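/- Let $\mathfrak g$ be a finite-dimensional semisimple complex Lie algebra of rank $l$, with Killing form $\kappa$ and adjoint group $G$ (the subgroup of $\mathrm{GL}(\mathfrak g)$ generated by the $\exp(\operatorname{ad}x)$, $x\in\mathfrak g$), and let $w(x,y,z)=\kappa([x,y],z)$. A linear subspace $W\subseteq\mathfrak g$ is a nullspace if $w$ vanishes on $W\times W\times W$, and a maximal nullspace if moreover it has the largest dimension among all nullspaces. Let $Y$ be the set of maximal nullspaces; $G$ acts on $Y$. A subalgebra of $\mathfrak g$ is parabolic if it contains a Borel subalgebra (a maximal solvable subalgebra). For $V\in Y$ put $\mathfrak p_V:=V+[V,V]$, where $[V,V]$ is the linear span of the brackets of elements of $V$. Then: (i) for every $V\in Y$, $\mathfrak p_V$ is a parabolic subalgebra of $\mathfrak g$ containing $V$, and it is contained in every parabolic subalgebra that contains $V$; (ii) if $V_1,V_2\in Y$ satisfy $\mathfrak p_{V_1}=\mathfrak p_{V_2}$, then $V_1$ and $V_2$ are conjugate under $G$. (iii) Moreover, $V_1,V_2\in Y$ are conjugate under $G$ if and only if $\mathfrak p_{V_1}$ and $\mathfrak p_{V_2}$ are conjugate under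 $G$, and every parabolic subalgebra of $\mathfrak g$ equals $\mathfrak p_V$ for some $V\in Y$. Hence $V\mapsto\mathfrak p_V$ induces a bijection from the set of $G$-orbits in $Y$ onto the set of $G$-conjugacy classes of parabolic subalgebras of $\mathfrak g$, and each of these two sets has exactly $2^l$ elements. -/

import Mathlib

open scoped Pointwise

namespace MaxNull

section

variable (g : Type*) [LieRing g] [LieAlgebra ℂ g]

/-- The invariant trilinear form `w(x, y, z) = κ([x, y], z)`, with `κ` the Killing form of `g`. -/
noncomputable def w (x y z : g) : ℂ :=
  killingForm ℂ g ⁅x, y⁆ z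

/-- `W` is a nullspace for `(g, w)`: the form `w` vanishes on `W × W × W`. -/
def IsNullspace (W : Submodule ℂ g) : Prop :=
  ∀ x ∈ W, ∀ y ∈ W, ∀ z ∈ W, w g x y z = 0

/-- The set `Y` of maximal nullspaces: the nullspaces of maximal dimension. -/
def Y : Set (Submodule ℂ g) :=
  {W | IsNullspace g W ∧
    ∀ U : Submodule ℂ g, IsNullspace g U → Module.finrank ℂ U ≤ Module.finrank ℂ W}

/-- `φ = exp (ad x)`: for every `v`, the series `∑ (ad x)ⁿ v / n!` converges to `φ v`. Convergence
in the finite-dimensional space `g` is convergence after applying each linear functional. -/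
def IsExpAd (x : g) (φ : g ≃ₗ[ℂ] g) : Prop :=
  ∀ (v : g) (f : Module.Dual ℂ g),
    HasSum (fun n : ℕ => ((n.factorial : ℂ))⁻¹ * f ((LieAlgebra.ad ℂ g x ^ n) v)) (f (φ v))

/-- The adjoint group of `g`: the subgroup of `GL(g)` generated by all `exp (ad x)`, `x ∈ g`.
It acts on subspaces of `g` by taking images. -/
def adjointGroup : Subgroup (g ≃ₗ[ℂ] g) :=
  Subgroup.closure {φ | ∃ x : g, IsExpAd g x φ}

/-- A Borel subalgebra: a maximal solvable Lie subalgebra. -/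
def IsBorel (b : LieSubalgebra ℂ g) : Prop :=
  Maximal (fun s : LieSubalgebra ℂ g => LieAlgebra.IsSolvable s) b

/-- A parabolic subalgebra: a Lie subalgebra containing a Borel subalgebra. -/
def IsParabolic (p : LieSubalgebra ℂ g) : Prop :=
  ∃ b : LieSubalgebra ℂ g, IsBorel g b ∧ b ≤ p

/-- The parabolic subalgebras, as a set of subspaces of `g`. -/
def parabolics : Set (Submodule ℂ g) :=
  {P | ∃ p : LieSubalgebra ℂ g, IsParabolic g p ∧ p.toSubmodule = P}

/-- The subspace `V + [V, V]`, where `[V, V]` is spanned by the brackets of elements of `V`. -/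
def pV (V : Submodule ℂ g) : Submodule ℂ g :=
  V ⊔ Submodule.span ℂ {z | ∃ x ∈ V, ∃ y ∈ V, ⁅x, y⁆ = z}

/-- The orbits under the adjoint group of the elements of a set `S` of subspaces of `g`. -/
def orbitsOf (S : Set (Submodule ℂ g)) : Set (Set (Submodule ℂ g)) :=
  (fun V => MulAction.orbit (adjointGroup g) V) '' S

end

end MaxNull

/-! Fix a Cartan subalgebra `H`, simple roots `Δ` and a Chevalley involution `θ`, equal to `-1` on
`H`. Let `b` be the Borel subalgebra and let `n₊`, `n₋` be the sums of the positive and of the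
negative root spaces. A subset `I` of `Δ` gives a standard parabolic `par I`, a Levi part plus a
nilradical, and a subspace `std I`: the `-1`-eigenspace of `θ` in the Levi part plus the nilradical.
It is null: the nilradical is orthogonal to `par I`, and a bracket of two `θ`-negated elements is
`θ`-fixed, hence orthogonal to a third one. Bracketing `std I` with `H` recovers all of `par I`
(`pV_std`). Everything therefore follows from two classifications: each maximal nullspace, and each
parabolic, is conjugate to exactly one standard one.

Nullspaces. Limits along one-parameter groups, a concrete form of Borel's fixed point theorem,
degenerate a nullspace to one stable under `n₊`, and such a nullspace lies in `b`
(`le_borel_of_isNullspace`). So the maximal dimension is `dim b`. As transversality to `n₋` is an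
open condition, some conjugate of a maximal nullspace is already transversal to `n₋`
(`exists_transversal`). A lower unipotent element then moves it so that it contains `H`
(`exists_isLower_H_le`), which forces it to be spanned by `H` and vectors `e r + c r • e (-r)`, `r`
positive (`exists_eq_graph`). Nullity expresses `c` at a sum of positive roots through its values at
the summands, so `c` is determined on `Δ`, and the torus rescales its nonzero values there freely.
Only the support `I` of `c` on `Δ` is left: the space is conjugate to `std I` (`exists_conj_std`).

Parabolics. The same limits, applied to `b` along an arbitrary Borel subalgebra, show that Borel
subalgebras are conjugate (`exists_conj_borel`), and the subalgebras containing `b` are the `par I`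
(`exists_eq_par`). To see that `par I` and `par J` are not conjugate for `I ≠ J`, correct the
conjugating element so that it preserves `b`. It then acts trivially on `b / n₊`
(`π_symm_of_map_borel`), because an entire family joins it to the identity and the relevant weights
take finitely many values. A linear form vanishing on `[par J, par J]` finally compares `I` with `J`
(`subset_of_map_par_eq`).

Minimality of `V + [V, V]` is immediate once it is known to be a parabolic subalgebra. -/

set_option linter.unusedSectionVars false

namespace MaxNull

/-! ### Brackets of root vectors. -/

section RootVectors

open LieAlgebra LieAlgebra.IsKilling LieModule

variable {g : Type*} [LieRing g] [LieAlgebra ℂ g] [FiniteDimensional ℂ g] [IsKilling ℂ g]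
  {H : LieSubalgebra ℂ g} [H.IsCartanSubalgebra]

/-- A nonzero vector of a one-dimensional root space spans it. -/
lemma exists_smul_of_mem_rootSpace {α : Weight ℂ H g} (hα : α.IsNonZero) {x y : g}
    (hx : x ∈ rootSpace H α) (hx0 : x ≠ 0) (hy : y ∈ rootSpace H α) : ∃ c : ℂ, y = c • x := by
  obtain ⟨c, hc⟩ := (finrank_eq_one_iff_of_nonzero' (⟨x, hx⟩ : rootSpace H α)
    (by simpa using hx0)).mp (finrank_rootSpace_eq_one α hα) ⟨y, hy⟩
  exact ⟨c, by simpa using (congrArg Subtype.val hc).symm⟩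

/-- The bracket of root vectors is nonzero when the sum of the roots is a root. -/
lemma lie_ne_zero_of_mem_rootSpace {α β γ : Weight ℂ H g} (hα : α.IsNonZero) (hβ : β.IsNonZero)
    (hγ : (γ : H → ℂ) = α + β) {x y : g} (hx : x ∈ rootSpace H α) (hy : y ∈ rootSpace H β)
    (hx0 : x ≠ 0) (hy0 : y ≠ 0) : ⁅x, y⁆ ≠ 0 := by
  -- `v` is a highest weight vector of the `α`-string through `β`. Since `α + β` is a root, `β` lies
  -- `k + 1 ≥ 1` steps below the top, so `y` is a multiple of `f ^ (k + 1) v`, and `e` raises this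
  -- back to `f ^ k v` with the nonzero factor `(k + 1) * (chainLength α β - k)`.
  obtain ⟨v, hv, v0⟩ := (chainTop α β).exists_ne_zero
  obtain ⟨h, e, f, isSl2, he, hf⟩ := exists_isSl2Triple_of_weight_isNonZero hα
  obtain rfl := isSl2.h_eq_coroot hα he hf
  have prim : isSl2.HasPrimitiveVectorWith v (chainLength α β : ℂ) :=
    have := lie_mem_genWeightSpace_of_mem_genWeightSpace he hv
    ⟨v0, (chainLength_smul _ _ hv).symm, by rwa [genWeightSpace_add_chainTop _ _ hα] at this⟩
  have hn : (1 : ℤ) ≤ chainTopCoeff α β := by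
    refine ((rootSpace_zsmul_add_ne_bot_iff α β hα 1).mp ?_).1
    rw [one_smul, ← hγ]; exact γ.2
  obtain ⟨k, hk⟩ : ∃ k : ℕ, chainTopCoeff α β = k + 1 := ⟨chainTopCoeff α β - 1, by omega⟩
  have hle : k + 1 ≤ chainLength α β := hk ▸ chainTopCoeff_le_chainLength α β
  have hmem : ((toEnd ℂ g g f) ^ (k + 1)) v ∈ rootSpace H β := by
    have := toEnd_pow_apply_mem hf hv (k + 1)
    convert this using 2
    rw [coe_chainTop', hk]
    simp
  have hne : ((toEnd ℂ g g f) ^ (k + 1)) v ≠ 0 := prim.pow_toEnd_f_ne_zero_of_eq_nat rfl hle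
  obtain ⟨c, rfl⟩ := exists_smul_of_mem_rootSpace hβ hmem hne hy
  obtain ⟨d, rfl⟩ := exists_smul_of_mem_rootSpace hα he isSl2.e_ne_zero hx
  have hc : c ≠ 0 := by rintro rfl; simp at hy0
  have hd : d ≠ 0 := by rintro rfl; simp at hx0
  rw [lie_smul, smul_lie, prim.lie_e_pow_succ_toEnd_f]
  have h1 : ((toEnd ℂ g g f) ^ k) v ≠ 0 := prim.pow_toEnd_f_ne_zero_of_eq_nat rfl (by omega)
  have h2 : ((k : ℂ) + 1) * ((chainLength α β : ℂ) - k) ≠ 0 := by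
    refine mul_ne_zero (Nat.cast_add_one_ne_zero k) (sub_ne_zero.mpr ?_)
    norm_cast
    omega
  exact smul_ne_zero hc (smul_ne_zero hd (smul_ne_zero h2 h1))

lemma lie_mem_rootSpace {α β γ : H → ℂ} (hγ : γ = α + β) {x y : g} (hx : x ∈ rootSpace H α)
    (hy : y ∈ rootSpace H β) : ⁅x, y⁆ ∈ rootSpace H γ :=
  hγ ▸ lie_mem_genWeightSpace_of_mem_genWeightSpace hx hy

end RootVectors

/-! ### The Chevalley involution, obtained from its graph in `g × g`. -/

section Involution

open LieAlgebra LieSubalgebra Set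

variable {ι g : Type*} [Fintype ι] [LieRing g] [LieAlgebra ℂ g] [FiniteDimensional ℂ g]
  {H : LieSubalgebra ℂ g} (b : LieAlgebra.Basis ι H)

/-- The graph of the Chevalley involution attached to a basis. -/
def chevalleyGraph : LieSubalgebra ℂ (g × g) :=
  .lieSpan _ _ (range (fun i => (b.e i, b.f i)) ∪ range (fun i => (b.f i, b.e i)))

lemma e_mem_chevalleyGraph (i : ι) : (b.e i, b.f i) ∈ chevalleyGraph b :=
  subset_lieSpan (Or.inl ⟨i, rfl⟩)

lemma f_mem_chevalleyGraph (i : ι) : (b.f i, b.e i) ∈ chevalleyGraph b :=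
  subset_lieSpan (Or.inr ⟨i, rfl⟩)

lemma h_mem_chevalleyGraph (i : ι) : (b.h i, -b.h i) ∈ chevalleyGraph b := by
  have := (chevalleyGraph b).lie_mem (e_mem_chevalleyGraph b i) (f_mem_chevalleyGraph b i)
  rw [LieAlgebra.Prod.bracket_apply] at this
  simp only [(b.sl2 i).lie_e_f] at this
  rwa [← lie_skew, (b.sl2 i).lie_e_f] at this

/-- The Cartan subalgebra of the graph of the Chevalley involution. -/
def chevalleyCartan : LieSubalgebra ℂ (chevalleyGraph b) :=
  .lieSpan _ _ (range (fun i => (⟨(b.h i, -b.h i), h_mem_chevalleyGraph b i⟩ : chevalleyGraph b)))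

/-- The basis of the graph of the Chevalley involution. -/
noncomputable def chevalleyBasis : LieAlgebra.Basis ι (chevalleyCartan b) where
  A := b.A
  h i := ⟨(b.h i, -b.h i), h_mem_chevalleyGraph b i⟩
  e i := ⟨(b.e i, b.f i), e_mem_chevalleyGraph b i⟩
  f i := ⟨(b.f i, b.e i), f_mem_chevalleyGraph b i⟩
  cartan_eq_lieSpan := rfl
  span_ef := by
    set E : ι → chevalleyGraph b := fun i => ⟨(b.e i, b.f i), e_mem_chevalleyGraph b i⟩
    set F : ι → chevalleyGraph b := fun i => ⟨(b.f i, b.e i), f_mem_chevalleyGraph b i⟩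
    have : range E ∪ range F = Subtype.val ⁻¹'
        (range (fun i => (b.e i, b.f i)) ∪ range (fun i => (b.f i, b.e i))) := by
      ext ⟨x, hx⟩
      simp [E, F, Subtype.ext_iff]
    rw [this]
    exact lieSpan_lieSpan_coe_preimage
  linInd := .of_comp (chevalleyGraph b).subtype <| .of_comp (LinearMap.fst ℂ g g) b.linInd
  nondegen := b.nondegen
  sl2 i :=
    { h_ne_zero := by simp [Subtype.ext_iff, (b.sl2 i).h_ne_zero]
      lie_e_f := by simp [Subtype.ext_iff, (b.sl2 i).lie_e_f, (b.sl2 i).symm.lie_e_f]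
      lie_h_e_nsmul := by
        simp [Subtype.ext_iff, (b.sl2 i).lie_h_e_nsmul, (b.sl2 i).lie_h_f_nsmul]
      lie_h_f_nsmul := by
        simp [Subtype.ext_iff, (b.sl2 i).lie_h_e_nsmul, (b.sl2 i).lie_h_f_nsmul] }
  lie_h_h i j := by simp [Subtype.ext_iff, b.lie_h_h]
  lie_h_e i j := by simp [Subtype.ext_iff, b.lie_h_e, b.lie_h_f]
  lie_h_f i j := by simp [Subtype.ext_iff, b.lie_h_e, b.lie_h_f]
  lie_e_f_ne i j hij := by
    have := b.lie_e_f_ne j i hij.symm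
    rw [← lie_skew, neg_eq_zero] at this
    simp [Subtype.ext_iff, b.lie_e_f_ne i j hij, this]

lemma swap_mem_chevalleyGraph {x : g × g} (hx : x ∈ chevalleyGraph b) :
    x.swap ∈ chevalleyGraph b := by
  have : (chevalleyGraph b) ≤ (chevalleyGraph b).comap
      (LieEquiv.prodComm ℂ g g : g × g →ₗ⁅ℂ⁆ g × g) := by
    refine lieSpan_le.mpr ?_
    rintro _ (⟨i, rfl⟩ | ⟨i, rfl⟩)
    · exact f_mem_chevalleyGraph b i
    · exact e_mem_chevalleyGraph b i
  exact this hx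

lemma exists_mem_chevalleyGraph (x : g) : ∃ y, (x, y) ∈ chevalleyGraph b := by
  have : (⊤ : LieSubalgebra ℂ g) ≤ (chevalleyGraph b).map (LieHom.fst ℂ g g) := by
    rw [← b.span_ef, lieSpan_le]
    rintro _ (⟨i, rfl⟩ | ⟨i, rfl⟩)
    · exact ⟨_, e_mem_chevalleyGraph b i, rfl⟩
    · exact ⟨_, f_mem_chevalleyGraph b i, rfl⟩
  obtain ⟨⟨_, y⟩, h, rfl⟩ := this (LieSubalgebra.mem_top x)
  exact ⟨y, h⟩

lemma mem_chevalleyCartan_of_fst_eq_zero {y : chevalleyGraph b} (hy : y ∈ chevalleyCartan b)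
    (h0 : (y : g × g).1 = 0) : y = 0 := by
  have hc := (chevalleyBasis b).coe_cartan_eq_span
  have hy' : y ∈ (chevalleyCartan b).toSubmodule := hy
  rw [hc] at hy'
  obtain ⟨c, rfl⟩ := (Submodule.mem_span_range_iff_exists_fun ℂ).mp hy'
  have h1 : ∑ i, c i • b.h i = 0 := by
    have : (LinearMap.fst ℂ g g ∘ₗ (chevalleyGraph b).subtype)
        (∑ i, c i • (chevalleyBasis b).h i) = 0 := h0
    rw [map_sum] at this
    simpa [chevalleyBasis] using this
  have := Fintype.linearIndependent_iff.mp b.linInd c h1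
  simp [this]

variable [IsKilling ℂ g]

/-- This makes the second coordinate a function of the first. The elements `y` form an ideal,
because the graph surjects onto the first factor and is stable under the swap. A nonzero ideal
contains a root space and with it a nonzero coroot in `H`. But if `x ∈ H` and `(0, x)` is in the
graph, then `(0, x)` commutes with the Cartan subalgebra of the graph, hence lies in it, and an
element of that Cartan subalgebra is determined by its first coordinate. -/
lemma eq_zero_of_zero_prod_mem_chevalleyGraph {y : g} (hy : (0, y) ∈ chevalleyGraph b) : y = 0 := by
  have := b.isCartanSubalgebra
  have := (chevalleyBasis b).isCartanSubalgebra
  let I : LieIdeal ℂ g :=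
    { carrier := {y | ((0 : g), y) ∈ chevalleyGraph b}
      add_mem' := fun {x y} hx hy => by simpa using (chevalleyGraph b).add_mem hx hy
      zero_mem' := (chevalleyGraph b).zero_mem
      smul_mem' := fun c x hx => by simpa using (chevalleyGraph b).smul_mem c hx
      lie_mem := fun {x m} hm => by
        obtain ⟨z, hz⟩ := exists_mem_chevalleyGraph b x
        have := (chevalleyGraph b).lie_mem (swap_mem_chevalleyGraph b hz) hm
        simpa [LieAlgebra.Prod.bracket_apply] using this }
  suffices hI : I = ⊥ by
    have : y ∈ I := hy
    rwa [hI, LieSubmodule.mem_bot] at this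
  have hH : ∀ x ∈ H, x ∈ I → x = 0 := by
    intro x hx hxI
    have hxI' : ((0 : g), x) ∈ chevalleyGraph b := hxI
    have hmem : (⟨(0, x), hxI'⟩ : chevalleyGraph b) ∈ chevalleyCartan b := by
      rw [← mem_toLieSubmodule, ← rootSpace_zero_eq, LieModule.mem_genWeightSpace]
      intro z
      refine ⟨1, ?_⟩
      obtain ⟨z, hz⟩ := z
      have hz' : z ∈ (chevalleyCartan b).toSubmodule := hz
      rw [(chevalleyBasis b).coe_cartan_eq_span] at hz'
      have key : ⁅z, (⟨(0, x), hxI'⟩ : chevalleyGraph b)⁆ = 0 := by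
        induction hz' using Submodule.span_induction with
        | mem u hu =>
          obtain ⟨i, rfl⟩ := hu
          have := b.isLieAbelian_cartan
          have h1 : ⁅b.h' i, (⟨x, hx⟩ : H)⁆ = 0 := trivial_lie_zero _ _ _ _
          have h2 : ⁅b.h i, x⁆ = 0 := by simpa [Subtype.ext_iff, Basis.h'] using h1
          simp [Subtype.ext_iff, chevalleyBasis, h2]
        | zero => simp
        | add u v hu hv hu' hv' =>
          rw [add_lie, hu' (by
              rw [← LieSubalgebra.mem_toSubmodule, (chevalleyBasis b).coe_cartan_eq_span]
              exact hu), hv' (by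
              rw [← LieSubalgebra.mem_toSubmodule, (chevalleyBasis b).coe_cartan_eq_span]
              exact hv), add_zero]
        | smul t u hu hu' =>
          rw [smul_lie, hu' (by
              rw [← LieSubalgebra.mem_toSubmodule, (chevalleyBasis b).coe_cartan_eq_span]
              exact hu), smul_zero]
      simpa using key
    have := mem_chevalleyCartan_of_fst_eq_zero b hmem rfl
    simpa [Subtype.ext_iff] using this
  have h1 := IsKilling.lieIdeal_eq_inf_cartan_sup_biSup_rootSpace (H := H) I
  have h2 : I.restr H ⊓ H.toLieSubmodule = ⊥ := by
    rw [LieSubmodule.eq_bot_iff]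
    intro x hx
    exact hH x hx.2 hx.1
  have h3 : ∀ α : H.root, ¬ rootSpace H α.val ≤ I.restr H := by
    intro α hα
    have h4 := I.corootSubmodule_le hα (IsKilling.coe_coroot_mem_corootSubmodule _)
    have h5 := hH _ (Subtype.property _) h4
    have h6 : IsKilling.coroot (α : LieModule.Weight ℂ H g) = 0 := Subtype.ext h5
    exact H.isNonZero_coe_root α (IsKilling.coroot_eq_zero_iff.mp h6)
  rw [h2] at h1
  simp only [h3, iSup_false, iSup_bot, sup_bot_eq] at h1
  have h7 : (I.restr H).toSubmodule = ⊥ := by rw [h1]; rfl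
  rw [← LieSubmodule.toSubmodule_inj]
  simpa using h7

/-- A Lie algebra with a basis has a Chevalley involution. -/
theorem exists_chevalley_involution (b : LieAlgebra.Basis ι H) :
    ∃ θ : g →ₗ⁅ℂ⁆ g, (∀ x, θ (θ x) = x) ∧ ∀ x ∈ H, θ x = -x := by
  have huniq : ∀ {x y z : g}, (x, y) ∈ chevalleyGraph b → (x, z) ∈ chevalleyGraph b → y = z := by
    intro x y z hy hz
    have := (chevalleyGraph b).sub_mem hy hz
    rw [Prod.mk_sub_mk, sub_self] at this
    exact sub_eq_zero.mp (eq_zero_of_zero_prod_mem_chevalleyGraph b this)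
  choose θ hθ using exists_mem_chevalleyGraph b
  refine ⟨{ toFun := θ
            map_add' := fun x y => huniq (hθ _) (by simpa using (chevalleyGraph b).add_mem (hθ x) (hθ y))
            map_smul' := fun c x => huniq (hθ _) (by simpa using (chevalleyGraph b).smul_mem c (hθ x))
            map_lie' := fun {x y} => huniq (hθ _) (by
              simpa [LieAlgebra.Prod.bracket_apply] using (chevalleyGraph b).lie_mem (hθ x) (hθ y)) },
    fun x => huniq (hθ _) (swap_mem_chevalleyGraph b (hθ x)), fun x hx => ?_⟩
  refine huniq (hθ x) ?_
  rw [← LieSubalgebra.mem_toSubmodule, b.coe_cartan_eq_span] at hx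
  induction hx using Submodule.span_induction with
  | mem u hu => obtain ⟨i, rfl⟩ := hu; exact h_mem_chevalleyGraph b i
  | zero => rw [neg_zero]; exact (chevalleyGraph b).zero_mem
  | add u v _ _ hu hv => simpa [add_comm] using (chevalleyGraph b).add_mem hu hv
  | smul t u _ hu => simpa using (chevalleyGraph b).smul_mem t hu

end Involution

end MaxNull

namespace MaxNull

/-! ### A Cartan subalgebra of dimension the rank, and generators from simple roots. -/

section ExistsBasis

open LieAlgebra LieAlgebra.IsKilling LieModule

variable {g : Type*} [LieRing g] [LieAlgebra ℂ g] [FiniteDimensional ℂ g] [IsKilling ℂ g]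

variable (g) in
/-- There is a Cartan subalgebra whose dimension is the rank. -/
lemma exists_isCartanSubalgebra_finrank_eq_rank :
    ∃ H : LieSubalgebra ℂ g, H.IsCartanSubalgebra ∧ Module.finrank ℂ H = LieAlgebra.rank ℂ g := by
  obtain ⟨x, hx⟩ := LieAlgebra.exists_isRegular ℂ g
  have hcard : (Module.finrank ℂ g : Cardinal) ≤ Cardinal.mk ℂ :=
    Cardinal.natCast_le_aleph0.trans <| Cardinal.infinite_iff.mp inferInstance
  have hrank := (isRegular_iff_finrank_engel_eq_rank ℂ x).mp hx
  refine ⟨LieSubalgebra.engel ℂ x, ⟨?_, LieSubalgebra.normalizer_engel _ _⟩, hrank⟩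
  apply LieSubalgebra.isNilpotent_of_forall_le_engel
  intro y hy
  set Ex : {LieSubalgebra.engel ℂ z | z ∈ LieSubalgebra.engel ℂ x} :=
    ⟨LieSubalgebra.engel ℂ x, x, LieSubalgebra.self_mem_engel _ _, rfl⟩
  suffices IsBot Ex from @this ⟨LieSubalgebra.engel ℂ y, y, hy, rfl⟩
  apply engel_isBot_of_isMin hcard (LieSubalgebra.engel ℂ x) Ex le_rfl
  rintro ⟨_, y, hy, rfl⟩ hyx
  -- Every Engel subalgebra has dimension at least the rank, so the one of a regular element is
  -- minimal.
  suffices Module.finrank ℂ (LieSubalgebra.engel ℂ x) ≤ Module.finrank ℂ (LieSubalgebra.engel ℂ y) by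
    suffices LieSubalgebra.engel ℂ y = LieSubalgebra.engel ℂ x from this.ge
    apply LieSubalgebra.toSubmodule_injective
    exact Submodule.eq_of_le_of_finrank_le hyx this
  rw [hrank]
  apply rank_le_finrank_engel

variable {H : LieSubalgebra ℂ g} [H.IsCartanSubalgebra]

/-- The negative of a root. -/
noncomputable def negRoot (r : H.root) : H.root :=
  ⟨-r.1, by
    have := H.isNonZero_coe_root r
    simpa [LieSubalgebra.root] using this⟩

lemma root_ext {r s : H.root} (h : ∀ x : H, r.1 x = s.1 x) : r = s :=
  Subtype.ext (LieModule.Weight.ext h)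

lemma exists_root_of_rootSpace_ne_bot {χ : H → ℂ} (h : rootSpace H χ ≠ ⊥) (h0 : χ ≠ 0) :
    ∃ t : H.root, (t.1 : H → ℂ) = χ := by
  refine ⟨⟨⟨χ, h⟩, ?_⟩, rfl⟩
  exact Finset.mem_filter.mpr ⟨Finset.mem_univ _, fun h => h0 h⟩

lemma eq_top_of_cartan_le_of_rootSpace_le {M : Submodule ℂ g} (hH : ∀ x ∈ H, x ∈ M)
    (hM : ∀ r : H.root, ∀ x ∈ rootSpace H r.1, x ∈ M) (x : g) : x ∈ M := by
  have h := congrArg LieSubmodule.toSubmodule (cartan_sup_iSup_rootSpace_eq_top (H := H))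
  rw [LieSubmodule.sup_toSubmodule, LieSubmodule.iSup_toSubmodule] at h
  have hle : (H.toLieSubmodule : Submodule ℂ g) ⊔ ⨆ α : Weight ℂ H g,
      ((⨆ (_ : α.IsNonZero), rootSpace H α : LieSubmodule ℂ H g) : Submodule ℂ g) ≤ M := by
    refine sup_le (fun x hx => hH x hx) (iSup_le fun α => ?_)
    rw [LieSubmodule.iSup_toSubmodule]
    exact iSup_le fun hα x hx => hM ⟨α, by simpa [LieSubalgebra.root] using hα⟩ x hx
  exact hle (h ▸ Submodule.mem_top)

variable (b : (rootSystem H).Base)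

lemma isPos_negRoot {r : H.root} : b.IsPos (negRoot r) ↔ ¬ b.IsPos r := by
  have := RootPairing.Base.IsPos.neg_iff_not b r
  convert this using 2
  refine root_ext fun x => ?_
  change (-r.1) x = ((rootSystem H).root ((rootSystem H).reflectionPerm r r)) x
  rw [RootPairing.root_reflectionPerm, RootPairing.reflection_apply_self]
  rfl

/-- The simple root vectors and their opposites generate. -/
lemma mem_lieSpan_of_simple {e f : H.root → g}
    (he : ∀ i ∈ b.support, e i ∈ rootSpace H i.1 ∧ f i ∈ rootSpace H (-i.1 : H → ℂ) ∧
      IsSl2Triple ((coroot i.1 : H) : g) (e i) (f i)) (x : g) :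
    x ∈ LieSubalgebra.lieSpan ℂ g ((e '' b.support) ∪ (f '' b.support)) := by
  set K := LieSubalgebra.lieSpan ℂ g ((e '' b.support) ∪ (f '' b.support))
  have heK : ∀ i ∈ b.support, e i ∈ K := fun i hi => LieSubalgebra.subset_lieSpan (Or.inl ⟨i, hi, rfl⟩)
  have hfK : ∀ i ∈ b.support, f i ∈ K := fun i hi => LieSubalgebra.subset_lieSpan (Or.inr ⟨i, hi, rfl⟩)
  -- Induction adding one simple root at a time. The root spaces of `r` and of `-r` are treated
  -- together, each being spanned by a bracket with a simple root vector or with its opposite.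
  have key : ∀ (r : H.root), b.IsPos r → (∀ x ∈ rootSpace H r.1, x ∈ K) ∧
      ∀ x ∈ rootSpace H (-r.1 : Weight ℂ H g), x ∈ K := by
    intro r hr
    refine hr.induction_on_add (p := fun r => (∀ x ∈ rootSpace H r.1, x ∈ K) ∧
      ∀ x ∈ rootSpace H (-r.1 : Weight ℂ H g), x ∈ K) ?_ ?_
    · intro i hi
      obtain ⟨h1, h2, h3⟩ := he i hi
      have hi0 := H.isNonZero_coe_root i
      refine ⟨fun x hx => ?_, fun x hx => ?_⟩
      · obtain ⟨c, rfl⟩ := exists_smul_of_mem_rootSpace hi0 h1 h3.e_ne_zero hx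
        exact K.smul_mem c (heK i hi)
      · obtain ⟨c, rfl⟩ := exists_smul_of_mem_rootSpace hi0.neg h2 h3.f_ne_zero hx
        exact K.smul_mem c (hfK i hi)
    · intro i j k hk ⟨ih1, ih2⟩ hj
      obtain ⟨h1, h2, h3⟩ := he j hj
      have hi0 := H.isNonZero_coe_root i
      have hj0 := H.isNonZero_coe_root j
      have hk0 := H.isNonZero_coe_root k
      have hk1 : (k.1 : H → ℂ) = i.1 + j.1 := by
        funext x
        exact LinearMap.congr_fun hk x
      have hk2 : ((-k.1 : Weight ℂ H g) : H → ℂ) = (-i.1 : Weight ℂ H g) + (-j.1 : Weight ℂ H g) := by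
        simp [hk1, add_comm]
      refine ⟨fun x hx => ?_, fun x hx => ?_⟩
      · obtain ⟨y, hy, hy0⟩ := i.1.exists_ne_zero
        have hne := lie_ne_zero_of_mem_rootSpace hi0 hj0 hk1 hy h1 hy0 h3.e_ne_zero
        obtain ⟨c, rfl⟩ := exists_smul_of_mem_rootSpace hk0 (lie_mem_rootSpace hk1 hy h1) hne hx
        exact K.smul_mem c (K.lie_mem (ih1 _ hy) (heK j hj))
      · obtain ⟨y, hy, hy0⟩ := (-i.1 : Weight ℂ H g).exists_ne_zero
        have hne := lie_ne_zero_of_mem_rootSpace hi0.neg hj0.neg hk2 hy h2 hy0 h3.f_ne_zero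
        obtain ⟨c, rfl⟩ := exists_smul_of_mem_rootSpace hk0.neg (lie_mem_rootSpace hk2 hy h2) hne hx
        exact K.smul_mem c (K.lie_mem (ih2 _ hy) (hfK j hj))
  refine eq_top_of_cartan_le_of_rootSpace_le (M := K.toSubmodule) (H := H) ?_ ?_ x
  · intro x hx
    have h1 : (⟨x, hx⟩ : H) ∈ Submodule.span ℂ (Set.range b.toCoweightBasis) := by
      rw [Module.Basis.span_eq]; trivial
    have h2 : Submodule.span ℂ (Set.range b.toCoweightBasis) ≤ K.toSubmodule.comap H.toSubmodule.subtype := by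
      rw [Submodule.span_le]
      rintro _ ⟨i, rfl⟩
      obtain ⟨h1, h2, h3⟩ := he i i.2
      rw [RootPairing.Base.toCoweightBasis_apply]
      change ((coroot i.1.1 : H) : g) ∈ K
      rw [← h3.lie_e_f]
      exact K.lie_mem (heK i i.2) (hfK i i.2)
    exact h2 h1
  · intro r x hx
    by_cases hr : b.IsPos r
    · exact (key r hr).1 x hx
    · refine (key _ ((isPos_negRoot b).mpr hr)).2 x ?_
      simpa [negRoot] using hx

/-- A base of the root system yields a basis of the Lie algebra in Mathlib's sense. -/
lemma nonempty_lieBasis : Nonempty (LieAlgebra.Basis b.support H) := by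
  classical
  have h1 : ∀ i : H.root, ∃ e f : g, e ∈ rootSpace H i.1 ∧ f ∈ rootSpace H (-i.1 : H → ℂ) ∧
      IsSl2Triple ((coroot i.1 : H) : g) e f := by
    intro i
    obtain ⟨h, e, f, h1, h2, h3⟩ := exists_isSl2Triple_of_weight_isNonZero (H.isNonZero_coe_root i)
    obtain rfl := h1.h_eq_coroot (H.isNonZero_coe_root i) h2 h3
    exact ⟨e, f, h2, h3, h1⟩
  choose e f he hf hsl using h1
  have hpair : ∀ i j : b.support, (b.cartanMatrix i j : ℂ) = i.1.1 (coroot j.1.1) := by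
    intro i j
    have := RootPairing.Base.algebraMap_cartanMatrixIn_apply ℤ b i j
    simpa using this
  refine ⟨
    { A := b.cartanMatrix
      h := fun i => ((coroot i.1.1 : H) : g)
      e := fun i => e i
      f := fun i => f i
      cartan_eq_lieSpan := ?_
      span_ef := ?_
      linInd := ?_
      nondegen := b.cartanMatrix_nondegenerate
      sl2 := fun i => hsl i
      lie_h_h := ?_
      lie_h_e := ?_
      lie_h_f := ?_
      lie_e_f_ne := ?_ }⟩
  · refine le_antisymm (fun x hx => ?_) (LieSubalgebra.lieSpan_le.mpr ?_)
    · have h1 : (⟨x, hx⟩ : H) ∈ Submodule.span ℂ (Set.range b.toCoweightBasis) := by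
        rw [Module.Basis.span_eq]; trivial
      have h2 : Submodule.span ℂ (Set.range b.toCoweightBasis) ≤
          (LieSubalgebra.lieSpan ℂ g (Set.range
            (fun i : b.support => ((coroot i.1.1 : H) : g)))).toSubmodule.comap H.toSubmodule.subtype := by
        rw [Submodule.span_le]
        rintro _ ⟨i, rfl⟩
        rw [RootPairing.Base.toCoweightBasis_apply]
        exact LieSubalgebra.subset_lieSpan ⟨i, rfl⟩
      exact h2 h1
    · rintro _ ⟨i, rfl⟩
      exact Subtype.property _
  · rw [eq_top_iff]
    intro x _
    have := mem_lieSpan_of_simple b (e := e) (f := f) (fun i _ => ⟨he i, hf i, hsl i⟩) x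
    convert this using 3
    · ext y; simp
    · ext y; simp
  · have h1 := b.toCoweightBasis.linearIndependent
    have h2 := h1.map' H.toSubmodule.subtype (Submodule.ker_subtype _)
    have h3 : (fun i : b.support => ((coroot i.1.1 : H) : g)) =
        H.toSubmodule.subtype ∘ b.toCoweightBasis := by
      funext i
      rw [Function.comp_apply, RootPairing.Base.toCoweightBasis_apply]
      rfl
    rw [h3]
    exact h2
  · intro i j
    have h1 : ⁅(coroot i.1.1 : H), (coroot j.1.1 : H)⁆ = 0 := trivial_lie_zero _ _ _ _
    simpa using congrArg Subtype.val h1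
  · intro i j
    have := lie_eq_smul_of_mem_rootSpace (he i) (coroot j.1.1 : H)
    rw [← hpair i j, Int.cast_smul_eq_zsmul] at this
    simpa using this
  · intro i j
    have := lie_eq_smul_of_mem_rootSpace (hf i) (coroot j.1.1 : H)
    rw [Pi.neg_apply, ← hpair i j, ← Int.cast_neg, Int.cast_smul_eq_zsmul] at this
    simpa using this
  · intro i j hij
    by_contra hne
    have hmem : ⁅e i, f j⁆ ∈ rootSpace H ((i.1.1 : H → ℂ) + (-j.1.1 : H → ℂ)) :=
      lie_mem_rootSpace rfl (he i) (hf j)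
    have hbot : rootSpace H ((i.1.1 : H → ℂ) + (-j.1.1 : H → ℂ)) ≠ ⊥ := by
      intro h
      rw [h, LieSubmodule.mem_bot] at hmem
      exact hne hmem
    have hzero : ((i.1.1 : H → ℂ) + (-j.1.1 : H → ℂ)) ≠ 0 := by
      intro h
      apply hij
      refine Subtype.ext (root_ext fun x => ?_)
      have := congrFun h x
      simpa [add_neg_eq_zero] using this
    obtain ⟨t, ht⟩ := exists_root_of_rootSpace_ne_bot hbot hzero
    refine b.sub_notMem_range_root i.2 j.2 ⟨t, ?_⟩
    ext x
    have := congrFun ht x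
    simpa [sub_eq_add_neg] using this

end ExistsBasis

end MaxNull

namespace MaxNull

-- Root frames: the structure theory reduced to linear algebra data.

universe u

/-- A root space decomposition of a semisimple Lie algebra with simple roots, fundamental
coweights and a Chevalley involution, unbundled into linear algebra data. -/
structure RootFrame (g : Type*) [LieRing g] [LieAlgebra ℂ g] [FiniteDimensional ℂ g]
    (R : Type*) [Fintype R] [DecidableEq R] where
  /-- the Cartan subalgebra -/
  H : Submodule ℂ g
  /-- root vectors -/
  e : R → g
  /-- projection to the Cartan subalgebra -/
  π : g →ₗ[ℂ] g
  /-- coefficients of the root vectors -/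
  coef : R → g →ₗ[ℂ] ℂ
  /-- the roots, extended by zero to the root spaces -/
  wt : R → g →ₗ[ℂ] ℂ
  /-- the opposite root -/
  neg : R → R
  /-- the simple roots -/
  Δ : Finset R
  /-- the fundamental coweights -/
  ϖ : R → g
  /-- coefficients of a root with respect to the simple roots -/
  n : R → R → ℤ
  /-- a Chevalley involution -/
  θ : g →ₗ⁅ℂ⁆ g
  π_mem : ∀ x, π x ∈ H
  π_of_mem : ∀ x ∈ H, π x = x
  π_e : ∀ r, π (e r) = 0
  coef_of_mem : ∀ r, ∀ x ∈ H, coef r x = 0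
  coef_e : ∀ r s, coef r (e s) = if r = s then 1 else 0
  expand : ∀ x, π x + ∑ r, coef r x • e r = x
  wt_e : ∀ r s, wt r (e s) = 0
  lie_H : ∀ x ∈ H, ∀ y ∈ H, ⁅x, y⁆ = 0
  lie_e : ∀ x ∈ H, ∀ r, ⁅x, e r⁆ = wt r x • e r
  neg_neg : ∀ r, neg (neg r) = r
  wt_neg : ∀ r x, wt (neg r) x = - wt r x
  lie_e_e : ∀ r s t, (∀ x ∈ H, wt r x + wt s x = wt t x) → ∃ N : ℂ, N ≠ 0 ∧ ⁅e r, e s⁆ = N • e t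
  lie_e_e_zero : ∀ r s, s ≠ neg r → (∀ t, ¬ ∀ x ∈ H, wt r x + wt s x = wt t x) → ⁅e r, e s⁆ = 0
  lie_e_neg_mem : ∀ r, ⁅e r, e (neg r)⁆ ∈ H
  wt_lie_e_neg : ∀ r, wt r ⁅e r, e (neg r)⁆ ≠ 0
  kill_e : ∀ r s, s ≠ neg r → killingForm ℂ g (e r) (e s) = 0
  kill_e_neg : ∀ r, killingForm ℂ g (e r) (e (neg r)) ≠ 0
  kill_H_e : ∀ x ∈ H, ∀ r, killingForm ℂ g x (e r) = 0
  exists_sep : ∃ z ∈ H, (∀ r, wt r z ≠ 0) ∧ ∀ r s, wt r z = wt s z → r = s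
  exists_ker : ∀ r s, r ≠ s → s ≠ neg r → ∃ h ∈ H, wt r h = 0 ∧ wt s h ≠ 0
  ϖ_mem : ∀ i, ϖ i ∈ H
  wt_ϖ : ∀ r, ∀ i ∈ Δ, wt r (ϖ i) = n r i
  n_simple : ∀ i ∈ Δ, ∀ j ∈ Δ, n i j = if i = j then 1 else 0
  ext_simple : ∀ h ∈ H, (∀ i ∈ Δ, wt i h = 0) → h = 0
  sign : ∀ r, (∀ i ∈ Δ, 0 ≤ n r i) ∨ (∀ i ∈ Δ, n r i ≤ 0)
  pos_cases : ∀ r, 0 < ∑ i ∈ Δ, n r i →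
    r ∈ Δ ∨ ∃ s, ∃ i ∈ Δ, 0 < ∑ j ∈ Δ, n s j ∧ ∀ x ∈ H, wt r x = wt s x + wt i x
  card_simple : Δ.card = LieAlgebra.rank ℂ g
  θ_θ : ∀ x, θ (θ x) = x
  θ_H : ∀ x ∈ H, θ x = -x

section ExistsFrame

open LieAlgebra LieAlgebra.IsKilling LieModule

variable {g : Type*} [LieRing g] [LieAlgebra ℂ g] [FiniteDimensional ℂ g] [IsKilling ℂ g]
variable {H : LieSubalgebra ℂ g} [H.IsCartanSubalgebra]

@[simp] lemma negRoot_apply (r : H.root) (x : H) : (negRoot r).1 x = - r.1 x := rfl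

lemma negRoot_negRoot (r : H.root) : negRoot (negRoot r) = r :=
  root_ext fun x => by simp

/-- The vector comes from an sl₂-triple, but the condition quantifies over all nonzero vectors of
the opposite root space. Root vectors for `r` and for `-r` can thus be chosen independently of each
other. -/
lemma exists_rootVector (r : H.root) : ∃ e ∈ rootSpace H r.1, e ≠ 0 ∧
    ∀ f ∈ rootSpace H (negRoot r).1, f ≠ 0 → ∃ c : ℂ, c ≠ 0 ∧ ⁅e, f⁆ = c • ((coroot r.1 : H) : g) := by
  have hr := H.isNonZero_coe_root r
  obtain ⟨h, e, f, h1, h2, h3⟩ := exists_isSl2Triple_of_weight_isNonZero hr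
  obtain rfl := h1.h_eq_coroot hr h2 h3
  refine ⟨e, h2, h1.e_ne_zero, fun f' hf' hf0 => ?_⟩
  obtain ⟨c, rfl⟩ := exists_smul_of_mem_rootSpace (α := (negRoot r).1)
    (H.isNonZero_coe_root (negRoot r)) (by exact h3) h1.f_ne_zero hf'
  refine ⟨c, fun h => hf0 (by simp [h]), ?_⟩
  rw [lie_smul, h1.lie_e_f]

/-- Modulo the kernel of `r`, every `x` is a multiple of the coroot of `r`; hence `s` is a multiple
of `r`, and the root system is reduced. -/
lemma wt_eq_smul_of_ker_le {r s : H.root} (h : ∀ x, r.1 x = 0 → s.1 x = 0) :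
    s = r ∨ s = negRoot r := by
  have hr := H.isNonZero_coe_root r
  have h2 := root_apply_coroot hr
  have key : (s.1 : H → ℂ) = (s.1 (coroot r.1) / 2) • (r.1 : H → ℂ) := by
    funext x
    have h1 := h (x - (r.1 x / 2) • coroot r.1) (by
      have : Weight.toLinear ℂ H g r.1 (x - (r.1 x / 2) • coroot r.1) = 0 := by
        rw [map_sub, map_smul]
        simp [h2]
      simpa using this)
    have h3 : Weight.toLinear ℂ H g s.1 (x - (r.1 x / 2) • coroot r.1) = 0 := h1
    rw [map_sub, map_smul] at h3
    simp only [Weight.toLinear_apply, smul_eq_mul] at h3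
    simp only [Pi.smul_apply, smul_eq_mul]
    linear_combination h3
  rcases eq_neg_or_eq_of_eq_smul r.1 s.1 (H.isNonZero_coe_root s) _ key with h | h
  · exact Or.inr (Subtype.ext h)
  · exact Or.inl (Subtype.ext h)

variable (H) in
lemma exists_separating : ∃ z : H, (∀ r : H.root, r.1 z ≠ 0) ∧
    ∀ r s : H.root, r.1 z = s.1 z → r = s := by
  classical
  let f : H.root ⊕ {p : H.root × H.root // p.1 ≠ p.2} → Module.Dual ℂ H :=
    Sum.elim (fun r => r.1.toLinear) (fun p => p.1.1.1.toLinear - p.1.2.1.toLinear)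
  obtain ⟨z, -, hz⟩ := Module.Dual.exists_forall_mem_ne_zero_of_forall_exists (⊤ : Submodule ℂ H) f
    (by
      rintro (r | ⟨⟨r, s⟩, hrs⟩)
      · refine ⟨coroot r.1, trivial, ?_⟩
        simp [f, root_apply_coroot (H.isNonZero_coe_root r)]
      · by_contra! hcon
        refine hrs (root_ext fun x => ?_)
        have := hcon x trivial
        simpa [f, sub_eq_zero] using this)
  refine ⟨z, fun r => by simpa [f] using hz (Sum.inl r), fun r s hrs => ?_⟩
  by_contra hne
  have := hz (Sum.inr ⟨(r, s), hne⟩)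
  simp [f, hrs] at this

/-- Projection to the Cartan subalgebra with given root vectors. -/
lemma exists_coordinates [DecidableEq H.root] {e : H.root → g}
    (he : ∀ r, e r ∈ rootSpace H r.1) (he0 : ∀ r, e r ≠ 0)
    (hk : ∀ r, killingForm ℂ g (e r) (e (negRoot r)) ≠ 0) :
    ∃ (π : g →ₗ[ℂ] H) (coef : H.root → g →ₗ[ℂ] ℂ), (∀ x : H, π x = x) ∧ (∀ r, π (e r) = 0) ∧
      (∀ r, ∀ x : H, coef r x = 0) ∧ (∀ r s, coef r (e s) = if r = s then 1 else 0) ∧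
      (∀ x, (π x : g) + ∑ r, coef r x • e r = x) ∧
      (∀ r s, s ≠ negRoot r → killingForm ℂ g (e r) (e s) = 0) ∧
      (∀ r, ∀ x : H, killingForm ℂ g x (e r) = 0) := by
  classical
  have kee : ∀ r s, s ≠ negRoot r → killingForm ℂ g (e r) (e s) = 0 := by
    intro r s hrs
    refine killingForm_apply_eq_zero_of_mem_rootSpace_of_add_ne_zero ℂ g H (he r) (he s) ?_
    intro h
    refine hrs (root_ext fun x => ?_)
    have := congrFun h x
    simp only [Pi.add_apply, Pi.zero_apply] at this
    rw [negRoot_apply]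
    linear_combination this
  have khe : ∀ r, ∀ x : H, killingForm ℂ g x (e r) = 0 := by
    intro r x
    have hx : (x : g) ∈ rootSpace H (0 : H → ℂ) := by
      rw [rootSpace_zero_eq]
      exact x.2
    refine killingForm_apply_eq_zero_of_mem_rootSpace_of_add_ne_zero ℂ g H hx (he r) ?_
    rw [zero_add]
    exact fun h => H.isNonZero_coe_root r h
  let coef : H.root → g →ₗ[ℂ] ℂ := fun r =>
    (killingForm ℂ g (e r) (e (negRoot r)))⁻¹ • (killingForm ℂ g).flip (e (negRoot r))
  have hcoef : ∀ r x, coef r x =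
      (killingForm ℂ g (e r) (e (negRoot r)))⁻¹ * killingForm ℂ g x (e (negRoot r)) :=
    fun r x => rfl
  have coefH : ∀ r, ∀ x : H, coef r x = 0 := fun r x => by rw [hcoef, khe, mul_zero]
  have coefe : ∀ r s, coef r (e s) = if r = s then 1 else 0 := by
    intro r s
    split_ifs with h
    · subst h; exact inv_mul_cancel₀ (hk _)
    · rw [hcoef, kee s, mul_zero]
      intro h'
      apply h
      rw [← negRoot_negRoot r, h', negRoot_negRoot]
  let π₀ : g →ₗ[ℂ] g := LinearMap.id - ∑ r, (coef r).smulRight (e r)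
  have hπ₀ : ∀ x, π₀ x = x - ∑ r, coef r x • e r := by
    intro x
    simp [π₀]
  have πH : ∀ x : H, π₀ x = x := fun x => by simp [hπ₀, coefH]
  have πe : ∀ r, π₀ (e r) = 0 := fun r => by simp [hπ₀, coefe]
  have hmem : ∀ x, π₀ x ∈ H.toSubmodule := by
    intro x
    refine eq_top_of_cartan_le_of_rootSpace_le (H := H) (M := H.toSubmodule.comap π₀) ?_ ?_ x
    · intro y hy
      rw [Submodule.mem_comap, πH ⟨y, hy⟩]
      exact hy
    · intro r y hy
      obtain ⟨c, rfl⟩ := exists_smul_of_mem_rootSpace (H.isNonZero_coe_root r) (he r) (he0 r) hy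
      rw [Submodule.mem_comap, map_smul, πe, smul_zero]
      exact zero_mem _
  refine ⟨π₀.codRestrict H.toSubmodule hmem, coef, ?_, ?_, coefH, coefe, ?_, kee, khe⟩
  · exact fun x => Subtype.ext (πH x)
  · exact fun r => Subtype.ext (πe r)
  · intro x
    rw [LinearMap.codRestrict_apply, hπ₀]
    abel

/-- A positive root pairs positively with some simple root `j`, so subtracting `j` gives a root
unless the two coincide. The height drops by one and is never zero, so it stays positive. -/
lemma pos_cases_of_base (b : (rootSystem H).Base) {r : H.root} (hr : b.IsPos r) :
    r ∈ b.support ∨ ∃ s, ∃ i ∈ b.support, b.IsPos s ∧ ∀ x, r.1 x = s.1 x + i.1 x := by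
  obtain ⟨j, hj, hj'⟩ := hr.exists_mem_support_pos_pairingIn
  rw [RootPairing.zero_lt_pairingIn_iff'] at hj'
  rcases eq_or_ne r j with rfl | hij
  · exact Or.inl hj
  obtain ⟨k, hk⟩ := (rootSystem H).root_sub_root_mem_of_pairingIn_pos hj' hij
  refine Or.inr ⟨k, j, hj, ?_, fun x => ?_⟩
  · have hkn : b.height k = b.height r - 1 := by
      rw [b.height_sub hk, RootPairing.Base.height_one_of_mem_support hj]
    rw [RootPairing.Base.isPos_iff'] at hr ⊢
    have h1 := b.height_ne_zero k
    have h2 := b.height_ne_zero r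
    lia
  · have := LinearMap.congr_fun hk x
    simp only [rootSystem_root_apply, LinearMap.sub_apply, Weight.toLinear_apply] at this
    linear_combination -this

lemma nonempty_rootFrame_of_base (b : (rootSystem H).Base) [DecidableEq H.root]
    (hH : Module.finrank ℂ H = LieAlgebra.rank ℂ g) : Nonempty (RootFrame g H.root) := by
  classical
  obtain ⟨B⟩ := nonempty_lieBasis b
  obtain ⟨θ, hθθ, hθH⟩ := exists_chevalley_involution B
  choose e he he0 hef using fun r : H.root => exists_rootVector r
  have hlen : ∀ r, ∃ c : ℂ, c ≠ 0 ∧ ⁅e r, e (negRoot r)⁆ = c • ((coroot r.1 : H) : g) :=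
    fun r => hef r _ (he _) (he0 _)
  have hcor : ∀ r : H.root, ((coroot r.1 : H) : g) ≠ 0 := by
    intro r h
    have h2 := root_apply_coroot (H.isNonZero_coe_root r)
    have h3 : coroot r.1 = 0 := Subtype.ext h
    have h4 : Weight.toLinear ℂ H g r.1 (coroot r.1) = 2 := h2
    rw [h3, map_zero] at h4
    norm_num at h4
  have hk : ∀ r, killingForm ℂ g (e r) (e (negRoot r)) ≠ 0 := by
    intro r h
    have h1 := lie_eq_killingForm_smul_of_mem_rootSpace_of_mem_rootSpace_neg (α := r.1)
      (he r) (f := e (negRoot r)) (by exact he (negRoot r))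
    obtain ⟨c, hc, hc2⟩ := hlen r
    rw [h, zero_smul, hc2] at h1
    exact (smul_ne_zero hc (hcor r)) h1
  obtain ⟨π, coef, h1, h2, h3, h4, h5, h6, h7⟩ := exists_coordinates he he0 hk
  choose f hf hfs hfr using b.exists_root_eq_sum_int
  have hht : ∀ r, b.height r = ∑ j ∈ b.support, f r j :=
    fun r => RootPairing.Base.height_eq_sum (hfr r)
  have hwt : ∀ r : H.root, ∀ x : H, r.1 x = ∑ j ∈ b.support, (f r j : ℂ) * j.1 x := by
    intro r x
    have := LinearMap.congr_fun (hfr r) x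
    simpa using this
  let D := b.toWeightBasis
  let ϖ : H.root → H := fun i =>
    if h : i ∈ b.support then (Module.evalEquiv ℂ H).symm (D.dualBasis ⟨i, h⟩) else 0
  have hϖ : ∀ i ∈ b.support, ∀ j ∈ b.support, j.1 (ϖ i) = if j = i then 1 else 0 := by
    intro i hi j hj
    have e1 : (Module.evalEquiv ℂ H) (ϖ i) = D.dualBasis ⟨i, hi⟩ := by
      simp [ϖ, hi]
    have e2 : (Module.evalEquiv ℂ H) (ϖ i) (D ⟨j, hj⟩) = j.1 (ϖ i) := by
      rw [Module.evalEquiv_apply, Module.Dual.eval_apply]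
      simp [D, RootPairing.Base.toWeightBasis_apply]
    rw [← e2, e1, Module.Basis.dualBasis_apply, Module.Basis.repr_self, Finsupp.single_apply]
    simp
  obtain ⟨z, hz1, hz2⟩ := exists_separating H
  have addmem : ∀ r s : H.root, ⁅e r, e s⁆ ∈ rootSpace H ((r.1 : H → ℂ) + s.1) :=
    fun r s => lie_mem_rootSpace rfl (he r) (he s)
  exact ⟨{
    H := H.toSubmodule
    e := e
    π := H.toSubmodule.subtype ∘ₗ π
    coef := coef
    wt := fun r => r.1.toLinear ∘ₗ π
    neg := negRoot
    Δ := b.support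
    ϖ := fun i => ϖ i
    n := f
    θ := θ
    π_mem := fun x => (π x).2
    π_of_mem := fun x hx => congrArg Subtype.val (h1 ⟨x, hx⟩)
    π_e := fun r => congrArg Subtype.val (h2 r)
    coef_of_mem := fun r x hx => h3 r ⟨x, hx⟩
    coef_e := h4
    expand := h5
    wt_e := fun r s => by rw [LinearMap.comp_apply, h2, map_zero]
    lie_H := fun x hx y hy => by
      have := trivial_lie_zero H H ⟨x, hx⟩ ⟨y, hy⟩
      exact congrArg Subtype.val this
    lie_e := fun x hx r => by
      have := lie_eq_smul_of_mem_rootSpace (he r) ⟨x, hx⟩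
      have h8 : π x = ⟨x, hx⟩ := h1 ⟨x, hx⟩
      simp only [LinearMap.comp_apply, h8]
      exact this
    neg_neg := negRoot_negRoot
    wt_neg := fun r x => rfl
    lie_e_e := fun r s t h => by
      have hk1 : (t.1 : H → ℂ) = r.1 + s.1 := by
        funext x
        have := h x x.2
        simpa [h1] using this.symm
      have h8 := lie_mem_rootSpace hk1 (he r) (he s)
      obtain ⟨c, hc⟩ := exists_smul_of_mem_rootSpace (H.isNonZero_coe_root t) (he t) (he0 t) h8
      refine ⟨c, fun h0 => ?_, hc⟩
      rw [h0, zero_smul] at hc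
      exact lie_ne_zero_of_mem_rootSpace (H.isNonZero_coe_root r) (H.isNonZero_coe_root s) hk1
        (he r) (he s) (he0 r) (he0 s) hc
    lie_e_e_zero := fun r s hrs h => by
      by_contra hne
      have hbot : rootSpace H ((r.1 : H → ℂ) + s.1) ≠ ⊥ := by
        intro h'
        have := addmem r s
        rw [h', LieSubmodule.mem_bot] at this
        exact hne this
      obtain ⟨t, ht⟩ := exists_root_of_rootSpace_ne_bot hbot (by
        intro h0
        refine hrs (root_ext fun x => ?_)
        have := congrFun h0 x
        simp only [Pi.add_apply, Pi.zero_apply] at this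
        rw [negRoot_apply]
        linear_combination this)
      refine h t fun x hx => ?_
      have h8 : π x = ⟨x, hx⟩ := h1 ⟨x, hx⟩
      have := congrFun ht ⟨x, hx⟩
      simp only [LinearMap.comp_apply, h8, Weight.toLinear_apply]
      exact this.symm
    lie_e_neg_mem := fun r => by
      obtain ⟨c, -, hc2⟩ := hlen r
      rw [hc2]
      exact H.smul_mem c (Subtype.property _)
    wt_lie_e_neg := fun r => by
      obtain ⟨c, hc, hc2⟩ := hlen r
      rw [hc2, map_smul, LinearMap.comp_apply, h1, Weight.toLinear_apply,
        root_apply_coroot (H.isNonZero_coe_root r)]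
      exact smul_ne_zero hc two_ne_zero
    kill_e := h6
    kill_e_neg := hk
    kill_H_e := fun x hx r => h7 r ⟨x, hx⟩
    exists_sep := ⟨z, z.2, fun r => by simpa [h1] using hz1 r, fun r s h => hz2 r s (by
      simpa [h1] using h)⟩
    exists_ker := fun r s hrs hs => by
      by_contra! hcon
      rcases wt_eq_smul_of_ker_le (r := r) (s := s) (fun x hx => by
        have := hcon x x.2
        simp only [LinearMap.comp_apply, h1, Weight.toLinear_apply] at this
        exact this hx) with h | h
      · exact hrs h.symm
      · exact hs h
    ϖ_mem := fun i => (ϖ i).2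
    wt_ϖ := fun r i hi => by
      rw [LinearMap.comp_apply, h1, Weight.toLinear_apply, hwt,
        Finset.sum_congr rfl fun j hj => by rw [hϖ i hi j hj]]
      simp [hi]
    n_simple := fun i hi j hj => by
      have := hwt i (ϖ j)
      rw [hϖ j hj i hi, Finset.sum_congr rfl fun k hk => by rw [hϖ j hj k hk]] at this
      simp only [mul_ite, mul_one, mul_zero, Finset.sum_ite_eq', hj, if_true] at this
      split_ifs at this ⊢ <;> exact_mod_cast this.symm
    ext_simple := fun h hh hi => by
      have h8 : π h = ⟨h, hh⟩ := h1 ⟨h, hh⟩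
      have h9 : (Module.evalEquiv ℂ H) ⟨h, hh⟩ = 0 := by
        refine D.ext fun i => ?_
        have := hi i i.2
        simp only [LinearMap.comp_apply, h8] at this
        rw [Module.evalEquiv_apply, Module.Dual.eval_apply, RootPairing.Base.toWeightBasis_apply]
        simpa using this
      rw [LinearEquiv.map_eq_zero_iff] at h9
      exact congrArg Subtype.val h9
    sign := fun r => by
      rcases hfs r with h | h
      · exact Or.inl fun i _ => h.le i
      · exact Or.inr fun i _ => h.le i
    pos_cases := fun r hr => by
      rw [← hht] at hr
      rcases pos_cases_of_base b ((RootPairing.Base.isPos_iff b).mpr hr) with h | ⟨s, i, hi, hs, hx⟩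
      · exact Or.inl h
      · refine Or.inr ⟨s, i, hi, ?_, fun x _ => by simpa using hx (π x)⟩
        rw [← hht]
        exact (RootPairing.Base.isPos_iff b).mp hs
    card_simple := by
      rw [← hH, ← Subspace.dual_finrank_eq, Module.finrank_eq_card_basis D, Fintype.card_coe]
    θ_θ := hθθ
    θ_H := fun x hx => hθH x hx }⟩

end ExistsFrame

/-- Every semisimple complex Lie algebra has a root frame. -/
lemma exists_rootFrame (g : Type u) [LieRing g] [LieAlgebra ℂ g] [FiniteDimensional ℂ g]
    [LieAlgebra.IsSemisimple ℂ g] :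
    ∃ (R : Type u) (_ : Fintype R) (_ : DecidableEq R), Nonempty (RootFrame g R) := by
  classical
  obtain ⟨H, hH, hr⟩ := exists_isCartanSubalgebra_finrank_eq_rank g
  obtain ⟨b⟩ := RootPairing.nonempty_base (LieAlgebra.IsKilling.rootSystem H)
  exact ⟨H.root, inferInstance, inferInstance, nonempty_rootFrame_of_base b hr⟩

end MaxNull

namespace MaxNull

/-! ### Exponentials of endomorphisms. -/

section ExpEnd

variable {V : Type*} [AddCommGroup V] [Module ℂ V] [FiniteDimensional ℂ V]
variable {W : Type*} [AddCommGroup W] [Module ℂ W] [FiniteDimensional ℂ W]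

/-- The exponential of an endomorphism of a finite-dimensional complex vector space. -/
noncomputable def expEnd (T : Module.End ℂ V) : Module.End ℂ V :=
  (LinearMap.toMatrixAlgEquiv (Module.finBasis ℂ V)).symm
    (NormedSpace.exp (LinearMap.toMatrixAlgEquiv (Module.finBasis ℂ V) T))

section

attribute [local instance] Matrix.linftyOpNormedRing Matrix.linftyOpNormedAlgebra

/-- Convergence is tested on linear functionals, so that no norm on `V` has to be chosen; the matrix
norm stays local to this section. -/
lemma hasSum_expEnd (T : Module.End ℂ V) (f : Module.Dual ℂ (Module.End ℂ V)) :
    HasSum (fun n : ℕ => ((n.factorial : ℂ))⁻¹ * f (T ^ n)) (f (expEnd T)) := by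
  let Φ := LinearMap.toMatrixAlgEquiv (Module.finBasis ℂ V)
  have h := NormedSpace.exp_series_hasSum_exp' (𝕂 := ℂ) (Φ T)
  let F : Matrix _ _ ℂ →ₗ[ℂ] ℂ := f ∘ₗ Φ.symm.toLinearMap
  have hF : Continuous F := LinearMap.continuous_of_finiteDimensional F
  have h2 := h.map F hF
  have h3 : (F : Matrix _ _ ℂ → ℂ) ∘ (fun n : ℕ => ((n.factorial : ℂ))⁻¹ • Φ T ^ n) =
      fun n : ℕ => ((n.factorial : ℂ))⁻¹ * f (T ^ n) := by
    funext n
    simp [F, ← map_pow]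
  rw [← h3]
  exact h2

lemma differentiable_expEnd_smul (T : Module.End ℂ V) (f : Module.Dual ℂ (Module.End ℂ V)) :
    Differentiable ℂ fun t : ℂ => f (expEnd (t • T)) := by
  let Φ := LinearMap.toMatrixAlgEquiv (Module.finBasis ℂ V)
  let F : Matrix _ _ ℂ →ₗ[ℂ] ℂ := f ∘ₗ Φ.symm.toLinearMap
  intro t
  have h := hasDerivAt_exp_smul_const (𝕂 := ℂ) (Φ T) t
  have h2 := (LinearMap.toContinuousLinearMap F).hasFDerivAt.comp_hasDerivAt t h
  have h3 : (fun t : ℂ => f (expEnd (t • T))) =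
      (LinearMap.toContinuousLinearMap F) ∘ fun u : ℂ => NormedSpace.exp (u • Φ T) := by
    funext u
    simp [F, expEnd, Φ]
  rw [h3]
  exact h2.differentiableAt

lemma expEnd_add_of_commute {S T : Module.End ℂ V} (h : Commute S T) :
    expEnd (S + T) = expEnd S * expEnd T := by
  rw [expEnd, map_add, Matrix.exp_add_of_commute, map_mul]
  · rfl
  · exact h.map (LinearMap.toMatrixAlgEquiv (Module.finBasis ℂ V))

end

lemma hasSum_expEnd_apply (T : Module.End ℂ V) (f : Module.Dual ℂ V) (v : V) :
    HasSum (fun n : ℕ => ((n.factorial : ℂ))⁻¹ * f ((T ^ n) v)) (f (expEnd T v)) :=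
  hasSum_expEnd T (f ∘ₗ LinearMap.applyₗ v)

lemma eq_of_forall_dual {v w : V} (h : ∀ f : Module.Dual ℂ V, f v = f w) : v = w := by
  rw [← sub_eq_zero, ← Module.forall_dual_apply_eq_zero_iff ℂ]
  intro f
  rw [map_sub, h, sub_self]

lemma mem_of_forall_dual {M : Submodule ℂ V} {v : V}
    (h : ∀ f : Module.Dual ℂ V, (∀ w ∈ M, f w = 0) → f v = 0) : v ∈ M := by
  by_contra hv
  obtain ⟨f, hf, hM⟩ := Submodule.exists_le_ker_of_notMem hv
  exact hf (h f fun w hw => hM hw)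

lemma expEnd_intertwine {S : Module.End ℂ V} {T : Module.End ℂ W} (A : V →ₗ[ℂ] W)
    (h : ∀ v, A (S v) = T (A v)) (v : V) : A (expEnd S v) = expEnd T (A v) := by
  have hpow : ∀ n : ℕ, A ((S ^ n) v) = (T ^ n) (A v) := by
    intro n
    induction n with
    | zero => simp
    | succ k ih => rw [pow_succ', pow_succ', Module.End.mul_apply, h, ih, Module.End.mul_apply]
  refine eq_of_forall_dual fun f => ?_
  have h1 := hasSum_expEnd_apply S (f ∘ₗ A) v
  have h2 := hasSum_expEnd_apply T f (A v)
  simp only [LinearMap.comp_apply, hpow] at h1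
  exact h1.unique h2

lemma expEnd_of_eigenvector {T : Module.End ℂ V} {v : V} {c : ℂ} (h : T v = c • v) :
    expEnd T v = Complex.exp c • v := by
  have hpow : ∀ n : ℕ, (T ^ n) v = c ^ n • v := by
    intro n
    induction n with
    | zero => simp
    | succ k ih => rw [pow_succ', Module.End.mul_apply, ih, map_smul, h, smul_smul, pow_succ]
  refine eq_of_forall_dual fun f => ?_
  have h1 := hasSum_expEnd_apply T f v
  have h2 := (NormedSpace.expSeries_div_hasSum_exp c).mul_right (f v)
  rw [← Complex.exp_eq_exp_ℂ] at h2
  rw [map_smul, smul_eq_mul]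
  refine h1.unique (h2.congr_fun ?_)
  intro n
  rw [hpow, map_smul, smul_eq_mul]
  ring

lemma pow_mem_of_stable {T : Module.End ℂ V} {M : Submodule ℂ V} (hM : ∀ w ∈ M, T w ∈ M) {v : V}
    (hv : v ∈ M) (n : ℕ) : (T ^ n) v ∈ M := by
  induction n with
  | zero => simpa
  | succ k ih => rw [pow_succ', Module.End.mul_apply]; exact hM _ ih

lemma expEnd_mem {T : Module.End ℂ V} {M : Submodule ℂ V} (hM : ∀ w ∈ M, T w ∈ M) {v : V}
    (hv : v ∈ M) : expEnd T v ∈ M := by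
  refine mem_of_forall_dual fun f hf => ?_
  have h1 := hasSum_expEnd_apply T f v
  have h2 : (fun n : ℕ => ((n.factorial : ℂ))⁻¹ * f ((T ^ n) v)) = fun _ => 0 := by
    funext n
    rw [hf _ (pow_mem_of_stable hM hv n), mul_zero]
  rw [h2] at h1
  exact h1.unique hasSum_zero

/-- Second order expansion of the exponential modulo a stable subspace. -/
lemma expEnd_sub_sub_mem {T : Module.End ℂ V} {M : Submodule ℂ V} (hM : ∀ w ∈ M, T w ∈ M) {v : V}
    (hv : T (T v) ∈ M) : expEnd T v - v - T v ∈ M := by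
  refine mem_of_forall_dual fun f hf => ?_
  have h1 := hasSum_expEnd_apply T f v
  have h2 : HasSum (fun n : ℕ => ((n.factorial : ℂ))⁻¹ * f ((T ^ n) v))
      (∑ n ∈ Finset.range 2, ((n.factorial : ℂ))⁻¹ * f ((T ^ n) v)) := by
    refine hasSum_sum_of_ne_finset_zero fun n hn => ?_
    obtain ⟨k, rfl⟩ := Nat.exists_eq_add_of_le' (not_lt.mp (Finset.mem_range.not.mp hn))
    have : (T ^ (k + 2)) v = (T ^ k) (T (T v)) := by
      rw [pow_add, Module.End.mul_apply, pow_two, Module.End.mul_apply]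
    rw [this, hf _ (pow_mem_of_stable hM hv k), mul_zero]
  have h3 := h1.unique h2
  rw [map_sub, map_sub, h3]
  simp [Finset.sum_range_succ]

lemma expEnd_sub_mem {T : Module.End ℂ V} {M : Submodule ℂ V} (hM : ∀ w ∈ M, T w ∈ M) {v : V}
    (hv : T v ∈ M) : expEnd T v - v ∈ M := by
  have := M.add_mem (expEnd_sub_sub_mem hM (hM _ hv)) hv
  simpa using this

@[simp] lemma expEnd_zero : expEnd (0 : Module.End ℂ V) = 1 := by
  ext v
  rw [expEnd_of_eigenvector (c := 0) (by simp)]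
  simp

/-- The exponential as an invertible map. -/
noncomputable def expEquiv (T : Module.End ℂ V) : V ≃ₗ[ℂ] V :=
  LinearEquiv.ofLinearMap (expEnd T) (expEnd (-T))
    (by
      change expEnd T * expEnd (-T) = 1
      rw [← expEnd_add_of_commute (Commute.refl T).neg_right]
      simp)
    (by
      change expEnd (-T) * expEnd T = 1
      rw [← expEnd_add_of_commute (Commute.refl T).neg_left]
      simp)

lemma expEquiv_inv (T : Module.End ℂ V) : (expEquiv T)⁻¹ = expEquiv (-T) := by
  ext v
  rfl

end ExpEnd

/-! ### The adjoint group and entire paths in it. -/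

section AdjointGroup

variable {g : Type*} [LieRing g] [LieAlgebra ℂ g] [FiniteDimensional ℂ g]

/-- On `g ⊗ g` the maps `D ⊗ 1` and `1 ⊗ D` commute, so the exponential of their sum is the product
of their exponentials; the bracket `g ⊗ g → g` intertwines that sum with `D`. -/
lemma expEnd_derivation {D : Module.End ℂ g} (hD : ∀ a b : g, D ⁅a, b⁆ = ⁅D a, b⁆ + ⁅a, D b⁆)
    (a b : g) : expEnd D ⁅a, b⁆ = ⁅expEnd D a, expEnd D b⁆ := by
  let S : Module.End ℂ (TensorProduct ℂ g g) := LinearMap.rTensor g D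
  let T : Module.End ℂ (TensorProduct ℂ g g) := LinearMap.lTensor g D
  let A : TensorProduct ℂ g g →ₗ[ℂ] g := (LieModule.toModuleHom ℂ g g : TensorProduct ℂ g g →ₗ[ℂ] g)
  have hA : ∀ v, A ((S + T) v) = D (A v) := by
    intro v
    induction v using TensorProduct.induction_on with
    | zero => simp
    | tmul x y => simp [A, S, T, hD]
    | add x y hx hy => rw [map_add, map_add, hx, hy, map_add, map_add]
  have hcomm : Commute S T := by
    refine TensorProduct.ext' fun x y => ?_
    simp [S, T]
  have h1 := expEnd_intertwine A hA (a ⊗ₜ b)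
  rw [expEnd_add_of_commute hcomm, Module.End.mul_apply] at h1
  have h2 : expEnd T (a ⊗ₜ[ℂ] b) = a ⊗ₜ[ℂ] (expEnd D b) :=
    (expEnd_intertwine (S := D) (T := T) (TensorProduct.mk ℂ g g a) (fun v => by simp [T]) b).symm
  have h3 : expEnd S (a ⊗ₜ[ℂ] (expEnd D b)) = (expEnd D a) ⊗ₜ[ℂ] (expEnd D b) :=
    (expEnd_intertwine (S := D) (T := S) ((TensorProduct.mk ℂ g g).flip (expEnd D b))
      (fun v => by simp [S]) a).symm
  rw [h2, h3] at h1
  simpa [A] using h1.symm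

/-- `exp (ad x)`. -/
noncomputable def expAd (x : g) : g ≃ₗ[ℂ] g := expEquiv (LieAlgebra.ad ℂ g x)

lemma expAd_apply (x v : g) : expAd x v = expEnd (LieAlgebra.ad ℂ g x) v := rfl

lemma isExpAd_expAd (x : g) : IsExpAd g x (expAd x) :=
  fun v f => hasSum_expEnd_apply _ f v

lemma isExpAd_iff {x : g} {φ : g ≃ₗ[ℂ] g} : IsExpAd g x φ ↔ φ = expAd x := by
  refine ⟨fun h => ?_, fun h => h ▸ isExpAd_expAd x⟩
  ext v
  exact eq_of_forall_dual fun f => (h v f).unique (isExpAd_expAd x v f)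

lemma expAd_mem_adjointGroup (x : g) : expAd x ∈ adjointGroup g :=
  Subgroup.subset_closure ⟨x, isExpAd_expAd x⟩

lemma expAd_inv (x : g) : (expAd x)⁻¹ = expAd (-x) := by
  rw [expAd, expEquiv_inv, expAd, map_neg]

lemma expAd_lie (x a b : g) : expAd x ⁅a, b⁆ = ⁅expAd x a, expAd x b⁆ :=
  expEnd_derivation (fun a b => by simp) a b

lemma expAd_mem {x : g} {M : Submodule ℂ g} (hM : ∀ w ∈ M, ⁅x, w⁆ ∈ M) {v : g} (hv : v ∈ M) :
    expAd x v ∈ M := expEnd_mem hM hv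

lemma expAd_sub_mem {x : g} {M : Submodule ℂ g} (hM : ∀ w ∈ M, ⁅x, w⁆ ∈ M) {v : g}
    (hv : ⁅x, v⁆ ∈ M) : expAd x v - v ∈ M := expEnd_sub_mem hM hv

lemma expAd_sub_sub_mem {x : g} {M : Submodule ℂ g} (hM : ∀ w ∈ M, ⁅x, w⁆ ∈ M) {v : g}
    (hv : ⁅x, ⁅x, v⁆⁆ ∈ M) : expAd x v - v - ⁅x, v⁆ ∈ M := expEnd_sub_sub_mem hM hv

lemma expAd_of_eigenvector {x v : g} {c : ℂ} (h : ⁅x, v⁆ = c • v) :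
    expAd x v = Complex.exp c • v := expEnd_of_eigenvector h

@[elab_as_elim]
lemma adjointGroup_induction {p : (φ : g ≃ₗ[ℂ] g) → φ ∈ adjointGroup g → Prop}
    (one : p 1 (one_mem _)) (expAd : ∀ x, p (expAd x) (expAd_mem_adjointGroup x))
    (mul : ∀ φ ψ hφ hψ, p φ hφ → p ψ hψ → p (φ * ψ) (mul_mem hφ hψ))
    {φ : g ≃ₗ[ℂ] g} (hφ : φ ∈ adjointGroup g) : p φ hφ := by
  induction hφ using Subgroup.closure_induction'' with
  | mem φ h =>
    obtain ⟨x, hx⟩ := h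
    rw [isExpAd_iff] at hx
    subst hx
    exact expAd x
  | inv_mem φ h =>
    obtain ⟨x, hx⟩ := h
    rw [isExpAd_iff] at hx
    have h2 : φ⁻¹ = MaxNull.expAd (-x) := by rw [hx, expAd_inv]
    simp only [h2]
    exact expAd (-x)
  | one => exact one
  | mul φ ψ hφ hψ h1 h2 => exact mul φ ψ hφ hψ h1 h2

lemma map_lie_of_mem_adjointGroup {φ : g ≃ₗ[ℂ] g} (hφ : φ ∈ adjointGroup g) (a b : g) :
    φ ⁅a, b⁆ = ⁅φ a, φ b⁆ := by
  induction hφ using adjointGroup_induction generalizing a b with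
  | one => rfl
  | expAd x => exact expAd_lie x a b
  | mul φ ψ _ _ h1 h2 => rw [LinearEquiv.mul_apply, h2, h1]; rfl

/-- An entire family of endomorphisms. -/
def IsEntire (A : ℂ → Module.End ℂ g) : Prop :=
  ∀ (f : Module.Dual ℂ g) (v : g), Differentiable ℂ fun t => f (A t v)

lemma IsEntire.mul {A B : ℂ → Module.End ℂ g} (hA : IsEntire A) (hB : IsEntire B) :
    IsEntire fun t => A t * B t := by
  intro f v
  let b := Module.finBasis ℂ g
  have h : (fun t => f ((A t * B t) v)) = fun t => ∑ i, (b.coord i (B t v)) * f (A t (b i)) := by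
    funext t
    rw [Module.End.mul_apply]
    conv_lhs => rw [← b.sum_repr (B t v)]
    simp only [map_sum, map_smul, smul_eq_mul]
    rfl
  rw [h]
  exact Differentiable.fun_sum fun i _ => (hB (b.coord i) v).mul (hA f (b i))

/-- Elements of the adjoint group are joined to the identity by entire families. -/
lemma exists_path {φ : g ≃ₗ[ℂ] g} (hφ : φ ∈ adjointGroup g) :
    ∃ A : ℂ → (g ≃ₗ[ℂ] g), A 0 = 1 ∧ A 1 = φ ∧ (∀ t, A t ∈ adjointGroup g) ∧
      IsEntire fun t => (A t : Module.End ℂ g) := by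
  induction hφ using adjointGroup_induction with
  | one => exact ⟨fun _ => 1, rfl, rfl, fun _ => one_mem _, fun f v => differentiable_const _⟩
  | expAd x =>
    refine ⟨fun t => expAd (t • x), ?_, by simp, fun t => expAd_mem_adjointGroup _, fun f v => ?_⟩
    · ext v
      simp [expAd_apply]
    · have := differentiable_expEnd_smul (LieAlgebra.ad ℂ g x) (f ∘ₗ LinearMap.applyₗ v)
      simpa [expAd_apply] using this
  | mul φ ψ _ _ h1 h2 =>
    obtain ⟨A, hA0, hA1, hAG, hA⟩ := h1
    obtain ⟨B, hB0, hB1, hBG, hB⟩ := h2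
    refine ⟨fun t => A t * B t, by simp [hA0, hB0], by simp [hA1, hB1],
      fun t => mul_mem (hAG t) (hBG t), ?_⟩
    exact hA.mul hB

end AdjointGroup

end MaxNull

namespace MaxNull

open Filter Topology

/-! ### Limits of sequences of subspaces. -/

section Limits

variable {V : Type*} [AddCommGroup V] [Module ℂ V] [FiniteDimensional ℂ V]
variable {W : Type*} [AddCommGroup W] [Module ℂ W] [FiniteDimensional ℂ W]

/-- Convergence of a sequence in a finite-dimensional space. -/
def DTendsto (p : ℕ → V) (a : V) : Prop :=
  ∀ f : Module.Dual ℂ V, Tendsto (fun n => f (p n)) atTop (𝓝 (f a))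

lemma DTendsto.map {p : ℕ → V} {a : V} (h : DTendsto p a) (L : V →ₗ[ℂ] W) :
    DTendsto (fun n => L (p n)) (L a) := fun f => h (f ∘ₗ L)

lemma DTendsto.add {p q : ℕ → V} {a b : V} (hp : DTendsto p a) (hq : DTendsto q b) :
    DTendsto (fun n => p n + q n) (a + b) := fun f => by
  simpa using (hp f).add (hq f)

lemma DTendsto.smul {p : ℕ → V} {a : V} (hp : DTendsto p a) (c : ℂ) :
    DTendsto (fun n => c • p n) (c • a) := fun f => by
  simpa using (hp f).const_mul c

lemma DTendsto.const (a : V) : DTendsto (fun _ => a) a := fun _ => tendsto_const_nhds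

lemma DTendsto.unique {p : ℕ → V} {a b : V} (ha : DTendsto p a) (hb : DTendsto p b) : a = b :=
  eq_of_forall_dual fun f => tendsto_nhds_unique (ha f) (hb f)

lemma DTendsto.bilinForm {p : ℕ → V} {q : ℕ → W} {a : V} {b : W} (hp : DTendsto p a)
    (hq : DTendsto q b) (β : V →ₗ[ℂ] W →ₗ[ℂ] ℂ) :
    Tendsto (fun n => β (p n) (q n)) atTop (𝓝 (β a b)) := by
  let B := Module.finBasis ℂ V
  have h : ∀ x y, β x y = ∑ i, B.coord i x * β (B i) y := by
    intro x y
    conv_lhs => rw [← B.sum_repr x]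
    simp only [map_sum, map_smul, LinearMap.sum_apply, LinearMap.smul_apply, smul_eq_mul]
    rfl
  rw [h a b, funext fun n => h (p n) (q n)]
  exact tendsto_finsetSum _ fun i _ => (hp (B.coord i)).mul (hq (β (B i)))

lemma DTendsto.bilin {U : Type*} [AddCommGroup U] [Module ℂ U] {p : ℕ → V} {q : ℕ → W} {a : V}
    {b : W} (hp : DTendsto p a) (hq : DTendsto q b) (β : V →ₗ[ℂ] W →ₗ[ℂ] U) :
    DTendsto (fun n => β (p n) (q n)) (β a b) := fun f =>
  hp.bilinForm hq (β.compr₂ f)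

/-- The lower limit of a sequence of subspaces. -/
def limitSpace (U : ℕ → Submodule ℂ V) : Submodule ℂ V where
  carrier := {w | ∃ p : ℕ → V, (∀ n, p n ∈ U n) ∧ DTendsto p w}
  add_mem' := by
    rintro a b ⟨p, hp, hp'⟩ ⟨q, hq, hq'⟩
    exact ⟨fun n => p n + q n, fun n => add_mem (hp n) (hq n), hp'.add hq'⟩
  zero_mem' := ⟨fun _ => 0, fun n => zero_mem _, DTendsto.const 0⟩
  smul_mem' := by
    rintro c a ⟨p, hp, hp'⟩
    exact ⟨fun n => c • p n, fun n => (U n).smul_mem c (hp n), hp'.smul c⟩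

lemma map_mem_limitSpace {U U' : ℕ → Submodule ℂ V} (L : V →ₗ[ℂ] V)
    (h : ∀ n, ∀ x ∈ U n, L x ∈ U' n) {x : V} (hx : x ∈ limitSpace U) : L x ∈ limitSpace U' := by
  obtain ⟨p, hp, hp'⟩ := hx
  exact ⟨fun n => L (p n), fun n => h n _ (hp n), hp'.map L⟩

lemma bilin_mem_limitSpace {U U' U'' : ℕ → Submodule ℂ V} (β : V →ₗ[ℂ] V →ₗ[ℂ] V)
    (h : ∀ n, ∀ x ∈ U n, ∀ y ∈ U' n, β x y ∈ U'' n) {x y : V} (hx : x ∈ limitSpace U)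
    (hy : y ∈ limitSpace U') : β x y ∈ limitSpace U'' := by
  obtain ⟨p, hp, hp'⟩ := hx
  obtain ⟨q, hq, hq'⟩ := hy
  exact ⟨fun n => β (p n) (q n), fun n => h n _ (hp n) _ (hq n), hp'.bilin hq' β⟩

lemma map_mem_limitSpace_of_shift {U : ℕ → Submodule ℂ V} (L : V →ₗ[ℂ] V)
    (h : ∀ n, ∀ x ∈ U n, L x ∈ U (n + 1)) {x : V} (hx : x ∈ limitSpace U) :
    L x ∈ limitSpace U := by
  obtain ⟨p, hp, hp'⟩ := hx
  -- The sequence delayed by one place; its initial term `0` does not affect the limit.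
  refine ⟨fun n => Nat.casesOn n 0 fun k => L (p k), fun n => ?_, fun f => ?_⟩
  · cases n with
    | zero => exact zero_mem _
    | succ k => exact h k _ (hp k)
  · rw [← tendsto_add_atTop_iff_nat 1]
    exact (hp'.map L) f

lemma dtendsto_leading {t : ℕ → ℂ} (ht0 : ∀ n, t n ≠ 0) (ht : Tendsto (fun n => (t n)⁻¹) atTop (𝓝 0))
    (u : ℕ → V) (D : ℕ) :
    DTendsto (fun n => (t n ^ D)⁻¹ • ∑ i ∈ Finset.range (D + 1), t n ^ i • u i) (u D) := by
  intro f
  have h : (fun n => f ((t n ^ D)⁻¹ • ∑ i ∈ Finset.range (D + 1), t n ^ i • u i)) =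
      fun n => ∑ i ∈ Finset.range (D + 1), (t n)⁻¹ ^ (D - i) * f (u i) := by
    funext n
    rw [map_smul, map_sum, smul_eq_mul, Finset.mul_sum]
    refine Finset.sum_congr rfl fun i hi => ?_
    rw [map_smul, smul_eq_mul, ← mul_assoc]
    congr 1
    have hi' : i ≤ D := Nat.lt_succ_iff.mp (Finset.mem_range.mp hi)
    have : t n ^ D = t n ^ (D - i) * t n ^ i := by rw [← pow_add, Nat.sub_add_cancel hi']
    rw [this, inv_pow]
    field_simp [ht0 n]
  rw [h]
  have h2 : f (u D) = ∑ i ∈ Finset.range (D + 1), (0 : ℂ) ^ (D - i) * f (u i) := by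
    rw [Finset.sum_range_succ, Finset.sum_eq_zero]
    · simp
    · intro i hi
      rw [zero_pow, zero_mul]
      have := Finset.mem_range.mp hi
      omega
  rw [h2]
  exact tendsto_finsetSum _ fun i _ => (ht.pow _).mul_const _

/-- If a polynomial family of vectors is nonzero, its leading coefficient is a limit. -/
lemma exists_leading {t : ℕ → ℂ} (ht0 : ∀ n, t n ≠ 0)
    (ht : Tendsto (fun n => (t n)⁻¹) atTop (𝓝 0)) (u : ℕ → V) (N : ℕ) (hu : ∃ i < N, u i ≠ 0) :
    ∃ D < N, u D ≠ 0 ∧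
      DTendsto (fun n => (t n ^ D)⁻¹ • ∑ i ∈ Finset.range N, t n ^ i • u i) (u D) := by
  classical
  have hne : ((Finset.range N).filter fun i => u i ≠ 0).Nonempty := by
    obtain ⟨i, hi, hi'⟩ := hu
    exact ⟨i, by simp [hi, hi']⟩
  set D := ((Finset.range N).filter fun i => u i ≠ 0).max' hne with hD
  have hDmem := Finset.max'_mem _ hne
  rw [← hD, Finset.mem_filter, Finset.mem_range] at hDmem
  refine ⟨D, hDmem.1, hDmem.2, ?_⟩
  have h := dtendsto_leading ht0 ht u D
  have hsum : ∀ n, ∑ i ∈ Finset.range N, t n ^ i • u i =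
      ∑ i ∈ Finset.range (D + 1), t n ^ i • u i := by
    intro n
    symm
    refine Finset.sum_subset (Finset.range_mono hDmem.1) fun i hi hi' => ?_
    have : u i = 0 := by
      by_contra hne'
      have := Finset.le_max' ((Finset.range N).filter fun i => u i ≠ 0) i
        (Finset.mem_filter.mpr ⟨hi, hne'⟩)
      rw [Finset.mem_range] at hi'
      omega
    rw [this, smul_zero]
  simpa only [hsum] using h

/-- Dimension does not drop when passing to the limit of a polynomial family of subspaces. -/
lemma finrank_le_finrank_limitSpace {t : ℕ → ℂ} (ht0 : ∀ n, t n ≠ 0)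
    (ht : Tendsto (fun n => (t n)⁻¹) atTop (𝓝 0)) {N : ℕ} (A : Fin (N + 1) → Module.End ℂ V)
    (hA : ∀ n, Function.Injective (∑ k : Fin (N + 1), t n ^ (k : ℕ) • A k : Module.End ℂ V))
    (U : Submodule ℂ V) {U' : ℕ → Submodule ℂ V}
    (hU' : ∀ n, ∀ x ∈ U, (∑ k : Fin (N + 1), t n ^ (k : ℕ) • A k : Module.End ℂ V) x ∈ U' n) :
    Module.finrank ℂ U ≤ Module.finrank ℂ (limitSpace U') := by
  classical
  set W := limitSpace U' with hW
  obtain ⟨q, hq⟩ := LinearMap.exists_leftInverse_of_injective W.subtype (Submodule.ker_subtype W)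
  -- Dimension count on polynomials in `t` of degree at most `K` with coefficients in `U`. Applying
  -- the family, which has degree `N` in `t`, gives polynomials of degree at most `K + N`, with
  -- coefficients `C i v`. The comparison is asymptotic in `K`, so the loss of `N` is harmless.
  have key : ∀ K : ℕ, Module.finrank ℂ U * (K + 1) ≤ Module.finrank ℂ W * (K + N + 1) := by
    intro K
    let C : ℕ → (Fin (K + 1) → U) →ₗ[ℂ] V := fun i =>
      ∑ p ∈ (Finset.univ : Finset (Fin (N + 1) × Fin (K + 1))).filter
        (fun p => (p.1 : ℕ) + (p.2 : ℕ) = i), A p.1 ∘ₗ U.subtype ∘ₗ LinearMap.proj p.2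
    have hC : ∀ n (v : Fin (K + 1) → U), ∑ i ∈ Finset.range (K + N + 1), t n ^ i • C i v =
        (∑ k : Fin (N + 1), t n ^ (k : ℕ) • A k : Module.End ℂ V)
          (∑ j : Fin (K + 1), t n ^ (j : ℕ) • (v j : V)) := by
      intro n v
      have h1 : (∑ k : Fin (N + 1), t n ^ (k : ℕ) • A k : Module.End ℂ V)
          (∑ j : Fin (K + 1), t n ^ (j : ℕ) • (v j : V)) =
          ∑ p : Fin (N + 1) × Fin (K + 1), t n ^ ((p.1 : ℕ) + (p.2 : ℕ)) • A p.1 (v p.2) := by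
        rw [LinearMap.sum_apply, Fintype.sum_prod_type]
        refine Finset.sum_congr rfl fun k _ => ?_
        rw [map_sum]
        refine Finset.sum_congr rfl fun j _ => ?_
        rw [LinearMap.smul_apply, map_smul, smul_smul, pow_add]
      rw [h1, ← Finset.sum_fiberwise_of_maps_to (t := Finset.range (K + N + 1))
        (g := fun p : Fin (N + 1) × Fin (K + 1) => (p.1 : ℕ) + (p.2 : ℕ))]
      · refine Finset.sum_congr rfl fun i _ => ?_
        simp only [C, LinearMap.sum_apply, Finset.smul_sum]
        refine Finset.sum_congr rfl fun p hp => ?_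
        rw [(Finset.mem_filter.mp hp).2]
        rfl
      · intro p _
        rw [Finset.mem_range]
        have := p.1.2
        have := p.2.2
        omega
    let L : (Fin (K + 1) → U) →ₗ[ℂ] (Fin (K + N + 1) → W) :=
      LinearMap.pi fun i => q ∘ₗ C i
    -- The leading coefficient of a nonzero image polynomial is a limit of rescaled elements of `U'
    -- n`, so it lies in `W` and the projection `q` fixes it. If `q` kills every coefficient, the
    -- image polynomial is therefore zero, and injectivity of the family gives `v = 0`.
    have hL : Function.Injective L := by
      rw [← LinearMap.ker_eq_bot, LinearMap.ker_eq_bot']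
      intro v hv
      have hCv : ∀ i < K + N + 1, C i v = 0 := by
        by_contra! hcon
        obtain ⟨D, hDN, hD0, hD⟩ := exists_leading ht0 ht (fun i => C i v) (K + N + 1) hcon
        have hmem : C D v ∈ W := by
          refine ⟨_, fun n => ?_, hD⟩
          rw [hC]
          refine Submodule.smul_mem _ _ (hU' n _ ?_)
          exact sum_mem fun j _ => U.smul_mem _ (v j).2
        have h1 : q (C D v) = 0 := congrFun hv ⟨D, hDN⟩
        have h2 : q (C D v) = ⟨C D v, hmem⟩ := LinearMap.congr_fun hq ⟨C D v, hmem⟩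
        rw [h1] at h2
        exact hD0 (congrArg Subtype.val h2.symm)
      have hzero : ∀ n, ∑ j : Fin (K + 1), t n ^ (j : ℕ) • (v j : V) = 0 := by
        intro n
        apply hA n
        rw [← hC, map_zero]
        refine Finset.sum_eq_zero fun i hi => ?_
        rw [hCv i (Finset.mem_range.mp hi), smul_zero]
      by_contra hv0
      let v' : ℕ → V := fun j => if h : j < K + 1 then v ⟨j, h⟩ else 0
      have hsum : ∀ n, ∑ j ∈ Finset.range (K + 1), t n ^ j • v' j = 0 := by
        intro n
        rw [← hzero n, Finset.sum_range]
        refine Finset.sum_congr rfl fun j _ => ?_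
        simp only [v', dif_pos j.2]
      obtain ⟨D, hDN, hD0, hD⟩ := exists_leading ht0 ht v' (K + 1) (by
        by_contra! hcon
        refine hv0 (funext fun j => Subtype.ext ?_)
        have := hcon j j.2
        simp only [v', dif_pos j.2] at this
        exact this)
      simp only [hsum, smul_zero] at hD
      exact hD0 (hD.unique (DTendsto.const 0))
    have := LinearMap.finrank_le_finrank_of_injective hL
    rw [Module.finrank_pi_fintype, Module.finrank_pi_fintype] at this
    simp only [Finset.sum_const, Finset.card_univ, Fintype.card_fin, smul_eq_mul] at this
    rwa [mul_comm, mul_comm (Module.finrank ℂ W)]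
  by_contra! hlt
  -- With `d = finrank W` and `K = d * N`, the bound `finrank U ≥ d + 1` would give `(d + 1) * (d *
  -- N + 1) ≤ d * (d * N + N + 1)`, where the left side exceeds the right by one.
  have h1 := key (Module.finrank ℂ W * N)
  have h2 : (Module.finrank ℂ W + 1) * (Module.finrank ℂ W * N + 1) ≤
      Module.finrank ℂ U * (Module.finrank ℂ W * N + 1) := Nat.mul_le_mul_right _ hlt
  have h3 := h2.trans h1
  ring_nf at h3
  omega

/-- Transversality to a fixed subspace is an open condition. -/
lemma exists_transversal_of_limitSpace {U : ℕ → Submodule ℂ V} {d : ℕ}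
    (hU : ∀ n, Module.finrank ℂ (U n) ≤ d) (hd : d ≤ Module.finrank ℂ (limitSpace U))
    {N : Submodule ℂ V} (h : ∀ x ∈ limitSpace U, x ∈ N → x = 0) :
    ∃ n, ∀ x ∈ U n, x ∈ N → x = 0 := by
  classical
  set W := limitSpace U with hW
  obtain ⟨q, hq⟩ := LinearMap.exists_leftInverse_of_injective (N.mkQ ∘ₗ W.subtype) (by
    rw [LinearMap.ker_eq_bot']
    intro x hx
    exact Subtype.ext (h x x.2 ((Submodule.Quotient.mk_eq_zero N).mp hx)))
  -- `F` is the identity on the limit `W` and kills `N`. Approximating a basis of `W` inside `U n`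
  -- makes the matrix of its `F`-image tend to the identity, so its determinant is eventually
  -- nonzero. Then `F` maps `U n` onto `W`, and injectively by dimension, so `U n` meets `N` only in
  -- zero.
  let F : V →ₗ[ℂ] W := q ∘ₗ N.mkQ
  have hFW : ∀ x : W, F x = x := fun x => LinearMap.congr_fun hq x
  have hFN : ∀ x ∈ N, F x = 0 := fun x hx => by
    have : N.mkQ x = 0 := (Submodule.Quotient.mk_eq_zero N).mpr hx
    simp [F, this]
  let b := Module.finBasis ℂ W
  choose p hp hp' using fun i => (b i).2
  have hlim : Tendsto (fun n => b.det fun i => F (p i n)) atTop (𝓝 1) := by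
    have h1 : Tendsto (fun n => (b.toMatrix fun i => F (p i n))) atTop (𝓝 1) := by
      refine tendsto_pi_nhds.mpr fun i => tendsto_pi_nhds.mpr fun j => ?_
      have h2 := (hp' j) (b.coord i ∘ₗ F)
      simp only [LinearMap.comp_apply, hFW] at h2
      have h3 : b.coord i (b j) = (1 : Matrix _ _ ℂ) i j := by
        rw [Module.Basis.coord_apply, Module.Basis.repr_self, Finsupp.single_apply,
          Matrix.one_apply]
        simp only [eq_comm]
      rw [h3] at h2
      exact h2
    have h3 : Continuous fun M : Matrix (Fin (Module.finrank ℂ W)) (Fin (Module.finrank ℂ W)) ℂ =>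
      M.det := Continuous.matrix_det continuous_id
    have h4 := (h3.tendsto 1).comp h1
    rw [Matrix.det_one] at h4
    exact h4
  obtain ⟨n, hn⟩ := (hlim.eventually_ne one_ne_zero).exists
  have hspan := ((Module.Basis.is_basis_iff_det b).mpr (isUnit_iff_ne_zero.mpr hn)).2
  refine ⟨n, fun x hx hxN => ?_⟩
  have hsurj : Function.Surjective (F ∘ₗ (U n).subtype) := by
    rw [← LinearMap.range_eq_top, eq_top_iff, ← hspan, Submodule.span_le]
    rintro _ ⟨i, rfl⟩
    exact ⟨⟨p i n, hp i n⟩, rfl⟩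
  have hinj : Function.Injective (F ∘ₗ (U n).subtype) := by
    have h1 := LinearMap.finrank_le_finrank_of_surjective hsurj
    rw [LinearMap.injective_iff_surjective_of_finrank_eq_finrank]
    · exact hsurj
    · exact le_antisymm ((hU n).trans hd) h1
  have := @hinj ⟨x, hx⟩ 0 (by simp [hFN x hxN])
  exact congrArg Subtype.val this

end Limits

end MaxNull

namespace MaxNull

/-! ### Limits along semisimple and nilpotent flows. -/

open Filter Topology Module

/-- A `ℚ`-linear functional `ℂ → ℚ` that separates the finitely many points, multiplied by a common
denominator. It replaces complex eigenvalues by integer weights: additivity will make the associated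
scaling a Lie automorphism, and injectivity will allow the endomorphism to be recovered from the
scaling. -/
lemma exists_integral_grading (E : Finset ℂ) : ∃ ℓ : ℂ → ℤ, Set.InjOn ℓ E ∧
    ∀ μ ∈ E, ∀ ν ∈ E, μ + ν ∈ E → ℓ (μ + ν) = ℓ μ + ℓ ν := by
  classical
  obtain ⟨φ, -, hφ⟩ := Module.Dual.exists_forall_mem_ne_zero_of_forall_exists
    (ι := {p : E × E // p.1 ≠ p.2}) (⊤ : Submodule ℚ (Module.Dual ℚ ℂ))
    (fun p => Module.Dual.eval ℚ ℂ ((p.1.1 : ℂ) - p.1.2)) (by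
      rintro ⟨⟨a, b⟩, hab⟩
      by_contra! hcon
      refine hab (Subtype.ext (sub_eq_zero.mp ?_))
      exact (Module.forall_dual_apply_eq_zero_iff ℚ _).mp fun f => hcon f trivial)
  obtain ⟨d, hd⟩ := IsLocalization.exist_integer_multiples_of_finset (nonZeroDivisors ℤ)
    (E.image φ)
  have hd0 : (d : ℤ) ≠ 0 := nonZeroDivisors.coe_ne_zero d
  have h1 : ∀ μ ∈ E, ∃ m : ℤ, (m : ℚ) = (d : ℤ) * φ μ := by
    intro μ hμ
    obtain ⟨m, hm⟩ := hd (φ μ) (Finset.mem_image_of_mem _ hμ)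
    exact ⟨m, by simpa using hm⟩
  let ℓ : ℂ → ℤ := fun μ => if h : μ ∈ E then (h1 μ h).choose else 0
  have hℓ : ∀ μ ∈ E, (ℓ μ : ℚ) = (d : ℤ) * φ μ := by
    intro μ hμ
    simp only [ℓ, dif_pos hμ]
    exact (h1 μ hμ).choose_spec
  refine ⟨ℓ, fun a ha b hb hab => ?_, fun μ hμ ν hν hμν => ?_⟩
  · by_contra hne
    refine hφ ⟨(⟨a, ha⟩, ⟨b, hb⟩), fun h => hne (congrArg Subtype.val h)⟩ ?_
    have h2 : (ℓ a : ℚ) = ℓ b := by rw [hab]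
    rw [hℓ a ha, hℓ b hb] at h2
    have h3 := mul_left_cancel₀ (by exact_mod_cast hd0) h2
    change φ (a - b) = 0
    rw [map_sub, h3, sub_self]
  · have : (ℓ (μ + ν) : ℚ) = ℓ μ + ℓ ν := by
      rw [hℓ _ hμ, hℓ _ hν, hℓ _ hμν, map_add]
      ring
    exact_mod_cast this

section Semisimple

variable {V : Type*} [AddCommGroup V] [Module ℂ V] [FiniteDimensional ℂ V]

lemma eigenvector_induction {s : End ℂ V} (hs : s.IsSemisimple) {P : V → Prop}
    (h : ∀ (μ : ℂ) v, s v = μ • v → P v) (hadd : ∀ v w, P v → P w → P (v + w)) (v : V) : P v := by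
  have hv : v ∈ ⨆ μ, s.eigenspace μ := by
    rw [hs.iSup_eigenspace_eq_top]
    trivial
  refine Submodule.iSup_induction _ (motive := P) hv (fun μ x hx => h μ x (End.mem_eigenspace_iff.mp hx))
    (h 0 0 (by simp)) hadd

/-- Lagrange interpolation at the eigenvalues. Being a polynomial in `s`, the resulting operator
preserves every `s`-stable subspace. -/
lemma exists_aeval_of_eigenvector (s : End ℂ V) (f : ℂ → ℂ) :
    ∃ p : Polynomial ℂ, ∀ μ v, s v = μ • v → Polynomial.aeval s p v = f μ • v := by
  classical
  let E := (End.finite_hasEigenvalue s).toFinset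
  refine ⟨Lagrange.interpolate E id f, fun μ v hv => ?_⟩
  rcases eq_or_ne v 0 with rfl | hv0
  · simp
  rw [End.aeval_apply_of_mem_apply_eq_smul hv]
  congr 1
  refine Lagrange.eval_interpolate_at_node f (v := id) Function.injective_id.injOn ?_
  simp only [E, Set.Finite.mem_toFinset, Set.mem_ofPred_eq]
  exact End.hasEigenvalue_of_hasEigenvector ⟨End.mem_eigenspace_iff.mpr hv, hv0⟩

lemma aeval_mem {s : End ℂ V} {M : Submodule ℂ V} (hM : ∀ v ∈ M, s v ∈ M) (p : Polynomial ℂ) {v : V}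
    (hv : v ∈ M) : Polynomial.aeval s p v ∈ M := by
  induction p using Polynomial.induction_on' with
  | add p q hp hq => rw [map_add]; exact M.add_mem hp hq
  | monomial n a =>
    rw [Polynomial.aeval_monomial, Module.End.mul_apply, Module.algebraMap_end_apply]
    exact M.smul_mem _ (pow_mem_of_stable hM hv n)

lemma expEnd_smul_of_isNilpotent {T : End ℂ V} {K : ℕ} (hT : T ^ K = 0) (c : ℂ) :
    expEnd (c • T) = ∑ k : Fin (K + 1), c ^ (k : ℕ) • (((k : ℕ).factorial : ℂ)⁻¹ • T ^ (k : ℕ)) := by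
  ext v
  refine eq_of_forall_dual fun f => ?_
  refine (hasSum_expEnd_apply (c • T) f v).unique ?_
  have h2 := hasSum_sum_of_ne_finset_zero (L := SummationFilter.unconditional ℕ)
    (s := Finset.range (K + 1))
    (f := fun n : ℕ => ((n.factorial : ℂ))⁻¹ * f (((c • T) ^ n) v)) (fun n hn => by
      have hn' : K ≤ n := by
        rw [Finset.mem_range] at hn
        omega
      rw [smul_pow, pow_eq_zero_of_le hn' hT]
      simp)
  convert h2 using 1
  rw [LinearMap.sum_apply, map_sum, Finset.sum_range]
  refine Finset.sum_congr rfl fun k _ => ?_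
  simp only [smul_pow, LinearMap.smul_apply, map_smul, smul_eq_mul]
  ring

lemma tendsto_inv_natCast_add_one : Tendsto (fun n : ℕ => ((n : ℂ) + 1)⁻¹) atTop (𝓝 0) := by
  have := tendsto_one_div_add_atTop_nhds_zero_nat (𝕜 := ℂ)
  simpa using this

/-- The limit of a subspace along the flow of a nilpotent endomorphism is stable. -/
lemma limitSpace_of_isNilpotent {T : End ℂ V} (hT : IsNilpotent T) (U : Submodule ℂ V) :
    Module.finrank ℂ U ≤ Module.finrank ℂ
        (limitSpace fun n : ℕ => U.map (expEquiv (((n : ℂ) + 1) • T)).toLinearMap) ∧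
      ∀ w ∈ limitSpace fun n : ℕ => U.map (expEquiv (((n : ℂ) + 1) • T)).toLinearMap,
        T w ∈ limitSpace fun n : ℕ => U.map (expEquiv (((n : ℂ) + 1) • T)).toLinearMap := by
  obtain ⟨K, hK⟩ := hT
  set W := limitSpace fun n : ℕ => U.map (expEquiv (((n : ℂ) + 1) • T)).toLinearMap with hW
  refine ⟨?_, fun w hw => ?_⟩
  · refine finrank_le_finrank_limitSpace (t := fun n : ℕ => (n : ℂ) + 1)
      (fun n => Nat.cast_add_one_ne_zero n)
      tendsto_inv_natCast_add_one (fun k : Fin (K + 1) => ((k : ℕ).factorial : ℂ)⁻¹ • T ^ (k : ℕ))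
      (fun n => ?_) U (fun n x hx => ?_)
    · rw [← expEnd_smul_of_isNilpotent hK]
      exact (expEquiv (((n : ℂ) + 1) • T)).injective
    · rw [← expEnd_smul_of_isNilpotent hK]
      exact ⟨x, hx, rfl⟩
  · have h1 : ∀ v ∈ W, expEnd T v ∈ W := by
      intro v hv
      refine map_mem_limitSpace_of_shift (expEnd T) ?_ hv
      rintro n _ ⟨u, hu, rfl⟩
      refine ⟨u, hu, ?_⟩
      change expEnd (((n + 1 : ℕ) + 1 : ℂ) • T) u = (expEnd T * expEnd (((n : ℂ) + 1) • T)) u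
      rw [← expEnd_add_of_commute ((Commute.refl T).smul_right _)]
      congr 2
      push_cast
      module
    have h2 : ∀ m : ℕ, expEnd ((m : ℂ) • T) w ∈ W := by
      intro m
      induction m with
      | zero => simpa using hw
      | succ k ih =>
        have h3 : expEnd (((k + 1 : ℕ) : ℂ) • T) w = expEnd T (expEnd ((k : ℂ) • T) w) := by
          change _ = (expEnd T * expEnd ((k : ℂ) • T)) w
          rw [← expEnd_add_of_commute ((Commute.refl T).smul_right _)]
          congr 2
          push_cast
          module
        rw [h3]
        exact h1 _ ih
    -- For a functional `f` vanishing on `W`, the polynomial `m ↦ f (exp (m T) w)` vanishes at all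
    -- natural numbers, hence identically, and its linear coefficient is `f (T w)`.
    refine mem_of_forall_dual fun f hf => ?_
    let P : Polynomial ℂ := ∑ k ∈ Finset.range (K + 2),
      Polynomial.monomial k (((k : ℕ).factorial : ℂ)⁻¹ * f ((T ^ k) w))
    -- The exponent is raised by one so that the degree `1` term is present even when `K = 0`.
    have hK' : T ^ (K + 1) = 0 := by rw [pow_succ, hK, zero_mul]
    have hP : ∀ m : ℕ, P.eval (m : ℂ) = 0 := by
      intro m
      rw [← hf _ (h2 m), expEnd_smul_of_isNilpotent hK', LinearMap.sum_apply, map_sum,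
        Polynomial.eval_finsetSum, Finset.sum_range]
      refine Finset.sum_congr rfl fun k _ => ?_
      simp only [Polynomial.eval_monomial, LinearMap.smul_apply, map_smul, smul_eq_mul]
      ring
    have hP0 : P = 0 := by
      refine Polynomial.eq_zero_of_infinite_isRoot P ?_
      refine Set.Infinite.mono ?_ (Set.infinite_range_of_injective (Nat.cast_injective (R := ℂ)))
      rintro _ ⟨m, rfl⟩
      exact hP m
    have h4 : P.coeff 1 = f (T w) := by
      simp only [P, Polynomial.finsetSum_coeff, Polynomial.coeff_monomial]
      rw [Finset.sum_ite_eq' (Finset.range (K + 2)) 1]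
      simp
    rw [← h4, hP0, Polynomial.coeff_zero]

lemma exists_split (s : End ℂ V) : ∃ E : Finset ℂ, ∀ μ v, s v = μ • v → v ≠ 0 → μ ∈ E := by
  refine ⟨(End.finite_hasEigenvalue s).toFinset, fun μ v hv hv0 => ?_⟩
  simp only [Set.Finite.mem_toFinset, Set.mem_ofPred_eq]
  exact End.hasEigenvalue_of_hasEigenvector ⟨End.mem_eigenspace_iff.mpr hv, hv0⟩

lemma tendsto_inv_two_pow : Tendsto (fun n : ℕ => ((2 : ℂ) ^ n)⁻¹) atTop (𝓝 0) := by
  have h : ∀ n : ℕ, ((2 : ℂ) ^ n)⁻¹ = (2⁻¹ : ℂ) ^ n := fun n => (inv_pow _ _).symm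
  simp only [h]
  exact tendsto_pow_atTop_nhds_zero_of_norm_lt_one (by norm_num)

/-- An integral one-parameter group attached to a semisimple endomorphism, whose limits are
stable under that endomorphism. -/
lemma exists_scaling {s : End ℂ V} (hs : s.IsSemisimple) :
    ∃ (B : V ≃ₗ[ℂ] V) (ℓ : ℂ → ℤ),
      (∀ μ ν a b c, s a = μ • a → s b = ν • b → s c = (μ + ν) • c → a ≠ 0 → b ≠ 0 → c ≠ 0 →
        ℓ (μ + ν) = ℓ μ + ℓ ν) ∧
      (∀ μ v, s v = μ • v → B v = (2 : ℂ) ^ ℓ μ • v) ∧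
      (∀ M : Submodule ℂ V, (∀ v ∈ M, s v ∈ M) → ∀ v ∈ M, B v ∈ M) ∧
      ∀ U : Submodule ℂ V,
        Module.finrank ℂ U ≤ Module.finrank ℂ
          (limitSpace fun n : ℕ => U.map (B ^ n).toLinearMap) ∧
        ∀ w ∈ limitSpace fun n : ℕ => U.map (B ^ n).toLinearMap,
          s w ∈ limitSpace fun n : ℕ => U.map (B ^ n).toLinearMap := by
  classical
  obtain ⟨E, hE⟩ := exists_split s
  obtain ⟨ℓ, hinj, hadd⟩ := exists_integral_grading E
  obtain ⟨p, hp⟩ := exists_aeval_of_eigenvector s (fun μ => (2 : ℂ) ^ ℓ μ)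
  obtain ⟨p', hp'⟩ := exists_aeval_of_eigenvector s (fun μ => (2 : ℂ) ^ (-ℓ μ))
  have two : (2 : ℂ) ≠ 0 := two_ne_zero
  let B : V ≃ₗ[ℂ] V := LinearEquiv.ofLinearMap (Polynomial.aeval s p) (Polynomial.aeval s p')
    (by
      ext v
      refine eigenvector_induction hs (P := fun v =>
        (Polynomial.aeval s p ∘ₗ Polynomial.aeval s p') v = LinearMap.id v)
        (fun μ v hv => ?_) (fun v w hv hw => by rw [map_add, map_add, hv, hw]) v
      rw [LinearMap.comp_apply, hp' μ v hv, map_smul, hp μ v hv, smul_smul, ← zpow_add₀ two]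
      simp)
    (by
      ext v
      refine eigenvector_induction hs (P := fun v =>
        (Polynomial.aeval s p' ∘ₗ Polynomial.aeval s p) v = LinearMap.id v)
        (fun μ v hv => ?_) (fun v w hv hw => by rw [map_add, map_add, hv, hw]) v
      rw [LinearMap.comp_apply, hp μ v hv, map_smul, hp' μ v hv, smul_smul, ← zpow_add₀ two]
      simp)
  have hB : ∀ v, B v = Polynomial.aeval s p v := fun v => rfl
  have hBe : ∀ μ v, s v = μ • v → B v = (2 : ℂ) ^ ℓ μ • v := fun μ v hv => hp μ v hv
  have hBn : ∀ (n : ℕ) μ v, s v = μ • v → (B ^ n) v = ((2 : ℂ) ^ ℓ μ) ^ n • v := by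
    intro n μ v hv
    induction n with
    | zero => simp
    | succ k ih =>
      rw [pow_succ', LinearEquiv.mul_apply, ih, map_smul, hBe μ v hv, smul_smul, pow_succ]
  refine ⟨B, ℓ, ?_, hBe, fun M hM v hv => aeval_mem hM p hv, fun U => ⟨?_, fun w hw => ?_⟩⟩
  · intro μ ν a b c ha hb hc ha0 hb0 hc0
    exact hadd μ (hE _ _ ha ha0) ν (hE _ _ hb hb0) (hE _ _ hc hc0)
  -- The shift `c` makes all exponents nonnegative. Multiplying `B ^ n` by the scalar `(2 ^ n) ^ c`
  -- does not change images of subspaces and turns the family into a polynomial one in `2 ^ n`.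
  · obtain ⟨c, hc⟩ : ∃ c : ℕ, ∀ μ ∈ E, 0 ≤ ℓ μ + c := by
      refine ⟨∑ μ ∈ E, (ℓ μ).natAbs, fun μ hμ => ?_⟩
      have := Finset.single_le_sum (f := fun μ => (ℓ μ).natAbs) (fun _ _ => Nat.zero_le _) hμ
      omega
    let k : ℂ → ℕ := fun μ => (ℓ μ + c).toNat
    have hk : ∀ μ ∈ E, ((k μ : ℕ) : ℤ) = ℓ μ + c := fun μ hμ => Int.toNat_of_nonneg (hc μ hμ)
    let N := ∑ μ ∈ E, k μ
    have hN : ∀ μ ∈ E, k μ < N + 1 := fun μ hμ =>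
      Nat.lt_succ_of_le (Finset.single_le_sum (f := k) (fun _ _ => Nat.zero_le _) hμ)
    choose q hq using fun j : ℕ => exists_aeval_of_eigenvector s (fun μ => if j = k μ then 1 else 0)
    have hA : ∀ n : ℕ, (∑ j : Fin (N + 1), ((2 : ℂ) ^ n) ^ (j : ℕ) • Polynomial.aeval s (q j) :
        End ℂ V) = ((2 : ℂ) ^ n) ^ c • (B ^ n).toLinearMap := by
      intro n
      ext v
      refine eigenvector_induction hs (P := fun v =>
        (∑ j : Fin (N + 1), ((2 : ℂ) ^ n) ^ (j : ℕ) • Polynomial.aeval s (q j) : End ℂ V) v =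
          (((2 : ℂ) ^ n) ^ c • (B ^ n).toLinearMap) v)
        (fun μ v hv => ?_) (fun v w hv hw => by rw [map_add, map_add, hv, hw]) v
      rcases eq_or_ne v 0 with rfl | hv0
      · simp
      have hμ := hE μ v hv hv0
      rw [LinearMap.sum_apply, LinearMap.smul_apply, LinearEquiv.coe_coe, hBn n μ v hv]
      simp only [LinearMap.smul_apply, hq _ μ v hv]
      rw [Finset.sum_eq_single_of_mem (⟨k μ, hN μ hμ⟩ : Fin (N + 1)) (Finset.mem_univ _)]
      · simp only [if_true, one_smul, smul_smul]
        congr 1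
        rw [← zpow_natCast ((2 : ℂ) ^ n) (k μ), hk μ hμ, zpow_add₀ (pow_ne_zero n two),
          ← zpow_natCast ((2 : ℂ) ^ ℓ μ) n, ← zpow_natCast (2 : ℂ) n, ← zpow_mul, ← zpow_mul]
        rw [mul_comm (n : ℤ) (ℓ μ), mul_comm, zpow_mul, zpow_mul]
        simp only [zpow_natCast]
      · intro j _ hj
        rw [if_neg, zero_smul, smul_zero]
        exact fun h => hj (Fin.ext h)
    refine finrank_le_finrank_limitSpace (t := fun n : ℕ => (2 : ℂ) ^ n)
      (fun n => pow_ne_zero n two) tendsto_inv_two_pow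
      (fun j : Fin (N + 1) => Polynomial.aeval s (q j)) (fun n => ?_) U (fun n x hx => ?_)
    · rw [hA]
      intro x y hxy
      exact (B ^ n).injective (smul_right_injective V (pow_ne_zero c (pow_ne_zero n two)) hxy)
    · rw [hA]
      exact Submodule.smul_mem _ _ ⟨x, hx, rfl⟩
  · have h1 : ∀ v ∈ limitSpace fun n : ℕ => U.map (B ^ n).toLinearMap,
        B v ∈ limitSpace fun n : ℕ => U.map (B ^ n).toLinearMap := by
      intro v hv
      refine map_mem_limitSpace_of_shift B.toLinearMap ?_ hv
      rintro n _ ⟨u, hu, rfl⟩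
      refine ⟨u, hu, ?_⟩
      rw [pow_succ']
      rfl
    -- The powers `2 ^ ℓ μ` are distinct on `E`, so `s` is a polynomial in `B`, and stability under
    -- `B` implies stability under `s`.
    let r := Lagrange.interpolate E (fun μ => (2 : ℂ) ^ ℓ μ) id
    have hr : ∀ v, Polynomial.aeval (B.toLinearMap : End ℂ V) r v = s v := by
      intro v
      refine eigenvector_induction hs (P := fun v =>
        Polynomial.aeval (B.toLinearMap : End ℂ V) r v = s v)
        (fun μ v hv => ?_) (fun v w hv hw => by rw [map_add, map_add, hv, hw]) v
      rcases eq_or_ne v 0 with rfl | hv0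
      · simp
      rw [End.aeval_apply_of_mem_apply_eq_smul (f := (B.toLinearMap : End ℂ V)) (hBe μ v hv), hv]
      congr 1
      refine Lagrange.eval_interpolate_at_node (v := fun μ => (2 : ℂ) ^ ℓ μ) id ?_ (hE μ v hv hv0)
      intro a ha b hb hab
      refine hinj ha hb ?_
      have h2 : ((2 : ℝ) ^ ℓ a) = (2 : ℝ) ^ ℓ b := by
        have h3 : (2 : ℂ) ^ ℓ a = (2 : ℂ) ^ ℓ b := hab
        have h4 := congrArg norm h3
        rw [norm_zpow, norm_zpow, Complex.norm_ofNat] at h4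
        exact h4
      exact zpow_right_injective₀ (by norm_num) (by norm_num) h2
    rw [← hr]
    exact aeval_mem h1 r hw

end Semisimple

/-! ### Degenerating a subspace to one stable under a solvable subalgebra. -/

section Derivation

variable {g : Type*} [LieRing g] [LieAlgebra ℂ g] [FiniteDimensional ℂ g]

/-- The semisimple part of `ad x` is a derivation. -/
lemma exists_semisimple_part (x : g) : ∃ s : End ℂ g, s.IsSemisimple ∧
    IsNilpotent (LieAlgebra.ad ℂ g x - s) ∧ Commute (LieAlgebra.ad ℂ g x) s ∧
    (∀ M : Submodule ℂ g, (∀ v ∈ M, ⁅x, v⁆ ∈ M) → ∀ v ∈ M, s v ∈ M) ∧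
    ∀ a b, s ⁅a, b⁆ = ⁅s a, b⁆ + ⁅a, s b⁆ := by
  obtain ⟨n, -, s, hs, hnil, hss, hx⟩ := (LieAlgebra.ad ℂ g x).exists_isNilpotent_isSemisimple
  have hcomm : Commute (LieAlgebra.ad ℂ g x) s := Algebra.commute_of_mem_adjoin_self hs
  have hnil' : IsNilpotent (LieAlgebra.ad ℂ g x - s) := by
    have h : LieAlgebra.ad ℂ g x - s = n := sub_eq_of_eq_add hx
    rw [h]
    exact hnil
  -- `s` is scalar on each generalized eigenspace of `ad x`, and the bracket adds generalized
  -- eigenvalues; hence `s` is a derivation.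
  have heig : ∀ μ, ∀ v ∈ (LieAlgebra.ad ℂ g x).maxGenEigenspace μ, s v = μ • v := fun μ v hv =>
    End.apply_eq_of_mem_of_comm_of_isFinitelySemisimple_of_isNil hv hcomm
      hss.isFinitelySemisimple hnil'
  refine ⟨s, hss, hnil', hcomm, fun M hM v hv => ?_, fun a b => ?_⟩
  · obtain ⟨p, rfl⟩ := Algebra.adjoin_mem_exists_aeval ℂ _ hs
    exact aeval_mem hM p hv
  · have htop : ∀ a, a ∈ ⨆ μ, (LieAlgebra.ad ℂ g x).maxGenEigenspace μ := by
      intro a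
      rw [End.iSup_maxGenEigenspace_eq_top]
      trivial
    refine Submodule.iSup_induction _ (motive := fun a => s ⁅a, b⁆ = ⁅s a, b⁆ + ⁅a, s b⁆) (htop a)
      (fun μ a ha => ?_) (by simp) (fun a a' h h' => by simp only [add_lie, map_add, h, h']; abel)
    refine Submodule.iSup_induction _ (motive := fun b => s ⁅a, b⁆ = ⁅s a, b⁆ + ⁅a, s b⁆) (htop b)
      (fun ν b hb => ?_) (by simp) (fun b b' h h' => by simp only [lie_add, map_add, h, h']; abel)
    rw [heig μ a ha, heig ν b hb, heig (μ + ν) ⁅a, b⁆ (LieModule.lie_mem_maxGenEigenspace_toEnd ha hb)]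
    simp [add_smul]

/-- By dimension `φ S = S`, so every `y ∈ S` is some `φ z` with `z ∈ S`, and `⁅φ z, φ u⁆ = φ ⁅z,
u⁆`. -/
lemma stable_map_of_normalizes {φ : g ≃ₗ[ℂ] g} (hφ : ∀ a b, φ ⁅a, b⁆ = ⁅φ a, φ b⁆)
    {S U : Submodule ℂ g} (hS : ∀ y ∈ S, φ y ∈ S) (hU : ∀ y ∈ S, ∀ u ∈ U, ⁅y, u⁆ ∈ U) :
    ∀ y ∈ S, ∀ u ∈ U.map φ.toLinearMap, ⁅y, u⁆ ∈ U.map φ.toLinearMap := by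
  have hmap : S.map φ.toLinearMap = S := by
    refine Submodule.eq_of_le_of_finrank_eq (by rintro _ ⟨y, hy, rfl⟩; exact hS y hy) ?_
    exact LinearEquiv.finrank_map_eq φ S
  rintro y hy _ ⟨u, hu, rfl⟩
  rw [← hmap] at hy
  obtain ⟨z, hz, rfl⟩ := hy
  exact ⟨⁅z, u⁆, hU z hz u hu, hφ z u⟩

/-- The limit of a subspace along the flow of a derivation stays stable under what is normalized
by the derivation. -/
lemma limit_stable_of_derivation {T : End ℂ g}
    (hder : ∀ a b, T ⁅a, b⁆ = ⁅T a, b⁆ + ⁅a, T b⁆) (U S : Submodule ℂ g)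
    (hS : ∀ y ∈ S, T y ∈ S) (hU : ∀ y ∈ S, ∀ u ∈ U, ⁅y, u⁆ ∈ U) :
    ∀ y ∈ S, ∀ u ∈ limitSpace fun n : ℕ => U.map (expEquiv (((n : ℂ) + 1) • T)).toLinearMap,
      ⁅y, u⁆ ∈ limitSpace fun n : ℕ => U.map (expEquiv (((n : ℂ) + 1) • T)).toLinearMap := by
  intro y hy u hu
  refine map_mem_limitSpace (LieAlgebra.ad ℂ g y) (fun n v hv => ?_) hu
  refine stable_map_of_normalizes (S := S) (fun a b => ?_) (fun z hz => ?_) hU y hy v hv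
  · refine expEnd_derivation (fun a b => ?_) a b
    simp only [LinearMap.smul_apply, hder, smul_add, smul_lie, lie_smul]
  · refine expEnd_mem (fun w hw => ?_) hz
    exact S.smul_mem _ (hS w hw)

/-- A class of subspaces closed under limits of Lie automorphisms contains, with each subspace, one
which is stable under a given `x` and of at least the same dimension. -/
lemma exists_stable_of_limit_closed {P : Submodule ℂ g → Prop}
    (hP : ∀ (A : ℕ → g ≃ₗ[ℂ] g) (U : Submodule ℂ g), (∀ n a b, A n ⁅a, b⁆ = ⁅A n a, A n b⁆) → P U →
      Module.finrank ℂ U ≤ Module.finrank ℂ (limitSpace fun n => U.map (A n).toLinearMap) →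
      P (limitSpace fun n => U.map (A n).toLinearMap)) (x : g) {U : Submodule ℂ g} (hU : P U)
    {S : Submodule ℂ g} (hS : ∀ y ∈ S, ⁅x, y⁆ ∈ S) (hSU : ∀ y ∈ S, ∀ u ∈ U, ⁅y, u⁆ ∈ U) :
    ∃ W, P W ∧ (∀ w ∈ W, ⁅x, w⁆ ∈ W) ∧ ∀ y ∈ S, ∀ u ∈ W, ⁅y, u⁆ ∈ W := by
  obtain ⟨s, hss, hnil, hcomm, hstab, hder⟩ := exists_semisimple_part x
  obtain ⟨B, ℓ, hℓ, hB, hBM, hBlim⟩ := exists_scaling hss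
  have hBlie : ∀ a b, B ⁅a, b⁆ = ⁅B a, B b⁆ := by
    intro a b
    refine eigenvector_induction hss (P := fun a => B ⁅a, b⁆ = ⁅B a, B b⁆) (fun μ a ha => ?_)
      (fun a a' h h' => by simp only [add_lie, map_add, h, h']) a
    refine eigenvector_induction hss (P := fun b => B ⁅a, b⁆ = ⁅B a, B b⁆) (fun ν b hb => ?_)
      (fun b b' h h' => by simp only [lie_add, map_add, h, h']) b
    have hab : s ⁅a, b⁆ = (μ + ν) • ⁅a, b⁆ := by
      rw [hder, ha, hb, smul_lie, lie_smul, add_smul]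
    rw [hB _ _ ha, hB _ _ hb, hB _ _ hab, smul_lie, lie_smul, smul_smul]
    rcases eq_or_ne ⁅a, b⁆ 0 with h0 | h0
    · simp [h0]
    · have ha0 : a ≠ 0 := fun h => h0 (by simp [h])
      have hb0 : b ≠ 0 := fun h => h0 (by simp [h])
      rw [hℓ μ ν a b _ ha hb hab ha0 hb0 h0, zpow_add₀ two_ne_zero]
  have hBnlie : ∀ (n : ℕ) a b, (B ^ n) ⁅a, b⁆ = ⁅(B ^ n) a, (B ^ n) b⁆ := by
    intro n a b
    induction n generalizing a b with
    | zero => rfl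
    | succ k ih => simp only [pow_succ, LinearEquiv.mul_apply, hBlie, ih]
  have hBnS : ∀ (n : ℕ), ∀ y ∈ S, (B ^ n) y ∈ S := by
    intro n
    induction n with
    | zero => exact fun y hy => hy
    | succ k ih =>
      intro y hy
      rw [pow_succ, LinearEquiv.mul_apply]
      exact ih _ (hBM S (hstab S hS) y hy)
  let T : End ℂ g := LieAlgebra.ad ℂ g x - s
  have hTder : ∀ a b, T ⁅a, b⁆ = ⁅T a, b⁆ + ⁅a, T b⁆ := by
    intro a b
    simp only [T, LinearMap.sub_apply, LieAlgebra.ad_apply, hder, sub_lie, lie_sub]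
    rw [leibniz_lie]
    abel
  have hTS : ∀ y ∈ S, T y ∈ S := fun y hy => S.sub_mem (hS y hy) (hstab S hS y hy)
  -- Two limits are taken, one along the semisimple part `s` of `ad x` and a second along its
  -- nilpotent part `T`. The second keeps stability under `s`, because `s` commutes with the flow of
  -- `T`.
  obtain ⟨hW1, hW2⟩ := hBlim U
  set W := limitSpace fun n : ℕ => U.map (B ^ n).toLinearMap with hW
  have hPW : P W := hP (fun n => B ^ n) U hBnlie hU hW1
  have hSW : ∀ y ∈ S, ∀ u ∈ W, ⁅y, u⁆ ∈ W := by
    intro y hy u hu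
    refine map_mem_limitSpace (LieAlgebra.ad ℂ g y) (fun n v hv => ?_) hu
    exact stable_map_of_normalizes (hBnlie n) (hBnS n) hSU y hy v hv
  obtain ⟨hW'1, hW'2⟩ := limitSpace_of_isNilpotent hnil W
  have hSW' := limit_stable_of_derivation hTder W S hTS hSW
  refine ⟨limitSpace fun n : ℕ => W.map (expEquiv (((n : ℂ) + 1) • T)).toLinearMap,
    hP _ W (fun n a b => ?_) hPW hW'1, fun w hw => ?_, hSW'⟩
  · refine expEnd_derivation (fun a b => ?_) a b
    simp only [LinearMap.smul_apply, hTder, smul_add, smul_lie, lie_smul]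
  · have h1 : ⁅x, w⁆ = T w + s w := by simp [T]
    rw [h1]
    refine Submodule.add_mem _ (hW'2 w hw) ?_
    refine map_mem_limitSpace s (fun n v hv => ?_) hw
    obtain ⟨u, hu, rfl⟩ := hv
    refine ⟨s u, hW2 u hu, ?_⟩
    refine (expEnd_intertwine s (fun v => ?_) u).symm
    have hc : Commute s (((n : ℂ) + 1) • T) := ((hcomm.symm.sub_right rfl).smul_right _)
    exact LinearMap.congr_fun hc.eq v

/-- Iterating limits along a solvable chain of subspaces. -/
lemma exists_stable_of_chain {P : Submodule ℂ g → Prop} (D : ℕ → Submodule ℂ g)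
    (hanti : ∀ k, D (k + 1) ≤ D k) (hlie : ∀ k, ∀ x ∈ D k, ∀ y ∈ D k, ⁅x, y⁆ ∈ D (k + 1)) (K : ℕ)
    (hK : D K = ⊥)
    (step : ∀ x ∈ D 0, ∀ U, P U → ∀ S : Submodule ℂ g, (∀ y ∈ S, ⁅x, y⁆ ∈ S) →
      (∀ y ∈ S, ∀ u ∈ U, ⁅y, u⁆ ∈ U) →
      ∃ W, P W ∧ (∀ w ∈ W, ⁅x, w⁆ ∈ W) ∧ ∀ y ∈ S, ∀ u ∈ W, ⁅y, u⁆ ∈ W)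
    {U : Submodule ℂ g} (hU : P U) : ∃ W, P W ∧ ∀ y ∈ D 0, ∀ w ∈ W, ⁅y, w⁆ ∈ W := by
  classical
  have hle : ∀ k, D k ≤ D 0 := by
    intro k
    induction k with
    | zero => exact le_rfl
    | succ k ih => exact (hanti k).trans ih
  -- The chain is climbed from its zero term upwards, one spanning vector of `D k` modulo `D (k +
  -- 1)` at a time. Each vector `x ∈ D k` normalizes the subspace already reached, since that
  -- subspace lies between `D (k + 1)` and `D k` and `⁅x, D k⁆` lies in `D (k + 1)`.
  suffices h : ∀ j, j ≤ K → ∃ W, P W ∧ ∀ y ∈ D (K - j), ∀ w ∈ W, ⁅y, w⁆ ∈ W by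
    simpa using h K le_rfl
  intro j
  induction j with
  | zero =>
    intro _
    refine ⟨U, hU, fun y hy w _ => ?_⟩
    rw [Nat.sub_zero, hK, Submodule.mem_bot] at hy
    simp [hy]
  | succ j ih =>
    intro hj
    obtain ⟨W₀, hPW₀, hW₀⟩ := ih (by omega)
    obtain ⟨k, hk⟩ : ∃ k, K - j = k + 1 := ⟨K - j - 1, by omega⟩
    have hk' : K - (j + 1) = k := by omega
    rw [hk] at hW₀
    rw [hk']
    obtain ⟨F, hF⟩ : (D k).FG := IsNoetherian.noetherian _
    have key : ∀ F' : Finset g, (F' : Set g) ⊆ D k →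
        ∃ W, P W ∧ ∀ y ∈ D (k + 1) ⊔ Submodule.span ℂ (F' : Set g), ∀ w ∈ W, ⁅y, w⁆ ∈ W := by
      intro F'
      induction F' using Finset.induction_on with
      | empty =>
        intro _
        refine ⟨W₀, hPW₀, ?_⟩
        simpa using hW₀
      | insert x F' hx ih2 =>
        intro hsub
        rw [Finset.coe_insert, Set.insert_subset_iff] at hsub
        obtain ⟨W₁, hPW₁, hW₁⟩ := ih2 hsub.2
        have hSD : D (k + 1) ⊔ Submodule.span ℂ (F' : Set g) ≤ D k :=
          sup_le (hanti k) (Submodule.span_le.mpr hsub.2)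
        obtain ⟨W, hPW, hxW, hSW⟩ := step x (hle k hsub.1) W₁ hPW₁ _
          (fun y hy => Submodule.mem_sup_left (hlie k x hsub.1 y (hSD hy))) hW₁
        refine ⟨W, hPW, fun y hy w hw => ?_⟩
        rw [Finset.coe_insert, Submodule.span_insert, sup_left_comm] at hy
        obtain ⟨a, ha, b, hb, rfl⟩ := Submodule.mem_sup.mp hy
        obtain ⟨c, rfl⟩ := Submodule.mem_span_singleton.mp ha
        rw [add_lie, smul_lie]
        exact W.add_mem (W.smul_mem c (hxW w hw)) (hSW b hb w hw)
    obtain ⟨W, hPW, hW⟩ := key F (by rw [← hF]; exact Submodule.subset_span)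
    refine ⟨W, hPW, fun y hy => hW y (Submodule.mem_sup_right ?_)⟩
    rwa [hF]

/-- The derived series of a solvable subalgebra as a chain of subspaces. -/
lemma exists_chain_of_isSolvable (b : LieSubalgebra ℂ g) [hb : LieAlgebra.IsSolvable b] :
    ∃ (D : ℕ → Submodule ℂ g) (K : ℕ), D 0 = b.toSubmodule ∧ (∀ k, D (k + 1) ≤ D k) ∧
      (∀ k, ∀ x ∈ D k, ∀ y ∈ D k, ⁅x, y⁆ ∈ D (k + 1)) ∧ D K = ⊥ := by
  obtain ⟨K, hK⟩ := (LieAlgebra.isSolvable_iff ℂ b).mp hb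
  refine ⟨fun k => (LieAlgebra.derivedSeries ℂ b k).toSubmodule.map b.toSubmodule.subtype, K,
    ?_, fun k => ?_, ?_, ?_⟩
  · simp [LieAlgebra.derivedSeries_def]
  · refine Submodule.map_mono ?_
    rw [LieAlgebra.derivedSeries_def, LieAlgebra.derivedSeries_def,
      LieAlgebra.derivedSeriesOfIdeal_succ]
    exact LieSubmodule.lie_le_right _ _
  · rintro k _ ⟨x, hx, rfl⟩ _ ⟨y, hy, rfl⟩
    let x' : b := x
    let y' : b := y
    refine ⟨⁅x', y'⁆, ?_, rfl⟩
    rw [LieAlgebra.derivedSeries_def, LieAlgebra.derivedSeriesOfIdeal_succ]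
    exact LieSubmodule.lie_mem_lie hx hy
  · simp [hK]

end Derivation

end MaxNull

namespace MaxNull

/-! ### Subspaces supported on sets of roots. -/

namespace RootFrame

variable {g : Type*} [LieRing g] [LieAlgebra ℂ g] [FiniteDimensional ℂ g]
variable {R : Type*} [Fintype R] [DecidableEq R] (F : RootFrame g R)

/-- The root `t` is the sum of the roots `r` and `s`. -/
def Add (r s t : R) : Prop := ∀ x ∈ F.H, F.wt r x + F.wt s x = F.wt t x

/-- The height of a root. -/
def ht (r : R) : ℤ := ∑ i ∈ F.Δ, F.n r i

/-- The subspace of elements supported on the roots satisfying `P`, with Cartan component only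
if `a` holds. -/
def sub (a : Prop) (P : R → Prop) : Submodule ℂ g where
  carrier := {x | (¬ a → F.π x = 0) ∧ ∀ r, ¬ P r → F.coef r x = 0}
  add_mem' := by
    rintro x y ⟨h1, h2⟩ ⟨h3, h4⟩
    exact ⟨fun h => by rw [map_add, h1 h, h3 h, add_zero],
      fun r h => by rw [map_add, h2 r h, h4 r h, add_zero]⟩
  zero_mem' := ⟨fun _ => map_zero _, fun _ _ => map_zero _⟩
  smul_mem' := by
    rintro c x ⟨h1, h2⟩
    exact ⟨fun h => by rw [map_smul, h1 h, smul_zero],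
      fun r h => by rw [map_smul, h2 r h, smul_zero]⟩

lemma e_mem_sub {a : Prop} {P : R → Prop} {r : R} (h : P r) : F.e r ∈ F.sub a P := by
  refine ⟨fun _ => F.π_e r, fun s hs => ?_⟩
  rw [F.coef_e, if_neg]
  rintro rfl
  exact hs h

lemma H_le_sub {a : Prop} (ha : a) (P : R → Prop) : F.H ≤ F.sub a P := fun x hx =>
  ⟨fun h => absurd ha h, fun r _ => F.coef_of_mem r x hx⟩

lemma sub_le {a : Prop} {P : R → Prop} {M : Submodule ℂ g} (hH : a → F.H ≤ M)
    (hM : ∀ r, P r → F.e r ∈ M) : F.sub a P ≤ M := by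
  intro x hx
  rw [← F.expand x]
  refine M.add_mem ?_ (M.sum_mem fun r _ => ?_)
  · by_cases ha : a
    · exact hH ha (F.π_mem x)
    · rw [hx.1 ha]
      exact zero_mem _
  · by_cases hr : P r
    · exact M.smul_mem _ (hM r hr)
    · rw [hx.2 r hr, zero_smul]
      exact zero_mem _

lemma sub_mono {a b : Prop} {P Q : R → Prop} (h : a → b) (hPQ : ∀ r, P r → Q r) :
    F.sub a P ≤ F.sub b Q :=
  F.sub_le (fun ha => F.H_le_sub (h ha) Q) fun _ hr => F.e_mem_sub (hPQ _ hr)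

lemma sub_eq_top : F.sub True (fun _ => True) = ⊤ :=
  eq_top_iff.mpr fun _ _ => ⟨fun h => absurd trivial h, fun _ h => absurd trivial h⟩

lemma π_π (x : g) : F.π (F.π x) = F.π x := F.π_of_mem _ (F.π_mem x)

lemma ext {x y : g} (h : F.π x = F.π y) (h' : ∀ r, F.coef r x = F.coef r y) : x = y := by
  rw [← F.expand x, ← F.expand y, h]
  simp only [h']

lemma e_ne_zero (r : R) : F.e r ≠ 0 := by
  intro h
  have := F.coef_e r r
  rw [h, map_zero, if_pos rfl] at this
  exact zero_ne_one this

lemma lie_e_trichotomy (r s : R) : (s = F.neg r ∧ ⁅F.e r, F.e s⁆ ∈ F.H) ∨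
    (∃ t, F.Add r s t ∧ ∃ N : ℂ, N ≠ 0 ∧ ⁅F.e r, F.e s⁆ = N • F.e t) ∨ ⁅F.e r, F.e s⁆ = 0 := by
  by_cases h1 : s = F.neg r
  · subst h1
    exact Or.inl ⟨rfl, F.lie_e_neg_mem r⟩
  by_cases h2 : ∃ t, F.Add r s t
  · obtain ⟨t, ht⟩ := h2
    exact Or.inr (Or.inl ⟨t, ht, F.lie_e_e r s t ht⟩)
  · push Not at h2
    exact Or.inr (Or.inr (F.lie_e_e_zero r s h1 h2))

/-- Bracket inclusions are reduced here to combinatorics of roots. The four conditions cover Cartan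
with root vector, root vector with Cartan, two root vectors whose roots add up to a root, and
opposite root vectors, whose bracket lies in `H`. -/
lemma lie_mem_sub {a b c : Prop} {P Q T : R → Prop} (h1 : ∀ s, a → Q s → T s)
    (h2 : ∀ r, P r → b → T r) (h3 : ∀ r s t, P r → Q s → F.Add r s t → T t)
    (h4 : ∀ r, P r → Q (F.neg r) → c) {x y : g} (hx : x ∈ F.sub a P) (hy : y ∈ F.sub b Q) :
    ⁅x, y⁆ ∈ F.sub c T := by
  have key1 : F.sub b Q ≤ (F.sub c T).comap (LieAlgebra.ad ℂ g x) := by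
    have key2 : ∀ y, (a → ∀ h ∈ F.H, ⁅h, y⁆ ∈ F.sub c T) → (∀ r, P r → ⁅F.e r, y⁆ ∈ F.sub c T) →
        ⁅x, y⁆ ∈ F.sub c T := by
      intro y hH hP
      have hy : ∀ v, (-(LieAlgebra.ad ℂ g y)) v = ⁅v, y⁆ := fun v => lie_skew v y
      have : F.sub a P ≤ (F.sub c T).comap (-(LieAlgebra.ad ℂ g y)) := by
        refine F.sub_le (fun ha h hh => ?_) fun r hr => ?_
        · rw [Submodule.mem_comap, hy]
          exact hH ha h hh
        · rw [Submodule.mem_comap, hy]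
          exact hP r hr
      have := this hx
      rwa [Submodule.mem_comap, hy] at this
    refine F.sub_le (fun hb h hh => key2 h (fun _ h' hh' => ?_) fun r hr => ?_)
      (fun s hs => key2 _ (fun ha h' hh' => ?_) fun r hr => ?_)
    · rw [F.lie_H h' hh' h hh]
      exact zero_mem _
    · rw [← lie_skew, F.lie_e h hh]
      exact neg_mem (Submodule.smul_mem _ _ (F.e_mem_sub (h2 r hr hb)))
    · rw [F.lie_e h' hh']
      exact Submodule.smul_mem _ _ (F.e_mem_sub (h1 s ha hs))
    · rcases F.lie_e_trichotomy r s with ⟨rfl, h⟩ | ⟨t, ht, N, -, h⟩ | h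
      · exact F.H_le_sub (h4 r hr hs) T h
      · rw [h]
        exact Submodule.smul_mem _ _ (F.e_mem_sub (h3 r s t hr hs ht))
      · rw [h]
        exact zero_mem _
  exact key1 hy

lemma killingForm_symm (x y : g) : killingForm ℂ g x y = killingForm ℂ g y x :=
  LieModule.traceForm_comm ℂ g g x y

/-- Under the Killing form a root space pairs only with the opposite one, and `H` only with itself.
-/
lemma kill_eq_zero {a b : Prop} {P Q : R → Prop} (h1 : ¬ (a ∧ b)) (h2 : ∀ r, P r → ¬ Q (F.neg r))
    {x y : g} (hx : x ∈ F.sub a P) (hy : y ∈ F.sub b Q) : killingForm ℂ g x y = 0 := by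
  have key1 : F.sub b Q ≤ LinearMap.ker (killingForm ℂ g x) := by
    have key2 : ∀ y, (a → ∀ h ∈ F.H, killingForm ℂ g h y = 0) →
        (∀ r, P r → killingForm ℂ g (F.e r) y = 0) → killingForm ℂ g x y = 0 := by
      intro y hH hP
      have : F.sub a P ≤ LinearMap.ker ((killingForm ℂ g).flip y) :=
        F.sub_le (fun ha h hh => hH ha h hh) hP
      exact this hx
    refine F.sub_le (fun hb h hh => key2 h (fun ha => absurd ⟨ha, hb⟩ h1) fun r hr => ?_)
      (fun s hs => key2 _ (fun ha h' hh' => F.kill_H_e h' hh' s) fun r hr => ?_)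
    · rw [killingForm_symm]
      exact F.kill_H_e h hh r
    · refine F.kill_e r s ?_
      rintro rfl
      exact h2 r hr hs
  exact key1 hy

/-! ### Coweights and heights -/

lemma eq_sum_coweights {h : g} (hh : h ∈ F.H) : h = ∑ i ∈ F.Δ, F.wt i h • F.ϖ i := by
  rw [← sub_eq_zero]
  refine F.ext_simple _ (F.H.sub_mem hh (F.H.sum_mem fun i _ => F.H.smul_mem _ (F.ϖ_mem i))) ?_
  intro j hj
  rw [map_sub, map_sum, sub_eq_zero, Finset.sum_eq_single_of_mem j hj]
  · rw [map_smul, F.wt_ϖ j j hj, F.n_simple j hj j hj, if_pos rfl]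
    simp
  · intro i hi hij
    rw [map_smul, F.wt_ϖ j i hi, F.n_simple j hj i hi, if_neg (Ne.symm hij)]
    simp

lemma wt_eq_sum (r : R) {h : g} (hh : h ∈ F.H) :
    F.wt r h = ∑ i ∈ F.Δ, F.wt i h * F.n r i := by
  conv_lhs => rw [F.eq_sum_coweights hh]
  rw [map_sum]
  refine Finset.sum_congr rfl fun i hi => ?_
  rw [map_smul, F.wt_ϖ r i hi, smul_eq_mul]

lemma n_add {r s t : R} (h : F.Add r s t) {i : R} (hi : i ∈ F.Δ) : F.n t i = F.n r i + F.n s i := by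
  have := h (F.ϖ i) (F.ϖ_mem i)
  rw [F.wt_ϖ r i hi, F.wt_ϖ s i hi, F.wt_ϖ t i hi] at this
  exact_mod_cast this.symm

lemma n_neg (r : R) {i : R} (hi : i ∈ F.Δ) : F.n (F.neg r) i = - F.n r i := by
  have := F.wt_neg r (F.ϖ i)
  rw [F.wt_ϖ r i hi, F.wt_ϖ (F.neg r) i hi] at this
  exact_mod_cast this

lemma exists_n_ne_zero (r : R) : ∃ i ∈ F.Δ, F.n r i ≠ 0 := by
  by_contra! hcon
  obtain ⟨z, hz, hz0, -⟩ := F.exists_sep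
  refine hz0 r ?_
  rw [F.wt_eq_sum r hz]
  exact Finset.sum_eq_zero fun i hi => by rw [hcon i hi, Int.cast_zero, mul_zero]

lemma ht_add {r s t : R} (h : F.Add r s t) : F.ht t = F.ht r + F.ht s := by
  rw [ht, ht, ht, ← Finset.sum_add_distrib]
  exact Finset.sum_congr rfl fun i hi => F.n_add h hi

lemma ht_neg (r : R) : F.ht (F.neg r) = - F.ht r := by
  rw [ht, ht, ← Finset.sum_neg_distrib]
  exact Finset.sum_congr rfl fun i hi => F.n_neg r hi

lemma ht_ne_zero (r : R) : F.ht r ≠ 0 := by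
  intro h
  obtain ⟨i, hi, hi0⟩ := F.exists_n_ne_zero r
  rcases F.sign r with h' | h'
  · exact hi0 ((Finset.sum_eq_zero_iff_of_nonneg h').mp h i hi)
  · exact hi0 ((Finset.sum_eq_zero_iff_of_nonpos h').mp h i hi)

lemma n_nonneg {r : R} (h : 0 < F.ht r) {i : R} (hi : i ∈ F.Δ) : 0 ≤ F.n r i := by
  rcases F.sign r with h' | h'
  · exact h' i hi
  · exact absurd (Finset.sum_nonpos h') (not_le.mpr h)

lemma ht_simple {i : R} (hi : i ∈ F.Δ) : F.ht i = 1 := by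
  rw [ht, Finset.sum_congr rfl fun j hj => F.n_simple i hi j hj]
  simp [hi]

/-- The sum of the fundamental coweights. -/
def ρ : g := ∑ i ∈ F.Δ, F.ϖ i

lemma ρ_mem : F.ρ ∈ F.H := F.H.sum_mem fun i _ => F.ϖ_mem i

lemma wt_ρ (r : R) : F.wt r F.ρ = F.ht r := by
  rw [ρ, map_sum, ht, Int.cast_sum]
  exact Finset.sum_congr rfl fun i hi => F.wt_ϖ r i hi

lemma exists_ht_lt : ∃ K : ℕ, ∀ r, F.ht r < K ∧ -(K : ℤ) < F.ht r := by
  refine ⟨∑ r, (F.ht r).natAbs + 1, fun r => ?_⟩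
  have := Finset.single_le_sum (f := fun r => (F.ht r).natAbs) (fun _ _ => Nat.zero_le _)
    (Finset.mem_univ r)
  rw [Nat.cast_add, Nat.cast_one]
  omega

lemma neg_ne (r : R) : F.neg r ≠ r := by
  intro h
  have := F.ht_neg r
  rw [h] at this
  have := F.ht_ne_zero r
  omega

/-- The standard Borel subspace. -/
def borel : Submodule ℂ g := F.sub True fun r => 0 < F.ht r

/-- The sum of the positive root spaces. -/
def npos : Submodule ℂ g := F.sub False fun r => 0 < F.ht r

/-- The sum of the negative root spaces. -/
def nneg : Submodule ℂ g := F.sub False fun r => F.ht r < 0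

/-- The height filtration. -/
def fil (k : ℤ) : Submodule ℂ g := F.sub (k ≤ 0) fun r => k ≤ F.ht r

lemma lie_mem_fil {k l m : ℤ} (h : m ≤ k + l) {x y : g} (hx : x ∈ F.fil k) (hy : y ∈ F.fil l) :
    ⁅x, y⁆ ∈ F.fil m := by
  refine F.lie_mem_sub (fun s h1 h2 => by omega) (fun r h1 h2 => by omega)
    (fun r s t h1 h2 h3 => ?_) (fun r h1 h2 => ?_) hx hy
  · rw [F.ht_add h3]
    omega
  · rw [F.ht_neg] at h2
    omega

lemma npos_eq_fil : F.npos = F.fil 1 := by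
  refine le_antisymm (F.sub_mono (by simp) fun r h => ?_) (F.sub_mono (by simp) fun r h => ?_) <;>
  omega

lemma borel_eq_fil : F.borel = F.fil 0 := by
  refine le_antisymm (F.sub_mono (by simp) fun r h => ?_) (F.sub_mono (by simp) fun r h => ?_)
  · omega
  · have := F.ht_ne_zero r
    omega

lemma fil_eq_bot {K : ℕ} (hK : ∀ r, F.ht r < K) {k : ℤ} (hk : K ≤ k) (hk0 : 0 < k) :
    F.fil k = ⊥ := by
  rw [eq_bot_iff]
  refine F.sub_le (fun h => absurd h (by omega)) fun r hr => ?_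
  have := hK r
  omega

lemma fil_eq_top {K : ℕ} (hK : ∀ r, -(K : ℤ) < F.ht r) : F.fil (-(K : ℤ)) = ⊤ := by
  rw [eq_top_iff, ← F.sub_eq_top]
  exact F.sub_mono (fun _ => by omega) fun r _ => (hK r).le

lemma isNilpotent_ad {x : g} (hx : x ∈ F.npos) : IsNilpotent (LieAlgebra.ad ℂ g x) := by
  obtain ⟨K, hK⟩ := F.exists_ht_lt
  rw [F.npos_eq_fil] at hx
  have h : ∀ (m : ℕ) v, (LieAlgebra.ad ℂ g x ^ m) v ∈ F.fil (-(K : ℤ) + m) := by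
    intro m v
    induction m with
    | zero =>
      rw [Nat.cast_zero, add_zero, F.fil_eq_top fun r => (hK r).2]
      trivial
    | succ m ih =>
      rw [pow_succ', Module.End.mul_apply]
      refine F.lie_mem_fil ?_ hx ih
      push_cast
      omega
  refine ⟨2 * K + 1, ?_⟩
  ext v
  have := h (2 * K + 1) v
  rw [F.fil_eq_bot (fun r => (hK r).1) (by push_cast; omega) (by push_cast; omega)] at this
  simpa using this

lemma isCompl_borel_nneg : IsCompl F.borel F.nneg := by
  constructor
  · rw [Submodule.disjoint_def]
    intro x hx hx'
    refine F.ext ?_ fun r => ?_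
    · rw [hx'.1 not_false, map_zero]
    · rw [map_zero]
      by_cases h : 0 < F.ht r
      · exact hx'.2 r (by omega)
      · exact hx.2 r h
  · rw [codisjoint_iff, eq_top_iff, ← F.sub_eq_top]
    refine F.sub_le (fun _ => (F.H_le_sub trivial _).trans le_sup_left) fun r _ => ?_
    rcases lt_or_gt_of_ne (F.ht_ne_zero r) with h | h
    · exact Submodule.mem_sup_right (F.e_mem_sub h)
    · exact Submodule.mem_sup_left (F.e_mem_sub h)

lemma isNullspace_borel : IsNullspace g F.borel := by
  intro x hx y hy z hz
  have h : ⁅x, y⁆ ∈ F.npos := by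
    refine F.lie_mem_sub (fun _ _ h => h) (fun _ h _ => h) (fun r s t h1 h2 h3 => ?_)
      (fun r h1 h2 => ?_) hx hy
    · rw [F.ht_add h3]
      omega
    · rw [F.ht_neg] at h2
      omega
  refine F.kill_eq_zero (by simp) (fun r h1 h2 => ?_) h hz
  rw [F.ht_neg] at h2
  omega

/-! ### Subspaces stable under the positive part -/

/-- A total order on roots compatible with addition and refining the height. -/
lemma exists_order : ∃ o : R → ℤ ×ₗ (ℝ ×ₗ ℝ), (∀ r s t, F.Add r s t → o t = o r + o s) ∧
    (∀ r, o (F.neg r) = - o r) ∧ (∀ r s, o r = o s → r = s) ∧ ∀ r s, o r ≤ o s → F.ht r ≤ F.ht s := by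
  obtain ⟨z, hz, -, hz2⟩ := F.exists_sep
  refine ⟨fun r => toLex (F.ht r, toLex ((F.wt r z).re, (F.wt r z).im)), fun r s t h => ?_,
    fun r => ?_, fun r s h => ?_, fun r s h => ?_⟩
  · simp only [F.ht_add h, ← h z hz]
    rfl
  · simp only [F.ht_neg, F.wt_neg]
    rfl
  · have h2 := congrArg (fun p => (ofLex (ofLex p).2)) h
    simp only [ofLex_toLex, Prod.mk.injEq] at h2
    exact hz2 r s (Complex.ext h2.1 h2.2)
  · rw [Prod.Lex.toLex_le_toLex] at h
    rcases h with h | h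
    · exact h.le
    · exact h.1.le

/-- A nullspace stable under the positive part is contained in the Borel subalgebra. -/
lemma le_borel_of_isNullspace {W : Submodule ℂ g} (hW : IsNullspace g W)
    (hstab : ∀ x ∈ F.npos, ∀ w ∈ W, ⁅x, w⁆ ∈ W) : W ≤ F.borel := by
  classical
  by_contra hnot
  obtain ⟨w, hw, hwb⟩ := SetLike.not_le_iff_exists.mp hnot
  obtain ⟨r₀, hr₀, hr₀'⟩ : ∃ r, ¬ 0 < F.ht r ∧ F.coef r w ≠ 0 := by
    by_contra hcon
    exact hwb ⟨fun h => absurd trivial h, fun r hr => by_contra fun h => hcon ⟨r, hr, h⟩⟩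
  obtain ⟨o, oadd, oneg, oinj, oht⟩ := F.exists_order
  -- Take the lowest root `r` occurring in `w`; it is negative. With `p = -r`, the elements `w`, `u
  -- = ⁅e p, w⁆` and `v = ⁅e p, u⁆` all lie in `W` and have lowest terms proportional to `e r`, `h₀
  -- = ⁅e p, e r⁆` and `e p`. The lowest terms alone determine `w (w, u, v)`, and they give a
  -- nonzero value.
  obtain ⟨r, hr, hmin⟩ := Finset.exists_min_image (Finset.univ.filter fun r => F.coef r w ≠ 0) o
    ⟨r₀, by simpa using hr₀'⟩
  rw [Finset.mem_filter] at hr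
  have hmin' : ∀ s, F.coef s w ≠ 0 → o r ≤ o s := fun s hs => hmin s (by simpa using hs)
  have hrht : F.ht r < 0 := by
    have h1 := oht _ _ (hmin' r₀ hr₀')
    have h2 := F.ht_ne_zero r
    omega
  have hor : o r < 0 := by
    have h1 : ¬ o (F.neg r) ≤ o r := fun h => by
      have := oht _ _ h
      rw [F.ht_neg] at this
      omega
    rw [oneg, not_le] at h1
    by_contra h2
    rw [not_lt] at h2
    exact absurd h1 (not_lt.mpr ((neg_nonpos.mpr h2).trans h2))
  set p := F.neg r with hp
  have hop : o p = - o r := oneg r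
  -- Strict and weak filtrations by the order, with `H` placed at level zero. Membership in `G l`
  -- expresses being of higher order than level `l`.
  let G : (ℤ ×ₗ (ℝ ×ₗ ℝ)) → Submodule ℂ g := fun l => F.sub (l < 0) fun s => l < o s
  let G' : (ℤ ×ₗ (ℝ ×ₗ ℝ)) → Submodule ℂ g := fun l => F.sub (l ≤ 0) fun s => l ≤ o s
  have GG : ∀ l m x y, x ∈ G l → y ∈ G' m → ⁅x, y⁆ ∈ G (l + m) := by
    intro l m x y hx hy
    refine F.lie_mem_sub (fun s h1 h2 => ?_) (fun s h1 h2 => ?_) (fun s t u h1 h2 h3 => ?_)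
      (fun s h1 h2 => ?_) hx hy
    · simpa using add_lt_add_of_lt_of_le h1 h2
    · simpa using add_lt_add_of_lt_of_le h1 h2
    · rw [oadd _ _ _ h3]
      exact add_lt_add_of_lt_of_le h1 h2
    · rw [oneg] at h2
      simpa using add_lt_add_of_lt_of_le h1 h2
  have Gle : ∀ l, G l ≤ G' l := fun l => F.sub_mono le_of_lt fun _ => le_of_lt
  have epG : F.e p ∈ G' (o p) := F.e_mem_sub le_rfl
  have erG : F.e r ∈ G' (o r) := F.e_mem_sub le_rfl
  set c := F.coef r w with hc
  have hc0 : c ≠ 0 := hr.2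
  have hw1 : w - c • F.e r ∈ G (o r) := by
    refine ⟨fun h => absurd hor h, fun s hs => ?_⟩
    rw [map_sub, map_smul, F.coef_e]
    by_cases hsr : s = r
    · subst hsr
      simp [hc]
    · rw [if_neg hsr, smul_zero, sub_zero]
      by_contra hne
      exact hs (lt_of_le_of_ne (hmin' s hne) fun h => hsr (oinj _ _ h.symm))
  have ep : F.e p ∈ F.npos := by
    refine F.e_mem_sub ?_
    rw [hp, F.ht_neg]
    omega
  set h₀ := ⁅F.e p, F.e r⁆ with hh₀
  have hrp : F.neg p = r := F.neg_neg r
  have h₀H : h₀ ∈ F.H := by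
    have := F.lie_e_neg_mem p
    rwa [hrp] at this
  have h₀p : F.wt p h₀ ≠ 0 := by
    have := F.wt_lie_e_neg p
    rwa [hrp] at this
  have h₀G : h₀ ∈ G' 0 := F.H_le_sub le_rfl _ h₀H
  set u := ⁅F.e p, w⁆ with hu
  have hu1 : u - c • h₀ ∈ G 0 := by
    have h1 : u - c • h₀ = - ⁅w - c • F.e r, F.e p⁆ := by
      rw [lie_skew, lie_sub, lie_smul]
    rw [h1]
    have := GG _ _ _ _ hw1 epG
    rw [hop, add_neg_cancel] at this
    exact neg_mem this
  set v := ⁅F.e p, u⁆ with hv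
  have hv1 : v - (-c * F.wt p h₀) • F.e p ∈ G (o p) := by
    have h1 : v - (-c * F.wt p h₀) • F.e p = - ⁅u - c • h₀, F.e p⁆ := by
      rw [lie_skew, lie_sub, lie_smul, ← lie_skew _ h₀, F.lie_e h₀ h₀H, mul_smul, neg_smul, smul_neg]
    rw [h1]
    have := GG _ _ _ _ hu1 epG
    rw [zero_add] at this
    exact neg_mem this
  have huW : u ∈ W := hstab _ ep _ hw
  have hvW : v ∈ W := hstab _ ep _ huW
  have hu' : u ∈ G' 0 := by
    have := (G' 0).add_mem (Gle 0 hu1) ((G' 0).smul_mem c h₀G)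
    simpa using this
  have hwu : ⁅w, u⁆ - (c * c * F.wt p h₀) • F.e r ∈ G (o r) := by
    have h1 : ⁅w, u⁆ - (c * c * F.wt p h₀) • F.e r =
        ⁅w - c • F.e r, u⁆ + c • -⁅u - c • h₀, F.e r⁆ := by
      have h2 : F.wt r h₀ = - F.wt p h₀ := by rw [← hrp, F.wt_neg]
      rw [lie_skew, sub_lie, smul_lie, lie_sub, lie_smul, ← lie_skew _ h₀, F.lie_e h₀ h₀H, h2]
      module
    rw [h1]
    refine add_mem ?_ (Submodule.smul_mem _ _ (neg_mem ?_))
    · have := GG _ _ _ _ hw1 hu'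
      rwa [add_zero] at this
    · have := GG _ _ _ _ hu1 erG
      rwa [zero_add] at this
  have Gkill : ∀ x y, x ∈ G (o r) → y ∈ G' (o p) → killingForm ℂ g x y = 0 := by
    intro x y hx hy
    refine F.kill_eq_zero ?_ (fun s h1 h2 => ?_) hx hy
    · rintro ⟨h1, h2⟩
      rw [hop] at h2
      exact absurd h1 (not_lt.mpr (neg_nonpos.mp h2))
    · rw [oneg s, hop] at h2
      exact absurd h1 (not_lt.mpr (neg_le_neg_iff.mp h2))
  have hzero := hW w hw u huW v hvW
  rw [MaxNull.w] at hzero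
  have e1 : killingForm ℂ g ⁅w, u⁆ v =
      (c * c * F.wt p h₀) * ((-c * F.wt p h₀) * killingForm ℂ g (F.e r) (F.e p)) := by
    have hv2 : v ∈ G' (o p) := by
      have := (G' (o p)).add_mem (Gle _ hv1) ((G' (o p)).smul_mem (-c * F.wt p h₀) epG)
      simpa using this
    have a1 := Gkill _ _ hwu hv2
    have a2 : killingForm ℂ g (F.e r) (v - (-c * F.wt p h₀) • F.e p) = 0 := by
      rw [killingForm_symm]
      refine F.kill_eq_zero (b := o r ≤ 0) (Q := fun s => o r ≤ o s) ?_ (fun s h1 h2 => ?_) hv1 erG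
      · rintro ⟨h1, h2⟩
        rw [hop] at h1
        exact absurd hor (not_lt.mpr (neg_neg_iff_pos.mp h1).le)
      · rw [oneg] at h2
        rw [hop] at h1
        exact absurd h1 (not_lt.mpr (le_neg_of_le_neg h2))
    rw [map_sub, LinearMap.sub_apply, map_smul, LinearMap.smul_apply, sub_eq_zero] at a1
    rw [map_sub, map_smul, sub_eq_zero] at a2
    rw [a1, a2]
    rfl
  rw [e1] at hzero
  have := F.kill_e_neg r
  simp [hc0, h₀p] at hzero
  exact this hzero

end RootFrame

end MaxNull

namespace MaxNull

open Filter Topology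

/-! ### The maximal dimension of a nullspace, and general position. -/

section General

variable {g : Type*} [LieRing g] [LieAlgebra ℂ g] [FiniteDimensional ℂ g]

lemma IsNullspace.map {φ : g ≃ₗ[ℂ] g} (hlie : ∀ a b, φ ⁅a, b⁆ = ⁅φ a, φ b⁆)
    {U : Submodule ℂ g} (hU : IsNullspace g U) : IsNullspace g (U.map φ.toLinearMap) := by
  rintro _ ⟨x, hx, rfl⟩ _ ⟨y, hy, rfl⟩ _ ⟨z, hz, rfl⟩
  rw [w]
  change killingForm ℂ g ⁅φ x, φ y⁆ (φ z) = 0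
  rw [← hlie]
  refine Eq.trans ?_ (hU x hx y hy z hz)
  exact LieAlgebra.killingForm_of_equiv_apply
    ({ φ with map_lie' := fun {a b} => hlie a b } : g ≃ₗ⁅ℂ⁆ g) ⁅x, y⁆ z

lemma IsNullspace.limitSpace {U : ℕ → Submodule ℂ g} (hU : ∀ n, IsNullspace g (U n)) :
    IsNullspace g (limitSpace U) := by
  rintro x ⟨p, hp, hp'⟩ y ⟨q, hq, hq'⟩ z ⟨r, hr, hr'⟩
  have h1 := (hp'.bilin hq' (LieModule.toEnd ℂ g g : g →ₗ[ℂ] g →ₗ[ℂ] g)).bilinForm hr'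
    (killingForm ℂ g)
  refine tendsto_nhds_unique h1 ?_
  have h2 : (fun n => killingForm ℂ g ((LieModule.toEnd ℂ g g : g →ₗ[ℂ] g →ₗ[ℂ] g) (p n) (q n))
      (r n)) = fun _ => 0 := by
    funext n
    exact hU n _ (hp n) _ (hq n) _ (hr n)
  rw [h2]
  exact tendsto_const_nhds

lemma expEquiv_smul_ad (c : ℂ) (x : g) : expEquiv (c • LieAlgebra.ad ℂ g x) = expAd (c • x) := by
  rw [expAd, map_smul]

variable (g) in
lemma exists_mem_Y : ∃ U, U ∈ Y g := by
  obtain ⟨U, hU, hmin⟩ := (measure fun U : Submodule ℂ g =>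
    Module.finrank ℂ g - Module.finrank ℂ U).wf.has_min {U | IsNullspace g U}
    ⟨⊥, fun x hx y hy z hz => by
      rw [Submodule.mem_bot] at hz
      rw [w, hz, map_zero]⟩
  refine ⟨U, hU, fun U' hU' => ?_⟩
  have h1 : ¬ (Module.finrank ℂ g - Module.finrank ℂ U' < Module.finrank ℂ g - Module.finrank ℂ U) :=
    hmin U' hU'
  have h2 := Submodule.finrank_le U'
  omega

end General

namespace RootFrame

variable {g : Type*} [LieRing g] [LieAlgebra ℂ g] [FiniteDimensional ℂ g]
variable {R : Type*} [Fintype R] [DecidableEq R] (F : RootFrame g R)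

/-- A subspace is transversal if it meets the negative part trivially. -/
def Transversal (U : Submodule ℂ g) : Prop := ∀ x ∈ U, x ∈ F.nneg → x = 0

lemma transversal_of_le_borel {U : Submodule ℂ g} (h : U ≤ F.borel) : F.Transversal U :=
  fun _ hx hn => Submodule.disjoint_def.mp F.isCompl_borel_nneg.disjoint _ (h hx) hn

/-- A maximal nullspace can be moved to general position with respect to the negative part by any
group containing the exponentials of the positive part. -/
lemma exists_transversal_aux {U₀ : Submodule ℂ g} (hU₀ : U₀ ∈ Y g) {Γ : Subgroup (g ≃ₗ[ℂ] g)}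
    (hΓ : ∀ x ∈ F.npos, expAd x ∈ Γ) :
    Module.finrank ℂ U₀ ≤ Module.finrank ℂ F.borel ∧
      ∃ ψ ∈ Γ, F.Transversal (U₀.map ψ.toLinearMap) := by
  -- The last clause carries transversality backwards through the limits: when a `Γ`-translate of
  -- the limit is transversal, so is one of some member of the sequence, by openness. The members
  -- are `Γ`-translates of the previous space because only exponentials of `n₊` occur.
  let P : Submodule ℂ g → Prop := fun U => IsNullspace g U ∧
    Module.finrank ℂ U = Module.finrank ℂ U₀ ∧
    ∀ ψ ∈ Γ, F.Transversal (U.map ψ.toLinearMap) → ∃ ψ' ∈ Γ, F.Transversal (U₀.map ψ'.toLinearMap)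
  have hP₀ : P U₀ := ⟨hU₀.1, rfl, fun ψ hψ h => ⟨ψ, hψ, h⟩⟩
  obtain ⟨K, hK⟩ := F.exists_ht_lt
  have hnpos : F.fil ((0 : ℕ) + 1) = F.npos := by
    rw [F.npos_eq_fil]
    rfl
  obtain ⟨W, ⟨hW1, hW2, hW3⟩, hstab⟩ := exists_stable_of_chain (P := P)
    (fun k => F.fil ((k : ℤ) + 1))
    (fun k => F.sub_mono (fun h => by push_cast at h; omega) fun r h => by push_cast at h; omega)
    (fun k x hx y hy => F.lie_mem_fil (by push_cast; omega) hx hy) K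
    (F.fil_eq_bot (fun r => (hK r).1) (by omega) (by omega)) (by
      rintro x hx U ⟨hU1, hU2, hU3⟩ S hS hSU
      simp only [Nat.cast_zero, zero_add] at hx
      rw [← F.npos_eq_fil] at hx
      have hnil := F.isNilpotent_ad hx
      obtain ⟨h1, h2⟩ := limitSpace_of_isNilpotent hnil U
      have hnull : IsNullspace g (limitSpace fun n : ℕ =>
          U.map (expEquiv (((n : ℂ) + 1) • LieAlgebra.ad ℂ g x)).toLinearMap) := by
        refine IsNullspace.limitSpace fun n => ?_
        rw [expEquiv_smul_ad]
        exact hU1.map (expAd_lie _)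
      refine ⟨_, ⟨hnull, le_antisymm (hU₀.2 _ hnull) (hU2 ▸ h1), fun ψ hψ hψT => ?_⟩, h2,
        limit_stable_of_derivation (fun a b => by simp) U S hS hSU⟩
      obtain ⟨n, hn⟩ := exists_transversal_of_limitSpace (d := Module.finrank ℂ U)
        (N := F.nneg.comap ψ.toLinearMap) (fun n => (Submodule.finrank_map_le _ _)) h1
        (fun y hy hy' => ψ.map_eq_zero_iff.mp (hψT _ ⟨y, hy, rfl⟩ hy'))
      refine hU3 (ψ * expAd (((n : ℂ) + 1) • x)) (mul_mem hψ (hΓ _ (F.npos.smul_mem _ hx))) ?_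
      rintro _ ⟨u, hu, rfl⟩ hu'
      have h3 := hn (expAd (((n : ℂ) + 1) • x) u) ⟨u, hu, by rw [expEquiv_smul_ad]; rfl⟩ hu'
      change ψ (expAd (((n : ℂ) + 1) • x) u) = 0
      rw [h3, map_zero]) hP₀
  rw [hnpos] at hstab
  -- The final limit lies in the Borel subspace: this bounds the dimension, and makes the limit
  -- transversal without any further translation.
  have hWb := F.le_borel_of_isNullspace hW1 hstab
  refine ⟨hW2 ▸ Submodule.finrank_mono hWb, hW3 1 (one_mem _) ?_⟩
  refine F.transversal_of_le_borel ?_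
  rintro _ ⟨x, hx, rfl⟩
  exact hWb hx

/-- The Borel subspace is itself null, and degenerating any maximal nullspace into it shows that its
dimension is the largest possible. -/
lemma mem_Y_iff {U : Submodule ℂ g} :
    U ∈ Y g ↔ IsNullspace g U ∧ Module.finrank ℂ U = Module.finrank ℂ F.borel := by
  obtain ⟨U₀, hU₀⟩ := exists_mem_Y g
  have h1 := (F.exists_transversal_aux hU₀ (Γ := ⊤) fun _ _ => trivial).1
  have h2 := hU₀.2 _ F.isNullspace_borel
  refine ⟨fun h => ⟨h.1, ?_⟩, fun h => ⟨h.1, fun U' hU' => ?_⟩⟩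
  · exact le_antisymm (F.exists_transversal_aux h (Γ := ⊤) fun _ _ => trivial).1
      (h.2 _ F.isNullspace_borel)
  · rw [h.2]
    exact (hU₀.2 _ hU').trans h1

lemma exists_transversal {U : Submodule ℂ g} (hU : U ∈ Y g) {Γ : Subgroup (g ≃ₗ[ℂ] g)}
    (hΓ : ∀ x ∈ F.npos, expAd x ∈ Γ) : ∃ ψ ∈ Γ, F.Transversal (U.map ψ.toLinearMap) :=
  (F.exists_transversal_aux hU hΓ).2

end RootFrame

end MaxNull

namespace MaxNull

/-! ### Transversal nullspaces: moving `H` inside, and the graph form. -/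

namespace RootFrame

variable {g : Type*} [LieRing g] [LieAlgebra ℂ g] [FiniteDimensional ℂ g]
variable [LieAlgebra.IsKilling ℂ g]
variable {R : Type*} [Fintype R] [DecidableEq R] (F : RootFrame g R)

lemma eq_zero_of_killingForm {x : g} (h : ∀ y, killingForm ℂ g x y = 0) : x = 0 := by
  have h1 := LieAlgebra.IsKilling.killingForm_nondegenerate ℂ g
  exact h1.1 x h

lemma coef_lie_H {h : g} (hh : h ∈ F.H) (r : R) (x : g) :
    F.coef r ⁅h, x⁆ = F.wt r h * F.coef r x := by
  conv_lhs => rw [← F.expand x]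
  rw [lie_add, F.lie_H h hh _ (F.π_mem x), zero_add, lie_sum, map_sum,
    Finset.sum_eq_single_of_mem r (Finset.mem_univ r)]
  · rw [lie_smul, F.lie_e h hh, map_smul, map_smul, F.coef_e, if_pos rfl]
    simp only [smul_eq_mul]
    ring
  · intro s _ hs
    rw [lie_smul, F.lie_e h hh, map_smul, map_smul, F.coef_e, if_neg hs.symm]
    simp

lemma π_lie_H {h : g} (hh : h ∈ F.H) (x : g) : F.π ⁅h, x⁆ = 0 := by
  conv_lhs => rw [← F.expand x]
  rw [lie_add, F.lie_H h hh _ (F.π_mem x), zero_add, lie_sum, map_sum]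
  refine Finset.sum_eq_zero fun s _ => ?_
  rw [lie_smul, F.lie_e h hh, map_smul, map_smul, F.π_e, smul_zero, smul_zero]

lemma isCompl_nneg {V : Submodule ℂ g} (hT : F.Transversal V)
    (hd : Module.finrank ℂ V = Module.finrank ℂ F.borel) : IsCompl V F.nneg := by
  have hdisj : Disjoint V F.nneg := Submodule.disjoint_def.mpr hT
  refine ⟨hdisj, ?_⟩
  rw [codisjoint_iff]
  apply Submodule.eq_top_of_finrank_eq
  have h1 := Submodule.finrank_add_eq_of_isCompl F.isCompl_borel_nneg
  have h2 := Submodule.finrank_sup_add_finrank_inf_eq V F.nneg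
  rw [hdisj.eq_bot, finrank_bot, add_zero] at h2
  rw [h2, hd, h1]

lemma finrank_eq_of_isCompl_nneg {V : Submodule ℂ g} (h : IsCompl V F.nneg) :
    Module.finrank ℂ V = Module.finrank ℂ F.borel := by
  have h1 := Submodule.finrank_add_eq_of_isCompl F.isCompl_borel_nneg
  have h2 := Submodule.finrank_add_eq_of_isCompl h
  omega

lemma exists_lift {V : Submodule ℂ g} (h : IsCompl V F.nneg) (x : g) :
    ∃ a ∈ V, a - x ∈ F.nneg := by
  have hx : x ∈ V ⊔ F.nneg := by rw [h.sup_eq_top]; trivial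
  obtain ⟨a, ha, u, hu, rfl⟩ := Submodule.mem_sup.mp hx
  exact ⟨a, ha, by simpa using hu⟩

lemma lie_nneg_mem {x y : g} (hx : x ∈ F.nneg) (hy : y ∈ F.nneg) : ⁅x, y⁆ ∈ F.nneg := by
  refine F.lie_mem_sub (by simp) (by simp) (fun r s t h1 h2 h3 => ?_) (fun r h1 h2 => ?_) hx hy
  · rw [F.ht_add h3]
    omega
  · rw [F.ht_neg] at h2
    omega

lemma lie_H_sub_mem {P : R → Prop} {h x : g} (hh : h ∈ F.H) (hx : x ∈ F.sub False P) :
    ⁅h, x⁆ ∈ F.sub False P :=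
  F.lie_mem_sub (a := True) (P := fun _ => False) (fun _ _ h => h) (fun _ h => h.elim)
    (fun _ _ _ h => h.elim) (fun _ h => h.elim) (F.H_le_sub trivial _ hh) hx

lemma kill_nneg {x y : g} (hx : x ∈ F.nneg) (hy : y ∈ F.nneg) : killingForm ℂ g x y = 0 := by
  refine F.kill_eq_zero (by simp) (fun r h1 h2 => ?_) hx hy
  rw [F.ht_neg] at h2
  omega

/-- Lifts of elements of the Cartan subalgebra to a transversal nullspace commute. -/
lemma lie_lift_eq_zero {V : Submodule ℂ g} (hV : IsNullspace g V) (hc : IsCompl V F.nneg)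
    {x y a b : g} (hx : x ∈ F.H) (hy : y ∈ F.H) (ha : a ∈ V) (hax : a - x ∈ F.nneg) (hb : b ∈ V)
    (hby : b - y ∈ F.nneg) : ⁅a, b⁆ = 0 := by
  have hmem : ⁅a, b⁆ ∈ F.nneg := by
    have h1 : ⁅a, b⁆ = ⁅x, b - y⁆ + -⁅y, a - x⁆ + ⁅a - x, b - y⁆ + ⁅x, y⁆ := by
      simp only [lie_sub, sub_lie, ← lie_skew y]
      abel
    rw [h1, F.lie_H x hx y hy, add_zero]
    exact add_mem (add_mem (F.lie_H_sub_mem hx hby) (neg_mem (F.lie_H_sub_mem hy hax)))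
      (F.lie_nneg_mem hax hby)
  -- `⁅a, b⁆` is orthogonal to `V` by nullity and to `n₋` because it lies in `n₋`; these two
  -- subspaces span `g`.
  refine eq_zero_of_killingForm fun z => ?_
  obtain ⟨v, hv, hvz⟩ := F.exists_lift hc z
  have h1 : killingForm ℂ g ⁅a, b⁆ v = 0 := hV a ha b hb v hv
  have h2 := F.kill_nneg hmem hvz
  rw [map_sub, h1, zero_sub, neg_eq_zero] at h2
  exact h2

/-- Elements of the adjoint group which preserve `F.sub True P` and are lower unipotent. -/
structure IsLower (P : R → Prop) (ν : g ≃ₗ[ℂ] g) : Prop where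
  mem : ν ∈ adjointGroup g
  map_sub : ∀ v ∈ F.sub True P, ν v ∈ F.sub True P
  map_nneg : ∀ v ∈ F.nneg, ν v ∈ F.nneg
  map_H : ∀ x ∈ F.H, ν x - x ∈ F.nneg

variable {F} in
lemma IsLower.mul {P : R → Prop} {ν ν' : g ≃ₗ[ℂ] g} (h : F.IsLower P ν) (h' : F.IsLower P ν') :
    F.IsLower P (ν * ν') where
  mem := mul_mem h.mem h'.mem
  map_sub := fun v hv => h.map_sub _ (h'.map_sub v hv)
  map_nneg := fun v hv => h.map_nneg _ (h'.map_nneg v hv)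
  map_H := fun x hx => by
    have h1 := add_mem (h.map_nneg _ (h'.map_H x hx)) (h.map_H x hx)
    rw [_root_.map_sub, sub_add_sub_cancel] at h1
    exact h1

/-- Closure of a set of roots under sums. -/
def Closed (P : R → Prop) : Prop := ∀ r s t, P r → P s → F.Add r s t → P t

lemma lie_mem_of_closed {P : R → Prop} (hP : F.Closed P) {x y : g} (hx : x ∈ F.sub True P)
    (hy : y ∈ F.sub True P) : ⁅x, y⁆ ∈ F.sub True P :=
  F.lie_mem_sub (fun _ _ h => h) (fun _ h _ => h) (fun r s t h1 h2 h3 => hP r s t h1 h2 h3)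
    (fun _ _ _ => trivial) hx hy

lemma isLower_expAd {P : R → Prop} (hP : F.Closed P) {y : g} (hy : y ∈ F.nneg)
    (hyP : y ∈ F.sub True P) : F.IsLower P (expAd y) where
  mem := expAd_mem_adjointGroup y
  map_sub := fun _ hv => expAd_mem (fun _ hw => F.lie_mem_of_closed hP hyP hw) hv
  map_nneg := fun _ hv => expAd_mem (fun _ hw => F.lie_nneg_mem hy hw) hv
  map_H := fun x hx => expAd_sub_mem (fun _ hw => F.lie_nneg_mem hy hw) (by
    rw [← lie_skew]
    exact neg_mem (F.lie_H_sub_mem hx hy))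

lemma isLower_one (P : R → Prop) : F.IsLower P 1 where
  mem := one_mem _
  map_sub := fun _ hv => hv
  map_nneg := fun _ hv => hv
  map_H := fun x _ => by
    rw [LinearEquiv.coe_one, id, sub_self]
    exact zero_mem _

/-- A lower unipotent perturbation of `ρ` is conjugate to `ρ`. -/
lemma exists_isLower_eq_ρ {P : R → Prop} (hP : F.Closed P) {a : g} (ha : a - F.ρ ∈ F.nneg)
    (haP : a ∈ F.sub True P) : ∃ ν, F.IsLower P ν ∧ ν a = F.ρ := by
  -- The error `a - ρ` is pushed down this filtration one height at a time until it vanishes.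
  let L : ℕ → Submodule ℂ g := fun k => F.sub False fun r => P r ∧ F.ht r ≤ -(k : ℤ)
  have hL : ∀ k l x y, x ∈ L k → y ∈ L l → 0 < k → ⁅x, y⁆ ∈ L (k + l) := by
    intro k l x y hx hy hk
    refine F.lie_mem_sub (by simp) (by simp) (fun r s t h1 h2 h3 => ?_) (fun r h1 h2 => ?_) hx hy
    · have h4 := h1.2
      have h5 := h2.2
      refine ⟨hP r s t h1.1 h2.1 h3, ?_⟩
      rw [F.ht_add h3]
      push_cast
      omega
    · have h4 := h1.2
      have h5 := h2.2
      rw [F.ht_neg] at h5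
      omega
  have hLnneg : ∀ k, 0 < k → L k ≤ F.nneg := fun k hk => F.sub_mono (fun h => h) fun r h => by
    have := h.2
    omega
  have hLP : ∀ k, L k ≤ F.sub True P := fun k => F.sub_mono (fun h => h.elim) fun r h => h.1
  have hLanti : ∀ j k, j ≤ k → L k ≤ L j := fun j k hjk => F.sub_mono (fun h => h) fun r h => ⟨h.1, by
    have := h.2
    omega⟩
  have key : ∀ k : ℕ, ∃ ν, F.IsLower P ν ∧ ν a - F.ρ ∈ L (k + 1) := by
    intro k
    induction k with
    | zero =>
      refine ⟨1, F.isLower_one P, ?_⟩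
      refine ⟨fun _ => ha.1 not_false, fun r hr => ?_⟩
      change F.coef r (a - F.ρ) = 0
      by_cases h1 : P r
      · refine ha.2 r fun h2 => hr ⟨h1, ?_⟩
        push_cast
        omega
      · rw [map_sub, haP.2 r h1, F.coef_of_mem r _ F.ρ_mem, sub_zero]
    | succ k ih =>
      obtain ⟨ν, hν, hνa⟩ := ih
      set u := ν a - F.ρ with hu
      have hνa' : ν a = F.ρ + u := by rw [hu]; abel
      -- On height `-(k + 1)` the bracket with `ρ` is multiplication by `-(k + 1)`, so with this
      -- factor `⁅y, ρ⁆` cancels the component of `u` of that height.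
      let y : g := (-((k : ℂ) + 1)⁻¹) • u
      have hk0 : (k : ℂ) + 1 ≠ 0 := Nat.cast_add_one_ne_zero k
      have hy : y ∈ L (k + 1) := Submodule.smul_mem _ _ hνa
      refine ⟨expAd y * ν, (F.isLower_expAd hP (hLnneg _ k.succ_pos hy) (hLP _ hy)).mul hν, ?_⟩
      have hst : ∀ v ∈ L (k + 1 + 1), ⁅y, v⁆ ∈ L (k + 1 + 1) := fun v hv =>
        hLanti _ _ (by omega) (hL _ _ _ _ hy hv k.succ_pos)
      have hyρ : ⁅y, F.ρ⁆ ∈ L (k + 1) := by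
        rw [← lie_skew]
        exact neg_mem (F.lie_H_sub_mem F.ρ_mem hy)
      have h1 : expAd y F.ρ - F.ρ - ⁅y, F.ρ⁆ ∈ L (k + 1 + 1) :=
        expAd_sub_sub_mem hst (hLanti _ _ (by omega) (hL _ _ _ _ hy hyρ k.succ_pos))
      have h2 : expAd y u - u ∈ L (k + 1 + 1) :=
        expAd_sub_mem hst (hLanti _ _ (by omega) (hL _ _ _ _ hy hνa k.succ_pos))
      have h3 : u + ⁅y, F.ρ⁆ ∈ L (k + 1 + 1) := by
        have hmem : u + ⁅y, F.ρ⁆ ∈ L (k + 1) := add_mem hνa hyρ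
        refine ⟨hmem.1, fun r hr => ?_⟩
        by_cases h4 : P r ∧ F.ht r ≤ -((k + 1 : ℕ) : ℤ)
        · have h5 : F.ht r = -((k : ℤ) + 1) := by
            have h6 : ¬ F.ht r ≤ -((k + 1 + 1 : ℕ) : ℤ) := fun h => hr ⟨h4.1, h⟩
            have h7 := h4.2
            push_cast at h6 h7
            omega
          rw [map_add, ← lie_skew, map_neg, F.coef_lie_H F.ρ_mem, F.wt_ρ, h5]
          simp only [y, map_smul, smul_eq_mul]
          push_cast
          field_simp
          ring
        · exact hmem.2 r h4
      have h4 : (expAd y * ν) a - F.ρ =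
          (expAd y F.ρ - F.ρ - ⁅y, F.ρ⁆) + (expAd y u - u) + (u + ⁅y, F.ρ⁆) := by
        rw [LinearEquiv.mul_apply, hνa', map_add]
        abel
      rw [h4]
      exact add_mem (add_mem h1 h2) h3
  obtain ⟨K, hK⟩ := F.exists_ht_lt
  obtain ⟨ν, hν, hνa⟩ := key K
  refine ⟨ν, hν, ?_⟩
  rw [← sub_eq_zero, ← Submodule.mem_bot ℂ]
  refine F.sub_le (fun h => h.elim) (fun r hr => ?_) hνa
  have h1 := (hK r).2
  have h2 := hr.2
  push_cast at h2
  omega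

/-- A transversal maximal nullspace can be moved by a lower unipotent element so as to contain the
Cartan subalgebra. -/
lemma exists_isLower_H_le {P : R → Prop} (hP : F.Closed P) {V : Submodule ℂ g}
    (hV : IsNullspace g V) (hc : IsCompl V F.nneg) (hVP : V ≤ F.sub True P) :
    ∃ ν, F.IsLower P ν ∧ F.H ≤ V.map ν.toLinearMap ∧ IsCompl (V.map ν.toLinearMap) F.nneg := by
  obtain ⟨a, haV, ha⟩ := F.exists_lift hc F.ρ
  obtain ⟨ν, hν, hνa⟩ := F.exists_isLower_eq_ρ hP ha (hVP haV)
  have hnmap : F.nneg.map ν.toLinearMap = F.nneg :=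
    Submodule.eq_of_le_of_finrank_eq (by rintro _ ⟨y, hy, rfl⟩; exact hν.map_nneg y hy)
      (LinearEquiv.finrank_map_eq ν F.nneg)
  have hc' : IsCompl (V.map ν.toLinearMap) F.nneg := by
    rw [← hnmap]
    exact hc.map (Submodule.orderIsoMapComap ν)
  refine ⟨ν, hν, fun x hx => ?_, hc'⟩
  have hV' := hV.map (φ := ν) (map_lie_of_mem_adjointGroup hν.mem)
  have hρ : F.ρ ∈ V.map ν.toLinearMap := ⟨a, haV, hνa⟩
  obtain ⟨b, hb, hbx⟩ := F.exists_lift hc' x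
  -- The lift `b` of `x` commutes with `ρ`, and `ρ` has nonzero weight on every root space; so `b`
  -- has no root components and equals `x`.
  have h1 := F.lie_lift_eq_zero hV' hc' F.ρ_mem hx hρ (by rw [sub_self]; exact zero_mem _) hb hbx
  have h2 : ∀ r, F.coef r (b - x) = 0 := by
    intro r
    have h3 := F.coef_lie_H F.ρ_mem r b
    rw [h1, map_zero, F.wt_ρ, eq_comm, mul_eq_zero] at h3
    rw [map_sub, F.coef_of_mem r x hx, sub_zero]
    exact h3.resolve_left (by exact_mod_cast F.ht_ne_zero r)
  have h3 : b - x = 0 := F.ext (by rw [map_zero]; exact hbx.1 not_false) (by simpa using h2)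
  rw [sub_eq_zero] at h3
  rwa [← h3]

/-- The subspace attached to a family of coefficients. -/
def graph (c : R → ℂ) : Submodule ℂ g where
  carrier := {v | ∀ r, 0 < F.ht r → F.coef (F.neg r) v = c r * F.coef r v}
  add_mem' := fun {x y} hx hy r hr => by
    rw [map_add, map_add, hx r hr, hy r hr, mul_add]
  zero_mem' := fun r _ => by simp
  smul_mem' := fun a x hx r hr => by
    rw [map_smul, map_smul, hx r hr, smul_eq_mul, smul_eq_mul]
    ring

lemma mem_graph {c : R → ℂ} {v : g} :
    v ∈ F.graph c ↔ ∀ r, 0 < F.ht r → F.coef (F.neg r) v = c r * F.coef r v := Iff.rfl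

lemma graph_congr {c c' : R → ℂ} (h : ∀ r, 0 < F.ht r → c r = c' r) : F.graph c = F.graph c' := by
  ext v
  simp only [mem_graph]
  exact forall₂_congr fun r hr => by rw [h r hr]

lemma H_le_graph (c : R → ℂ) : F.H ≤ F.graph c := fun x hx r _ => by
  rw [F.coef_of_mem _ x hx, F.coef_of_mem _ x hx, mul_zero]

lemma neg_injective : Function.Injective F.neg := fun r s h => by
  rw [← F.neg_neg r, h, F.neg_neg]

lemma e_add_mem_graph (c : R → ℂ) {r : R} (hr : 0 < F.ht r) :
    F.e r + c r • F.e (F.neg r) ∈ F.graph c := by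
  intro s hs
  have h1 : F.neg s ≠ r := by
    rintro rfl
    rw [F.ht_neg] at hr
    omega
  have h2 : s ≠ F.neg r := by
    rintro rfl
    exact h1 (F.neg_neg r)
  simp only [map_add, map_smul, F.coef_e, h1, h2, if_false, F.neg_injective.eq_iff]
  by_cases h : s = r
  · simp [h]
  · simp [h]

lemma isCompl_graph (c : R → ℂ) : IsCompl (F.graph c) F.nneg := by
  constructor
  · rw [Submodule.disjoint_def]
    intro x hx hx'
    have hpos : ∀ r, 0 < F.ht r → F.coef r x = 0 := fun r hr => hx'.2 r (by omega)
    refine F.ext (by rw [map_zero, hx'.1 not_false]) fun r => ?_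
    rw [map_zero]
    rcases lt_or_gt_of_ne (F.ht_ne_zero r) with h | h
    · have h1 : 0 < F.ht (F.neg r) := by rw [F.ht_neg]; omega
      have h2 := hx _ h1
      rw [F.neg_neg, hpos _ h1, mul_zero] at h2
      exact h2
    · exact hpos r h
  · rw [codisjoint_iff, eq_top_iff, ← F.sub_eq_top]
    refine F.sub_le (fun _ => (F.H_le_graph c).trans le_sup_left) fun r _ => ?_
    rcases lt_or_gt_of_ne (F.ht_ne_zero r) with h | h
    · exact Submodule.mem_sup_right (F.e_mem_sub h)
    · have h1 : F.e r = (F.e r + c r • F.e (F.neg r)) + (-c r) • F.e (F.neg r) := by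
        rw [neg_smul, add_neg_cancel_right]
      rw [h1]
      refine add_mem (Submodule.mem_sup_left (F.e_add_mem_graph c h))
        (Submodule.mem_sup_right (Submodule.smul_mem _ _ (F.e_mem_sub ?_)))
      rw [F.ht_neg]
      omega

lemma eq_of_isCompl_nneg {U V : Submodule ℂ g} (h : U ≤ V) (hU : IsCompl U F.nneg)
    (hV : IsCompl V F.nneg) : U = V :=
  Submodule.eq_of_le_of_finrank_eq h
    ((F.finrank_eq_of_isCompl_nneg hU).trans (F.finrank_eq_of_isCompl_nneg hV).symm)

lemma coef_eq_kill (r : R) {u : g} (hu : u ∈ F.nneg) :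
    killingForm ℂ g (F.e r) u = F.coef (F.neg r) u * killingForm ℂ g (F.e r) (F.e (F.neg r)) := by
  conv_lhs => rw [← F.expand u]
  rw [hu.1 not_false, zero_add, map_sum, Finset.sum_eq_single_of_mem (F.neg r) (Finset.mem_univ _)]
  · simp
  · intro s _ hs
    rw [map_smul, F.kill_e r s hs, smul_zero]

/-- A maximal nullspace containing the Cartan subalgebra, in general position, is a graph. -/
lemma exists_eq_graph {V : Submodule ℂ g} (hV : IsNullspace g V) (hc : IsCompl V F.nneg)
    (hH : F.H ≤ V) : ∃ c, V = F.graph c := by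
  choose a haV ha using fun r : R => F.exists_lift hc (F.e r)
  let c : R → ℂ := fun r => F.coef (F.neg r) (a r - F.e r)
  have key : ∀ r s, 0 < F.ht r → 0 < F.ht s → r ≠ s → F.coef (F.neg s) (a r - F.e r) = 0 := by
    intro r s hr hs hrs
    have hsn : s ≠ F.neg r := by
      rintro rfl
      rw [F.ht_neg] at hs
      omega
    -- This `h` kills `e r` but not `e s`. Nullity on `h`, `a r`, `a s` then isolates the
    -- coefficient of `a r` at `-s`, multiplied by the nonzero number `wt s h`.
    obtain ⟨h, hh, h1, h2⟩ := F.exists_ker r s hrs hsn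
    have h3 : killingForm ℂ g ⁅h, a r⁆ (a s) = 0 := hV h (hH hh) _ (haV r) _ (haV s)
    set u := a r - F.e r with hu
    have har : a r = F.e r + u := by rw [hu]; abel
    have h4 : ⁅h, a r⁆ = ⁅h, u⁆ := by
      rw [har, lie_add, F.lie_e h hh, h1, zero_smul, zero_add]
    have h5 : ⁅h, u⁆ ∈ F.nneg := F.lie_H_sub_mem hh (ha r)
    have h6 := F.kill_nneg h5 (ha s)
    rw [map_sub, ← h4, h3, zero_sub, neg_eq_zero, h4, killingForm_symm, F.coef_eq_kill s h5,
      F.coef_lie_H hh, F.wt_neg] at h6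
    have h7 := F.kill_e_neg s
    simpa [h2, h7] using h6
  have hac : ∀ r, 0 < F.ht r → a r = F.e r + c r • F.e (F.neg r) := by
    intro r hr
    rw [← sub_eq_iff_eq_add']
    refine F.ext ?_ fun s => ?_
    · rw [(ha r).1 not_false, map_smul, F.π_e, smul_zero]
    · rw [map_smul, F.coef_e]
      by_cases hs : s = F.neg r
      · subst hs
        simp [c]
      · rw [if_neg hs, smul_zero]
        rcases lt_or_gt_of_ne (F.ht_ne_zero s) with h | h
        · rw [← F.neg_neg s]
          refine key r (F.neg s) hr (by rw [F.ht_neg]; omega) ?_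
          rintro rfl
          exact hs (F.neg_neg s).symm
        · exact (ha r).2 s (by omega)
  refine ⟨c, (F.eq_of_isCompl_nneg (fun v hv => ?_) (F.isCompl_graph c) hc).symm⟩
  -- `v'` is the element of `V` with the same Cartan part and the same positive coefficients as `v`.
  -- Both lie in the graph, which is transversal to `n₋`, so they agree.
  set v' := F.π v + ∑ r with 0 < F.ht r, F.coef r v • a r with hv'
  have hv'V : v' ∈ V := V.add_mem (hH (F.π_mem v)) (V.sum_mem fun r _ => V.smul_mem _ (haV r))
  have hv'g : v' ∈ F.graph c := by
    refine add_mem (F.H_le_graph c (F.π_mem v)) (sum_mem fun r hr => Submodule.smul_mem _ _ ?_)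
    have hr' := (Finset.mem_filter.mp hr).2
    rw [hac r hr']
    exact F.e_add_mem_graph c hr'
  have hdiff : v - v' ∈ F.nneg := by
    refine ⟨fun _ => ?_, fun r hr => ?_⟩
    · rw [map_sub, hv', map_add, F.π_π, map_sum, Finset.sum_eq_zero, add_zero, sub_self]
      intro s hs
      rw [hac s (Finset.mem_filter.mp hs).2, map_smul, map_add, map_smul, F.π_e, F.π_e]
      simp
    · have hr' : 0 < F.ht r := by
        have := F.ht_ne_zero r
        omega
      rw [map_sub, hv', map_add, F.coef_of_mem r _ (F.π_mem v), zero_add, map_sum,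
        Finset.sum_eq_single_of_mem r (Finset.mem_filter.mpr ⟨Finset.mem_univ _, hr'⟩)]
      · rw [hac r hr', map_smul, map_add, map_smul, F.coef_e, F.coef_e, if_pos rfl,
          if_neg (F.neg_ne r).symm]
        simp
      · intro s hs hsr
        have hs' := (Finset.mem_filter.mp hs).2
        rw [hac s hs', map_smul, map_add, map_smul, F.coef_e, F.coef_e, if_neg hsr.symm, if_neg]
        · simp
        · rintro rfl
          rw [F.ht_neg] at hr'
          omega
  have h0 := Submodule.disjoint_def.mp (F.isCompl_graph c).disjoint _ (sub_mem hv hv'g) hdiff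
  rw [sub_eq_zero] at h0
  rwa [h0]

end RootFrame

end MaxNull

namespace MaxNull

/-! ### Coefficients of null graphs, the torus, and the standard nullspaces. -/

namespace RootFrame

variable {g : Type*} [LieRing g] [LieAlgebra ℂ g] [FiniteDimensional ℂ g]
variable [LieAlgebra.IsKilling ℂ g]
variable {R : Type*} [Fintype R] [DecidableEq R] (F : RootFrame g R)

lemma killingForm_lie (x y z : g) :
    killingForm ℂ g ⁅x, y⁆ z = killingForm ℂ g x ⁅y, z⁆ :=
  LieModule.traceForm_apply_lie_apply ℂ g g x y z

/-- By invariance under `h`, the value times the sum of the three weights is zero. -/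
lemma kill_triple {a b c : R} {h : g} (hh : h ∈ F.H)
    (hne : F.wt a h + F.wt b h + F.wt c h ≠ 0) :
    killingForm ℂ g ⁅F.e a, F.e b⁆ (F.e c) = 0 := by
  have h1 : ⁅h, ⁅F.e a, F.e b⁆⁆ = (F.wt a h + F.wt b h) • ⁅F.e a, F.e b⁆ := by
    rw [leibniz_lie, F.lie_e h hh, F.lie_e h hh, smul_lie, lie_smul, add_smul]
  have h2 : killingForm ℂ g ⁅⁅F.e a, F.e b⁆, h⁆ (F.e c) =
      killingForm ℂ g ⁅F.e a, F.e b⁆ ⁅h, F.e c⁆ := killingForm_lie _ _ _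
  rw [← lie_skew, h1, F.lie_e h hh, map_neg, map_smul, LinearMap.neg_apply, LinearMap.smul_apply,
    map_smul] at h2
  have h3 : (F.wt a h + F.wt b h + F.wt c h) * killingForm ℂ g ⁅F.e a, F.e b⁆ (F.e c) = 0 := by
    simp only [smul_eq_mul] at h2
    linear_combination -h2
  exact (mul_eq_zero.mp h3).resolve_left hne

/-- The multiplicativity relation satisfied by the coefficients of a nullspace. -/
lemma graph_relation {c : R → ℂ} (hc : IsNullspace g (F.graph c)) {a b t : R} (ha : 0 < F.ht a)
    (hb : 0 < F.ht b) (hadd : F.Add a b t) :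
    c t * killingForm ℂ g ⁅F.e a, F.e b⁆ (F.e (F.neg t)) +
      c a * c b * killingForm ℂ g ⁅F.e (F.neg a), F.e (F.neg b)⁆ (F.e t) = 0 := by
  have ht : 0 < F.ht t := by rw [F.ht_add hadd]; omega
  have h := hc _ (F.e_add_mem_graph c ha) _ (F.e_add_mem_graph c hb) _ (F.e_add_mem_graph c ht)
  -- Of the eight terms of the expansion only those with weights `(a, b, -t)` and `(-a, -b, t)` have
  -- total weight zero. The regular element `z` detects that the other six do not.
  obtain ⟨z, hz, hz0, -⟩ := F.exists_sep
  have hzt := hadd z hz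
  have k1 : killingForm ℂ g ⁅F.e a, F.e b⁆ (F.e t) = 0 := F.kill_triple hz (by
    have := hz0 t
    intro h
    exact this (by linear_combination (h - hzt) / 2))
  have k2 : killingForm ℂ g ⁅F.e a, F.e (F.neg b)⁆ (F.e t) = 0 := F.kill_triple hz (by
    have := hz0 a
    rw [F.wt_neg]
    intro h
    exact this (by linear_combination (h + hzt) / 2))
  have k3 : killingForm ℂ g ⁅F.e a, F.e (F.neg b)⁆ (F.e (F.neg t)) = 0 := F.kill_triple hz (by
    have := hz0 b
    rw [F.wt_neg, F.wt_neg]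
    intro h
    exact this (by linear_combination -(h + hzt) / 2 + hzt))
  have k4 : killingForm ℂ g ⁅F.e (F.neg a), F.e b⁆ (F.e t) = 0 := F.kill_triple hz (by
    have := hz0 b
    rw [F.wt_neg]
    intro h
    exact this (by linear_combination (h + hzt) / 2))
  have k5 : killingForm ℂ g ⁅F.e (F.neg a), F.e b⁆ (F.e (F.neg t)) = 0 := F.kill_triple hz (by
    have := hz0 a
    rw [F.wt_neg, F.wt_neg]
    intro h
    exact this (by linear_combination -(h + hzt) / 2 + hzt))
  have k6 : killingForm ℂ g ⁅F.e (F.neg a), F.e (F.neg b)⁆ (F.e (F.neg t)) = 0 :=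
    F.kill_triple hz (by
      have := hz0 t
      rw [F.wt_neg, F.wt_neg, F.wt_neg]
      intro h
      exact this (by linear_combination -(h + hzt) / 2))
  rw [w] at h
  simp only [add_lie, lie_add, smul_lie, lie_smul, map_add, map_smul, LinearMap.add_apply,
    LinearMap.smul_apply, smul_eq_mul, k1, k2, k3, k4, k5, k6] at h
  linear_combination h

/-- A null graph is determined by its coefficients at the simple roots. -/
lemma graph_eq_of_simple {c c' : R → ℂ} (hc : IsNullspace g (F.graph c))
    (hc' : IsNullspace g (F.graph c')) (h : ∀ i ∈ F.Δ, c i = c' i) : F.graph c = F.graph c' := by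
  refine F.graph_congr ?_
  have key : ∀ m : ℕ, ∀ r, 0 < F.ht r → F.ht r ≤ m → c r = c' r := by
    intro m
    induction m with
    | zero => intro r h1 h2; push_cast at h2; omega
    | succ m ih =>
      intro r h1 h2
      rcases F.pos_cases r h1 with hr | ⟨s, i, hi, hs, hadd⟩
      · exact h r hr
      · have hadd' : F.Add s i r := fun x hx => (hadd x hx).symm
        have hs' : 0 < F.ht s := hs
        have hi1 := F.ht_simple hi
        have hht := F.ht_add hadd'
        have e1 := F.graph_relation hc hs' (by omega) hadd'
        have e2 := F.graph_relation hc' hs' (by omega) hadd'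
        rw [← ih s hs' (by push_cast at h2; omega), ← h i hi] at e2
        obtain ⟨N, hN, hNe⟩ := F.lie_e_e s i r hadd'
        have hA : killingForm ℂ g ⁅F.e s, F.e i⁆ (F.e (F.neg r)) ≠ 0 := by
          rw [hNe, map_smul, LinearMap.smul_apply]
          exact smul_ne_zero hN (F.kill_e_neg r)
        have e3 : (c r - c' r) * killingForm ℂ g ⁅F.e s, F.e i⁆ (F.e (F.neg r)) = 0 := by
          linear_combination e1 - e2
        exact sub_eq_zero.mp ((mul_eq_zero.mp e3).resolve_right hA)
  intro r hr
  exact key (F.ht r).toNat r hr (by omega)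

/-! ### The torus -/

lemma expAd_H {h x : g} (hh : h ∈ F.H) (hx : x ∈ F.H) : expAd h x = x := by
  rw [expAd_of_eigenvector (c := 0) (by rw [F.lie_H h hh x hx, zero_smul]), Complex.exp_zero,
    one_smul]

lemma expAd_e {h : g} (hh : h ∈ F.H) (r : R) :
    expAd h (F.e r) = Complex.exp (F.wt r h) • F.e r :=
  expAd_of_eigenvector (F.lie_e h hh r)

lemma coef_expAd {h : g} (hh : h ∈ F.H) (r : R) (x : g) :
    F.coef r (expAd h x) = Complex.exp (F.wt r h) * F.coef r x := by
  conv_lhs => rw [← F.expand x]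
  rw [map_add, map_sum, map_add, map_sum, F.expAd_H hh (F.π_mem x), F.coef_of_mem r _ (F.π_mem x),
    zero_add, Finset.sum_eq_single_of_mem r (Finset.mem_univ r)]
  · rw [map_smul, map_smul, F.expAd_e hh, map_smul, F.coef_e, if_pos rfl]
    simp only [smul_eq_mul]
    ring
  · intro s _ hs
    rw [map_smul, map_smul, F.expAd_e hh, map_smul, F.coef_e, if_neg hs.symm]
    simp

/-- The factor is the quotient of `exp (-r)` on the space of `-r` by `exp r` on that of `r`. Hence
the `2`, and hence the freedom to rescale every nonzero simple coefficient. -/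
lemma map_graph_expAd (c : R → ℂ) {h : g} (hh : h ∈ F.H) :
    (F.graph c).map (expAd h).toLinearMap =
      F.graph fun r => Complex.exp (-(2 * F.wt r h)) * c r := by
  refine Submodule.eq_of_le_of_finrank_eq ?_ ?_
  · rintro _ ⟨v, hv, rfl⟩ r hr
    change F.coef (F.neg r) (expAd h v) = _ * F.coef r (expAd h v)
    rw [F.coef_expAd hh, F.coef_expAd hh, hv r hr, F.wt_neg]
    have h1 : Complex.exp (-(F.wt r h)) = Complex.exp (-(2 * F.wt r h)) * Complex.exp (F.wt r h) := by
      rw [← Complex.exp_add]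
      ring_nf
    rw [h1]
    ring
  · rw [LinearEquiv.finrank_map_eq, F.finrank_eq_of_isCompl_nneg (F.isCompl_graph _),
      F.finrank_eq_of_isCompl_nneg (F.isCompl_graph _)]

lemma exists_coweight (t : R → ℂ) : ∃ h ∈ F.H, ∀ i ∈ F.Δ, F.wt i h = t i := by
  refine ⟨∑ j ∈ F.Δ, t j • F.ϖ j, F.H.sum_mem fun j _ => F.H.smul_mem _ (F.ϖ_mem j), fun i hi => ?_⟩
  rw [map_sum, Finset.sum_eq_single_of_mem i hi]
  · rw [map_smul, F.wt_ϖ i i hi, F.n_simple i hi i hi, if_pos rfl]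
    simp
  · intro j hj hji
    rw [map_smul, F.wt_ϖ i j hj, F.n_simple i hi j hj, if_neg hji.symm]
    simp

/-- Null graphs with the same support on the simple roots are conjugate under the torus. -/
lemma exists_torus_conj {c c' : R → ℂ} (hc : IsNullspace g (F.graph c))
    (hc' : IsNullspace g (F.graph c')) (h : ∀ i ∈ F.Δ, c i = 0 ↔ c' i = 0) :
    ∃ φ ∈ adjointGroup g, (F.graph c).map φ.toLinearMap = F.graph c' := by
  have h1 : ∀ i, ∃ t : ℂ, c i ≠ 0 → c' i ≠ 0 → Complex.exp (-(2 * t)) * c i = c' i := by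
    intro i
    by_cases h0 : c i ≠ 0 ∧ c' i ≠ 0
    · refine ⟨-(Complex.log (c' i / c i)) / 2, fun _ _ => ?_⟩
      have : -(2 * (-(Complex.log (c' i / c i)) / 2)) = Complex.log (c' i / c i) := by ring
      rw [this, Complex.exp_log (div_ne_zero h0.2 h0.1), div_mul_cancel₀ _ h0.1]
    · exact ⟨0, fun h2 h3 => absurd ⟨h2, h3⟩ h0⟩
  choose t ht using h1
  obtain ⟨x, hx, hxt⟩ := F.exists_coweight t
  refine ⟨expAd x, expAd_mem_adjointGroup x, ?_⟩
  rw [F.map_graph_expAd c hx]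
  refine F.graph_eq_of_simple ?_ hc' fun i hi => ?_
  · rw [← F.map_graph_expAd c hx]
    exact hc.map (expAd_lie x)
  · rw [hxt i hi]
    by_cases h0 : c i = 0
    · rw [h0, (h i hi).mp h0, mul_zero]
    · exact ht i h0 fun h2 => h0 ((h i hi).mpr h2)

/-! ### The standard maximal nullspaces -/

/-- The sum of the coefficients of a root at the simple roots outside `I`. -/
def level (I : Finset R) (r : R) : ℤ := ∑ i ∈ F.Δ \ I, F.n r i

lemma level_add (I : Finset R) {r s t : R} (h : F.Add r s t) :
    F.level I t = F.level I r + F.level I s := by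
  rw [level, level, level, ← Finset.sum_add_distrib]
  exact Finset.sum_congr rfl fun i hi => F.n_add h (Finset.mem_sdiff.mp hi).1

lemma level_neg (I : Finset R) (r : R) : F.level I (F.neg r) = - F.level I r := by
  rw [level, level, ← Finset.sum_neg_distrib]
  exact Finset.sum_congr rfl fun i hi => F.n_neg r (Finset.mem_sdiff.mp hi).1

lemma level_nonneg (I : Finset R) {r : R} (h : 0 < F.ht r) : 0 ≤ F.level I r :=
  Finset.sum_nonneg fun _ hi => F.n_nonneg h (Finset.mem_sdiff.mp hi).1

lemma level_nonpos (I : Finset R) {r : R} (h : F.ht r < 0) : F.level I r ≤ 0 := by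
  have := F.level_nonneg I (r := F.neg r) (by rw [F.ht_neg]; omega)
  rw [F.level_neg] at this
  omega

lemma level_simple (I : Finset R) {i : R} (hi : i ∈ F.Δ) :
    F.level I i = if i ∈ I then 0 else 1 := by
  rw [level, Finset.sum_congr rfl fun j hj => F.n_simple i hi j (Finset.mem_sdiff.mp hj).1]
  simp [hi]

/-- As `θ` is `-1` on `H`, it sends the root space of `r` to that of `-r`. With this sign, `e r + d
• e (neg r)` is `e r - θ (e r)`, which `θ` negates. -/
lemma θ_e_mem (r : R) : ∃ d : ℂ, F.θ (F.e r) = -d • F.e (F.neg r) := by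
  refine ⟨-(F.coef (F.neg r) (F.θ (F.e r))), ?_⟩
  rw [_root_.neg_neg]
  have h1 : ∀ h ∈ F.H, ⁅h, F.θ (F.e r)⁆ = (-F.wt r h) • F.θ (F.e r) := by
    intro h hh
    have : F.θ ⁅-h, F.e r⁆ = ⁅h, F.θ (F.e r)⁆ := by
      rw [LieHom.map_lie, F.θ_H _ (F.H.neg_mem hh), _root_.neg_neg]
    rw [← this, neg_lie, F.lie_e h hh, map_neg, map_smul, neg_smul]
  obtain ⟨z, hz, hz0, hz1⟩ := F.exists_sep
  refine F.ext ?_ fun s => ?_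
  · have h2 := congrArg F.π (h1 z hz)
    rw [F.π_lie_H hz, map_smul, eq_comm, smul_eq_zero] at h2
    rw [map_smul, F.π_e, smul_zero]
    exact h2.resolve_left (neg_ne_zero.mpr (hz0 r))
  · rw [map_smul, F.coef_e]
    by_cases hs : s = F.neg r
    · subst hs
      simp
    · rw [if_neg hs, smul_zero]
      have h2 := congrArg (F.coef s) (h1 z hz)
      rw [F.coef_lie_H hz, map_smul, smul_eq_mul] at h2
      have h3 : (F.wt s z + F.wt r z) * F.coef s (F.θ (F.e r)) = 0 := by linear_combination h2
      refine (mul_eq_zero.mp h3).resolve_left fun h4 => hs (hz1 _ _ ?_)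
      rw [F.wt_neg]
      linear_combination h4

/-- The structure constants of the Chevalley involution. -/
noncomputable def d (r : R) : ℂ := (F.θ_e_mem r).choose

lemma θ_e (r : R) : F.θ (F.e r) = -F.d r • F.e (F.neg r) := (F.θ_e_mem r).choose_spec

lemma d_mul_d (r : R) : F.d r * F.d (F.neg r) = 1 := by
  have h := F.θ_θ (F.e r)
  rw [F.θ_e, map_smul, F.θ_e, F.neg_neg, smul_smul] at h
  have h2 := congrArg (F.coef r) h
  rw [map_smul, F.coef_e, if_pos rfl, smul_eq_mul, mul_one, neg_mul_neg] at h2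
  exact h2

lemma d_ne_zero (r : R) : F.d r ≠ 0 := left_ne_zero_of_mul_eq_one (F.d_mul_d r)

lemma killingForm_θ (x y : g) : killingForm ℂ g (F.θ x) (F.θ y) = killingForm ℂ g x y :=
  LieAlgebra.killingForm_of_equiv_apply
    ({ F.θ with invFun := F.θ, left_inv := F.θ_θ, right_inv := F.θ_θ } : g ≃ₗ⁅ℂ⁆ g) x y

/-- The coefficients of the standard maximal nullspaces. -/
noncomputable def stdCoef (I : Finset R) (r : R) : ℂ := if F.level I r = 0 then F.d r else 0

/-- The standard maximal nullspaces. -/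
noncomputable def std (I : Finset R) : Submodule ℂ g := F.graph (F.stdCoef I)

/-- The standard parabolic subspaces. -/
def par (I : Finset R) : Submodule ℂ g := F.sub True fun r => 0 ≤ F.level I r

lemma closed_level (I : Finset R) : F.Closed fun r => 0 ≤ F.level I r := fun r s t h1 h2 h3 => by
  change 0 ≤ F.level I t
  rw [F.level_add I h3]
  exact add_nonneg h1 h2

lemma std_le_par (I : Finset R) : F.std I ≤ F.par I := by
  intro v hv
  refine ⟨fun h => absurd trivial h, fun r hr => ?_⟩
  have h1 : 0 < F.ht (F.neg r) := by
    rw [F.ht_neg]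
    by_contra h
    exact hr (F.level_nonneg I (by have := F.ht_ne_zero r; omega))
  have h2 := hv _ h1
  rw [F.neg_neg, stdCoef, if_neg, zero_mul] at h2
  · exact h2
  · rw [F.level_neg]
    omega

lemma lie_mem_par {I : Finset R} {x y : g} (hx : x ∈ F.par I) (hy : y ∈ F.par I) :
    ⁅x, y⁆ ∈ F.par I := F.lie_mem_of_closed (F.closed_level I) hx hy

/-- `l` collects the Cartan part and the roots of level zero, the Levi part, on which the graph
equations with coefficients `d` say exactly that `θ` acts as `-1`. The remainder `u` lies in the
nilradical, because `std I` has no component of negative level. -/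
lemma std_decomposition {I : Finset R} {v : g} (hv : v ∈ F.std I) :
    ∃ l u, v = l + u ∧ F.θ l = -l ∧ l ∈ F.sub True (fun r => F.level I r = 0) ∧
      u ∈ F.sub False fun r => 0 < F.level I r := by
  classical
  have hvp := F.std_le_par I hv
  set l := F.π v + ∑ r with F.level I r = 0, F.coef r v • F.e r with hl
  have hlπ : F.π l = F.π v := by
    rw [hl, map_add, F.π_π, map_sum, Finset.sum_eq_zero, add_zero]
    intro r _
    rw [map_smul, F.π_e, smul_zero]
  have hlc : ∀ r, F.coef r l = if F.level I r = 0 then F.coef r v else 0 := by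
    intro r
    rw [hl, map_add, F.coef_of_mem r _ (F.π_mem v), zero_add, map_sum]
    simp only [map_smul, F.coef_e, smul_eq_mul, mul_ite, mul_one, mul_zero, Finset.sum_ite_eq,
      Finset.mem_filter, Finset.mem_univ, true_and]
  refine ⟨l, v - l, by abel, ?_, ⟨fun h => absurd trivial h, fun r hr => ?_⟩,
    ⟨fun _ => by rw [map_sub, hlπ, sub_self], fun r hr => ?_⟩⟩
  · have key : F.θ l = -(F.π v) + ∑ r with F.level I r = 0, (-F.d r * F.coef r v) • F.e (F.neg r) := by
      rw [hl, map_add, map_sum, F.θ_H _ (F.π_mem v)]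
      congr 1
      refine Finset.sum_congr rfl fun r _ => ?_
      rw [map_smul, F.θ_e, smul_smul]
      congr 1
      ring
    refine F.ext ?_ fun s => ?_
    · rw [key, map_add, map_neg, F.π_π, map_neg, hlπ, map_sum, Finset.sum_eq_zero, add_zero]
      intro r _
      rw [map_smul, F.π_e, smul_zero]
    · rw [key, map_neg, hlc, map_add, map_neg, F.coef_of_mem s _ (F.π_mem v), neg_zero, zero_add,
        map_sum]
      have e1 : ∀ r, F.coef s ((-F.d r * F.coef r v) • F.e (F.neg r)) =
          if F.neg s = r then -F.d r * F.coef r v else 0 := by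
        intro r
        rw [map_smul, F.coef_e, smul_eq_mul]
        have : s = F.neg r ↔ F.neg s = r :=
          ⟨fun h => by rw [h, F.neg_neg], fun h => by rw [← h, F.neg_neg]⟩
        simp only [this, mul_ite, mul_one, mul_zero]
      rw [Finset.sum_congr rfl fun r _ => e1 r, Finset.sum_ite_eq]
      simp only [Finset.mem_filter, Finset.mem_univ, true_and, F.level_neg, neg_eq_zero]
      split_ifs with h0
      · rcases lt_or_gt_of_ne (F.ht_ne_zero s) with h | h
        · have h1 := hv (F.neg s) (by rw [F.ht_neg]; omega)
          rw [F.neg_neg, stdCoef, if_pos (by rw [F.level_neg, h0, neg_zero])] at h1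
          rw [h1, neg_mul]
        · have h1 := hv s h
          rw [stdCoef, if_pos h0] at h1
          rw [h1]
          linear_combination -(F.coef s v) * F.d_mul_d s
      · rw [neg_zero]
  · rw [hlc, if_neg hr]
  · rw [map_sub, hlc]
    split_ifs with h0
    · rw [sub_self]
    · rw [hvp.2 r (by omega), sub_zero]

/-- The standard subspaces are nullspaces. -/
lemma isNullspace_std (I : Finset R) : IsNullspace g (F.std I) := by
  intro x hx y hy z hz
  obtain ⟨l₁, u₁, rfl, hθ₁, hl₁, hu₁⟩ := F.std_decomposition hx
  obtain ⟨l₂, u₂, rfl, hθ₂, hl₂, hu₂⟩ := F.std_decomposition hy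
  obtain ⟨l₃, u₃, rfl, hθ₃, hl₃, hu₃⟩ := F.std_decomposition hz
  have hup : ∀ u p, u ∈ F.sub False (fun r => 0 < F.level I r) → p ∈ F.par I →
      ⁅u, p⁆ ∈ F.sub False fun r => 0 < F.level I r := by
    intro u p hu hp
    refine F.lie_mem_sub (fun _ h => h.elim) (fun _ h _ => h) (fun r s t h1 h2 h3 => ?_)
      (fun r h1 h2 => ?_) hu hp
    · rw [F.level_add I h3]
      omega
    · rw [F.level_neg] at h2
      omega
  have hkill : ∀ u p, u ∈ F.sub False (fun r => 0 < F.level I r) → p ∈ F.par I →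
      killingForm ℂ g u p = 0 := by
    intro u p hu hp
    refine F.kill_eq_zero (by simp) (fun r h1 h2 => ?_) hu hp
    rw [F.level_neg] at h2
    omega
  have hlp : F.sub True (fun r => F.level I r = 0) ≤ F.par I :=
    F.sub_mono (fun h => h) fun r h => h.ge
  have e1 : ⁅l₁ + u₁, l₂ + u₂⁆ = ⁅l₁, l₂⁆ + (⁅u₁, l₂ + u₂⁆ + -⁅u₂, l₁⁆) := by
    rw [lie_skew, add_lie, lie_add l₁]
    abel
  have e2 : ⁅u₁, l₂ + u₂⁆ + -⁅u₂, l₁⁆ ∈ F.sub False fun r => 0 < F.level I r :=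
    add_mem (hup _ _ hu₁ (F.std_le_par I hy)) (neg_mem (hup _ _ hu₂ (hlp hl₁)))
  -- `θ` preserves the Killing form, fixes `⁅l₁, l₂⁆` and negates `l₃`, so the value equals its own
  -- negative.
  have e3 : killingForm ℂ g ⁅l₁, l₂⁆ l₃ = 0 := by
    have h1 := F.killingForm_θ ⁅l₁, l₂⁆ l₃
    rw [LieHom.map_lie, hθ₁, hθ₂, hθ₃, neg_lie, lie_neg, _root_.neg_neg, map_neg] at h1
    have h2 : (2 : ℂ) * killingForm ℂ g ⁅l₁, l₂⁆ l₃ = 0 := by linear_combination -h1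
    simpa using h2
  have e4 : killingForm ℂ g ⁅l₁, l₂⁆ u₃ = 0 := by
    rw [killingForm_symm]
    exact hkill _ _ hu₃ (F.lie_mem_par (hlp hl₁) (hlp hl₂))
  have e5 := hkill _ _ e2 (F.std_le_par I hz)
  rw [w, e1, map_add (killingForm ℂ g), LinearMap.add_apply, e5, map_add, e3, e4]
  simp

lemma std_mem_Y (I : Finset R) : F.std I ∈ Y g :=
  F.mem_Y_iff.mpr ⟨F.isNullspace_std I, F.finrank_eq_of_isCompl_nneg (F.isCompl_graph _)⟩

lemma stdCoef_simple (I : Finset R) {i : R} (hi : i ∈ F.Δ) : F.stdCoef I i = 0 ↔ i ∉ I := by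
  rw [stdCoef, F.level_simple I hi]
  by_cases h : i ∈ I
  · simp [h, F.d_ne_zero]
  · simp [h]

lemma exists_std_of_graph {c : R → ℂ} (hc : IsNullspace g (F.graph c)) :
    ∃ I ⊆ F.Δ, (∀ i ∈ F.Δ, i ∈ I ↔ c i ≠ 0) ∧
      ∃ φ ∈ adjointGroup g, (F.graph c).map φ.toLinearMap = F.std I := by
  classical
  refine ⟨F.Δ.filter fun i => c i ≠ 0, Finset.filter_subset _ _, fun i hi => by simp [hi],
    F.exists_torus_conj hc (F.isNullspace_std _) fun i hi => ?_⟩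
  rw [F.stdCoef_simple _ hi]
  simp [hi]

/-- Every maximal nullspace is conjugate to a standard one. -/
lemma exists_conj_std {V : Submodule ℂ g} (hV : V ∈ Y g) :
    ∃ I ⊆ F.Δ, ∃ φ ∈ adjointGroup g, V.map φ.toLinearMap = F.std I := by
  obtain ⟨ψ, hψ, hT⟩ := F.exists_transversal hV (Γ := adjointGroup g)
    fun x _ => expAd_mem_adjointGroup x
  have hnull := hV.1.map (map_lie_of_mem_adjointGroup hψ)
  have hc := F.isCompl_nneg hT (by
    rw [LinearEquiv.finrank_map_eq, (F.mem_Y_iff.mp hV).2])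
  obtain ⟨ν, hν, hH, hc'⟩ := F.exists_isLower_H_le (P := fun _ => True)
    (fun _ _ _ _ _ _ => trivial) hnull hc (by rw [F.sub_eq_top]; exact le_top)
  obtain ⟨c, hcg⟩ := F.exists_eq_graph (hnull.map (map_lie_of_mem_adjointGroup hν.mem)) hc' hH
  obtain ⟨I, hI, -, χ, hχ, hχI⟩ := F.exists_std_of_graph (c := c) (by
    rw [← hcg]
    exact hnull.map (map_lie_of_mem_adjointGroup hν.mem))
  refine ⟨I, hI, χ * (ν * ψ), mul_mem hχ (mul_mem hν.mem hψ), ?_⟩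
  rw [← hχI, ← hcg, ← Submodule.map_comp, ← Submodule.map_comp]
  rfl

end RootFrame

end MaxNull

namespace MaxNull

/-! ### The span of a nullspace and its brackets; subalgebras containing the Borel. -/

section

variable {g : Type*} [LieRing g] [LieAlgebra ℂ g]

lemma le_pV (V : Submodule ℂ g) : V ≤ pV g V := le_sup_left

lemma lie_mem_pV {V : Submodule ℂ g} {x y : g} (hx : x ∈ V) (hy : y ∈ V) : ⁅x, y⁆ ∈ pV g V :=
  Submodule.mem_sup_right (Submodule.subset_span ⟨x, hx, y, hy, rfl⟩)

lemma pV_le {V P : Submodule ℂ g} (h : V ≤ P) (hP : ∀ x ∈ P, ∀ y ∈ P, ⁅x, y⁆ ∈ P) :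
    pV g V ≤ P := by
  refine sup_le h (Submodule.span_le.mpr ?_)
  rintro _ ⟨x, hx, y, hy, rfl⟩
  exact hP x (h hx) y (h hy)

lemma pV_map {φ : g ≃ₗ[ℂ] g} (hφ : ∀ a b, φ ⁅a, b⁆ = ⁅φ a, φ b⁆) (V : Submodule ℂ g) :
    pV g (V.map φ.toLinearMap) = (pV g V).map φ.toLinearMap := by
  rw [pV, pV, Submodule.map_sup, Submodule.map_span]
  congr 2
  ext z
  constructor
  · rintro ⟨_, ⟨x, hx, rfl⟩, _, ⟨y, hy, rfl⟩, rfl⟩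
    exact ⟨⁅x, y⁆, ⟨x, hx, y, hy, rfl⟩, hφ x y⟩
  · rintro ⟨_, ⟨x, hx, y, hy, rfl⟩, rfl⟩
    exact ⟨φ x, ⟨x, hx, rfl⟩, φ y, ⟨y, hy, rfl⟩, (hφ x y).symm⟩

end

namespace RootFrame

variable {g : Type*} [LieRing g] [LieAlgebra ℂ g] [FiniteDimensional ℂ g]
variable [LieAlgebra.IsKilling ℂ g]
variable {R : Type*} [Fintype R] [DecidableEq R] (F : RootFrame g R)

/-- The components of an element of a subspace stable under the Cartan subalgebra lie in it. -/
lemma coef_smul_e_mem {M : Submodule ℂ g} (hM : ∀ h ∈ F.H, ∀ v ∈ M, ⁅h, v⁆ ∈ M) {x : g}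
    (hx : x ∈ M) (r : R) : F.coef r x • F.e r ∈ M := by
  classical
  obtain ⟨z, hz, hz0, hz1⟩ := F.exists_sep
  obtain ⟨p, hp⟩ := exists_aeval_of_eigenvector (LieAlgebra.ad ℂ g z)
    fun μ => if μ = F.wt r z then 1 else 0
  have h1 := aeval_mem (s := LieAlgebra.ad ℂ g z) (fun v hv => hM z hz v hv) p hx
  have h2 : Polynomial.aeval (LieAlgebra.ad ℂ g z) p x = F.coef r x • F.e r := by
    conv_lhs => rw [← F.expand x]
    rw [map_add, map_sum, hp 0 (F.π x) (by
      rw [zero_smul]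
      exact F.lie_H z hz _ (F.π_mem x)), if_neg (hz0 r).symm, zero_smul, zero_add,
      Finset.sum_eq_single_of_mem r (Finset.mem_univ _)]
    · rw [map_smul, hp _ _ (F.lie_e z hz r), if_pos rfl, one_smul]
    · intro s _ hs
      rw [map_smul, hp _ _ (F.lie_e z hz s), if_neg fun h => hs (hz1 _ _ h), zero_smul, smul_zero]
  rwa [h2] at h1

lemma e_mem_of_coef_ne_zero {M : Submodule ℂ g} (hM : ∀ h ∈ F.H, ∀ v ∈ M, ⁅h, v⁆ ∈ M) {x : g}
    (hx : x ∈ M) {r : R} (hr : F.coef r x ≠ 0) : F.e r ∈ M :=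
  (Submodule.smul_mem_iff _ hr).mp (F.coef_smul_e_mem hM hx r)

/-- Bracketing `e r + c • e (-r)` with `ρ`, which lies in `std I`, gives a nonzero multiple of `e r
- c • e (-r)`. Sum and difference put `e r` and `c • e (-r)` separately into the span, and `c ≠ 0`
when `r` has level zero. -/
lemma pV_std (I : Finset R) : pV g (F.std I) = F.par I := by
  refine le_antisymm (pV_le (F.std_le_par I) fun _ hx _ hy => F.lie_mem_par hx hy) ?_
  have hH : F.H ≤ F.std I := F.H_le_graph _
  have key : ∀ r, 0 < F.ht r →
      F.e r ∈ pV g (F.std I) ∧ F.stdCoef I r • F.e (F.neg r) ∈ pV g (F.std I) := by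
    intro r hr
    have h1 := F.e_add_mem_graph (F.stdCoef I) hr
    set y := F.stdCoef I r • F.e (F.neg r) with hy
    have h2 : ⁅F.ρ, F.e r + y⁆ = (F.ht r : ℂ) • (F.e r - y) := by
      rw [hy, lie_add, lie_smul, F.lie_e _ F.ρ_mem, F.lie_e _ F.ρ_mem, F.wt_ρ, F.wt_ρ, F.ht_neg]
      push_cast
      module
    have h3 := lie_mem_pV (hH F.ρ_mem) h1
    rw [h2, Submodule.smul_mem_iff _ (by exact_mod_cast F.ht_ne_zero r)] at h3
    have h4 := le_pV _ h1
    have e1 : F.e r = (2⁻¹ : ℂ) • ((F.e r + y) + (F.e r - y)) := by module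
    have e2 : y = (2⁻¹ : ℂ) • ((F.e r + y) - (F.e r - y)) := by module
    constructor
    · rw [e1]
      exact Submodule.smul_mem _ _ (add_mem h4 h3)
    · rw [e2]
      exact Submodule.smul_mem _ _ (sub_mem h4 h3)
  refine F.sub_le (fun _ => hH.trans (le_pV _)) fun r hr => ?_
  rcases lt_or_gt_of_ne (F.ht_ne_zero r) with h | h
  · have h0 : F.level I (F.neg r) = 0 := by
      have := F.level_nonpos I h
      rw [F.level_neg]
      omega
    have h1 := (key (F.neg r) (by rw [F.ht_neg]; omega)).2
    rwa [stdCoef, if_pos h0, F.neg_neg, Submodule.smul_mem_iff _ (F.d_ne_zero _)] at h1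
  · exact (key r h).1

lemma level_empty (r : R) : F.level ∅ r = F.ht r := by
  rw [level, ht, Finset.sdiff_empty]

lemma par_empty : F.par ∅ = F.borel := by
  refine le_antisymm (F.sub_mono (fun h => h) fun r h => ?_) (F.sub_mono (fun h => h) fun r h => ?_)
  · rw [F.level_empty] at h
    have := F.ht_ne_zero r
    omega
  · rw [F.level_empty]
    omega

lemma borel_le_par (I : Finset R) : F.borel ≤ F.par I :=
  F.sub_mono (fun h => h) fun _ h => F.level_nonneg I h

lemma lie_mem_borel {x y : g} (hx : x ∈ F.borel) (hy : y ∈ F.borel) : ⁅x, y⁆ ∈ F.borel := by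
  rw [← F.par_empty] at *
  exact F.lie_mem_par hx hy

lemma std_empty : F.std ∅ = F.borel := by
  refine F.eq_of_isCompl_nneg ?_ (F.isCompl_graph _) F.isCompl_borel_nneg
  rw [← F.par_empty]
  exact F.std_le_par ∅

lemma e_mem_par {I : Finset R} {r : R} (h : 0 ≤ F.level I r) : F.e r ∈ F.par I := F.e_mem_sub h

lemma e_neg_mem_par {I : Finset R} {i : R} (hi : i ∈ F.Δ) (h : i ∈ I) :
    F.e (F.neg i) ∈ F.par I := by
  refine F.e_mem_par ?_
  rw [F.level_neg, F.level_simple I hi, if_pos h]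
  omega

lemma add_neg {r s t : R} (h : F.Add r s t) : F.Add (F.neg r) (F.neg s) (F.neg t) := by
  intro x hx
  rw [F.wt_neg, F.wt_neg, F.wt_neg, ← h x hx]
  ring

lemma sub_of_add {r s t : R} (h : F.Add r s t) : F.Add (F.neg t) s (F.neg r) := by
  intro x hx
  rw [F.wt_neg, F.wt_neg, ← h x hx]
  ring

lemma e_mem_of_add {P : Submodule ℂ g} (hP : ∀ x ∈ P, ∀ y ∈ P, ⁅x, y⁆ ∈ P) {r s t : R}
    (h : F.Add r s t) (hr : F.e r ∈ P) (hs : F.e s ∈ P) : F.e t ∈ P := by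
  obtain ⟨N, hN, h1⟩ := F.lie_e_e r s t h
  have h2 := hP _ hr _ hs
  rwa [h1, Submodule.smul_mem_iff _ hN] at h2

/-- Induction on positive roots. -/
lemma pos_induction {Q : R → Prop} (simple : ∀ i ∈ F.Δ, Q i)
    (add : ∀ r i s, i ∈ F.Δ → 0 < F.ht r → F.Add r i s → Q r → Q s) {r : R} (hr : 0 < F.ht r) :
    Q r := by
  have key : ∀ k : ℕ, ∀ r, 0 < F.ht r → F.ht r ≤ k → Q r := by
    intro k
    induction k with
    | zero =>
      intro r h1 h2
      push_cast at h2
      omega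
    | succ k ih =>
      intro r h1 h2
      rcases F.pos_cases r h1 with h | ⟨s, i, hi, hs, hsi⟩
      · exact simple r h
      · have hadd : F.Add s i r := fun x hx => (hsi x hx).symm
        refine add s i r hi hs hadd (ih s hs ?_)
        have h3 := F.ht_add hadd
        rw [F.ht_simple hi] at h3
        push_cast at h2
        omega
  exact key (F.ht r).toNat r hr (Int.self_le_toNat _)

/-- The subalgebras containing the standard Borel subalgebra. -/
lemma exists_eq_par {P : Submodule ℂ g} (hP : ∀ x ∈ P, ∀ y ∈ P, ⁅x, y⁆ ∈ P) (hb : F.borel ≤ P) :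
    ∃ I ⊆ F.Δ, P = F.par I := by
  classical
  set I := F.Δ.filter fun i => F.e (F.neg i) ∈ P with hI
  have hmem : ∀ i, i ∈ F.Δ → (i ∈ I ↔ F.e (F.neg i) ∈ P) := fun i hi => by simp [hI, hi]
  have hH : F.H ≤ P := (F.H_le_sub trivial _).trans hb
  have hpos : ∀ r, 0 < F.ht r → F.e r ∈ P := fun r hr => hb (F.e_mem_sub hr)
  -- For positive `r`, level zero means that only simple roots of `I` occur in `r`. If `r + i` is a
  -- root, its opposite root vector bracketed with the positive vectors `e i` and `e r` yields those
  -- of `-r` and `-i`; conversely these two bracket to it.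
  have key : ∀ r, 0 < F.ht r → (F.e (F.neg r) ∈ P ↔ F.level I r = 0) := by
    intro r hr
    refine F.pos_induction (Q := fun r => F.e (F.neg r) ∈ P ↔ F.level I r = 0)
      (fun i hi => ?_) (fun r i s hi hr hadd ih => ?_) hr
    · rw [F.level_simple I hi, ← hmem i hi]
      by_cases h : i ∈ I <;> simp [h]
    · have hi0 : 0 < F.ht i := by rw [F.ht_simple hi]; omega
      have h1 := F.level_nonneg I hr
      have h2 := F.level_nonneg I hi0
      have hli : F.level I i = 0 ↔ F.e (F.neg i) ∈ P := by
        rw [F.level_simple I hi, ← hmem i hi]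
        by_cases h : i ∈ I <;> simp [h]
      rw [F.level_add I hadd]
      constructor
      · intro h
        have h3 : F.e (F.neg r) ∈ P := F.e_mem_of_add hP (F.sub_of_add hadd) h (hpos i hi0)
        have h4 : F.e (F.neg i) ∈ P := F.e_mem_of_add hP
          (F.sub_of_add fun x hx => (add_comm _ _).trans (hadd x hx)) h (hpos r hr)
        rw [ih.mp h3, hli.mpr h4, add_zero]
      · intro h
        exact F.e_mem_of_add hP (F.add_neg hadd) (ih.mpr (by omega)) (hli.mp (by omega))
  refine ⟨I, Finset.filter_subset _ _, le_antisymm (fun x hx => ?_) (F.sub_le (fun _ => hH) ?_)⟩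
  · refine ⟨fun h => absurd trivial h, fun r hr => ?_⟩
    by_contra hne
    have h1 := F.e_mem_of_coef_ne_zero (fun h hh v hv => hP _ (hH hh) _ hv) hx hne
    have h2 : 0 < F.ht (F.neg r) := by
      rw [F.ht_neg]
      have h3 := F.ht_ne_zero r
      by_contra h4
      exact hr (F.level_nonneg I (by omega))
    rw [← F.neg_neg r, key _ h2, F.level_neg] at h1
    omega
  · intro r hr
    rcases lt_or_gt_of_ne (F.ht_ne_zero r) with h | h
    · have h1 := F.level_nonpos I h
      rw [← F.neg_neg r, key _ (by rw [F.ht_neg]; omega), F.level_neg]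
      omega
    · exact hpos r h

end RootFrame

end MaxNull

namespace MaxNull

/-! ### Conjugacy of Borel and of parabolic subalgebras. -/

section

variable {g : Type*} [LieRing g] [LieAlgebra ℂ g] [FiniteDimensional ℂ g]

/-- The image of a subalgebra under an element of the adjoint group. -/
def mapSubalgebra {φ : g ≃ₗ[ℂ] g} (hφ : φ ∈ adjointGroup g) (b : LieSubalgebra ℂ g) :
    LieSubalgebra ℂ g where
  toSubmodule := b.toSubmodule.map φ.toLinearMap
  lie_mem' := by
    rintro _ _ ⟨x, hx, rfl⟩ ⟨y, hy, rfl⟩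
    exact ⟨⁅x, y⁆, b.lie_mem hx hy, map_lie_of_mem_adjointGroup hφ x y⟩

lemma isSolvable_of_chain {b : LieSubalgebra ℂ g} {D : ℕ → Submodule ℂ g} (h0 : D 0 = b.toSubmodule)
    (hlie : ∀ k, ∀ x ∈ D k, ∀ y ∈ D k, ⁅x, y⁆ ∈ D (k + 1))
    {K : ℕ} (hK : D K = ⊥) : LieAlgebra.IsSolvable b := by
  rw [LieAlgebra.isSolvable_iff ℂ]
  have key : ∀ k, ∀ x ∈ LieAlgebra.derivedSeries ℂ b k, (x : g) ∈ D k := by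
    intro k
    induction k with
    | zero =>
      intro x _
      rw [h0]
      exact x.2
    | succ k ih =>
      intro x hx
      rw [LieAlgebra.derivedSeries_def, LieAlgebra.derivedSeriesOfIdeal_succ,
        ← LieSubmodule.mem_toSubmodule, LieSubmodule.lieIdeal_oper_eq_linear_span'] at hx
      refine (Submodule.span_le (p := (D (k + 1)).comap b.toSubmodule.subtype)).mpr ?_ hx
      rintro _ ⟨y, hy, z, hz, rfl⟩
      exact hlie k _ (ih y hy) _ (ih z hz)
  refine ⟨K, (LieSubmodule.eq_bot_iff _).mpr fun x hx => ?_⟩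
  have := key K x hx
  rw [hK, Submodule.mem_bot] at this
  exact Subtype.ext this

lemma isSolvable_mapSubalgebra {φ : g ≃ₗ[ℂ] g} (hφ : φ ∈ adjointGroup g) {b : LieSubalgebra ℂ g}
    (hb : LieAlgebra.IsSolvable b) : LieAlgebra.IsSolvable (mapSubalgebra hφ b) := by
  obtain ⟨D, K, h0, -, h2, h3⟩ := exists_chain_of_isSolvable b
  refine isSolvable_of_chain (D := fun k => (D k).map φ.toLinearMap) (K := K) ?_ ?_ ?_
  · simp only [h0]
    rfl
  · rintro k _ ⟨x, hx, rfl⟩ _ ⟨y, hy, rfl⟩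
    exact ⟨⁅x, y⁆, h2 k x hx y hy, map_lie_of_mem_adjointGroup hφ x y⟩
  · simp only [h3, Submodule.map_bot]

lemma mapSubalgebra_mono {φ : g ≃ₗ[ℂ] g} (hφ : φ ∈ adjointGroup g) {b c : LieSubalgebra ℂ g}
    (h : b ≤ c) : mapSubalgebra hφ b ≤ mapSubalgebra hφ c := by
  rintro _ ⟨x, hx, rfl⟩
  exact ⟨x, h hx, rfl⟩

lemma mapSubalgebra_inv {φ : g ≃ₗ[ℂ] g} (hφ : φ ∈ adjointGroup g) (b : LieSubalgebra ℂ g) :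
    mapSubalgebra hφ (mapSubalgebra (inv_mem hφ) b) = b := by
  ext x
  constructor
  · rintro ⟨_, ⟨y, hy, rfl⟩, rfl⟩
    have : φ (φ⁻¹ y) = y := φ.apply_symm_apply y
    change φ (φ⁻¹ y) ∈ b
    rwa [this]
  · intro hx
    exact ⟨φ⁻¹ x, ⟨x, hx, rfl⟩, φ.apply_symm_apply x⟩

lemma IsBorel.map {φ : g ≃ₗ[ℂ] g} (hφ : φ ∈ adjointGroup g) {b : LieSubalgebra ℂ g}
    (hb : IsBorel g b) : IsBorel g (mapSubalgebra hφ b) := by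
  refine ⟨isSolvable_mapSubalgebra hφ hb.1, fun s hs hle => ?_⟩
  have h1 : b ≤ mapSubalgebra (inv_mem hφ) s := by
    intro x hx
    exact ⟨φ x, hle ⟨x, hx, rfl⟩, φ.symm_apply_apply x⟩
  have h2 := mapSubalgebra_mono hφ (hb.2 (isSolvable_mapSubalgebra (inv_mem hφ) hs) h1)
  rwa [mapSubalgebra_inv] at h2

lemma map_mem_parabolics {φ : g ≃ₗ[ℂ] g} (hφ : φ ∈ adjointGroup g) {P : Submodule ℂ g}
    (hP : P ∈ parabolics g) : P.map φ.toLinearMap ∈ parabolics g := by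
  obtain ⟨p, ⟨b, hb, hbp⟩, rfl⟩ := hP
  exact ⟨mapSubalgebra hφ p, ⟨mapSubalgebra hφ b, hb.map hφ, mapSubalgebra_mono hφ hbp⟩, rfl⟩

end

namespace RootFrame

variable {g : Type*} [LieRing g] [LieAlgebra ℂ g] [FiniteDimensional ℂ g]
variable [LieAlgebra.IsKilling ℂ g]
variable {R : Type*} [Fintype R] [DecidableEq R] (F : RootFrame g R)

/-- The standard parabolic subalgebras. -/
def parSubalgebra (I : Finset R) : LieSubalgebra ℂ g where
  toSubmodule := F.par I
  lie_mem' := fun hx hy => F.lie_mem_par hx hy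

lemma isSolvable_parSubalgebra_empty : LieAlgebra.IsSolvable (F.parSubalgebra ∅) := by
  obtain ⟨K, hK⟩ := F.exists_ht_lt
  refine isSolvable_of_chain (D := fun k => F.fil k) (K := K + 1) ?_ ?_ ?_
  · change F.fil ((0 : ℕ) : ℤ) = F.par ∅
    rw [F.par_empty, F.borel_eq_fil, Nat.cast_zero]
  · intro k x hx y hy
    refine F.lie_mem_sub (fun s h1 h2 => ?_) (fun r h1 h2 => ?_)
      (fun r s t h1 h2 h3 => ?_) (fun r h1 h2 => ?_) hx hy
    · have := F.ht_ne_zero s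
      push_cast
      omega
    · have := F.ht_ne_zero r
      push_cast
      omega
    · have := F.ht_ne_zero r
      have := F.ht_ne_zero s
      rw [F.ht_add h3]
      push_cast
      omega
    · have := F.ht_ne_zero r
      rw [F.ht_neg] at h2
      omega
  · refine F.fil_eq_bot (fun r => (hK r).1) ?_ ?_ <;> push_cast <;> omega

/-- `e r`, `e (-r)` and their bracket regenerate each other up to nonzero scalars, so they survive
in every term of the derived series. -/
lemma not_isSolvable {b : LieSubalgebra ℂ g} (r : R) (h1 : F.e r ∈ b) (h2 : F.e (F.neg r) ∈ b) :
    ¬ LieAlgebra.IsSolvable b := by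
  intro hb
  obtain ⟨D, K, h0, -, hlie, hK⟩ := exists_chain_of_isSolvable b
  set h := ⁅F.e r, F.e (F.neg r)⁆ with hh
  have hH : h ∈ F.H := F.lie_e_neg_mem r
  have hr : F.wt r h ≠ 0 := F.wt_lie_e_neg r
  have key : ∀ k, F.e r ∈ D k ∧ F.e (F.neg r) ∈ D k ∧ h ∈ D k := by
    intro k
    induction k with
    | zero =>
      rw [h0]
      exact ⟨h1, h2, b.lie_mem h1 h2⟩
    | succ k ih =>
      obtain ⟨i1, i2, i3⟩ := ih
      refine ⟨?_, ?_, hlie k _ i1 _ i2⟩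
      · have := hlie k _ i3 _ i1
        rwa [F.lie_e h hH, Submodule.smul_mem_iff _ hr] at this
      · have := hlie k _ i3 _ i2
        rwa [F.lie_e h hH, F.wt_neg, Submodule.smul_mem_iff _ (neg_ne_zero.mpr hr)] at this
  have := (key K).1
  rw [hK, Submodule.mem_bot] at this
  exact F.e_ne_zero r this

lemma isBorel_parSubalgebra_empty : IsBorel g (F.parSubalgebra ∅) := by
  refine ⟨F.isSolvable_parSubalgebra_empty, fun s hs hle => ?_⟩
  obtain ⟨I, hI, hsI⟩ := F.exists_eq_par (P := s.toSubmodule) (fun x hx y hy => s.lie_mem hx hy) (by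
    rw [← F.par_empty]
    exact hle)
  have h0 : I = ∅ := by
    rw [Finset.eq_empty_iff_forall_notMem]
    intro i hi
    refine F.not_isSolvable (b := s) i ?_ ?_ hs
    · change F.e i ∈ s.toSubmodule
      rw [hsI]
      exact F.borel_le_par I (F.e_mem_sub (by rw [F.ht_simple (hI hi)]; omega))
    · change F.e (F.neg i) ∈ s.toSubmodule
      rw [hsI]
      exact F.e_neg_mem_par (hI hi) hi
  intro x hx
  have hx' : x ∈ s.toSubmodule := hx
  rw [hsI, h0] at hx'
  exact hx'

/-- Testing on `ρ` suffices: bracketing with it multiplies each root coefficient by the nonzero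
height. -/
lemma mem_borel_of_normalizes {y : g} (h : ∀ v ∈ F.borel, ⁅y, v⁆ ∈ F.borel) : y ∈ F.borel := by
  refine ⟨fun h => absurd trivial h, fun r hr => ?_⟩
  have h1 := neg_mem (h F.ρ (F.H_le_sub trivial _ F.ρ_mem))
  rw [lie_skew] at h1
  have h2 := h1.2 r hr
  rw [F.coef_lie_H F.ρ_mem, F.wt_ρ] at h2
  exact (mul_eq_zero.mp h2).resolve_left (by exact_mod_cast F.ht_ne_zero r)

/-- A maximal nullspace which is a subalgebra is conjugate to the standard Borel subalgebra. -/
lemma exists_conj_borel_of_lie_mem {W : Submodule ℂ g} (hW : W ∈ Y g)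
    (hlie : ∀ x ∈ W, ∀ y ∈ W, ⁅x, y⁆ ∈ W) :
    ∃ φ ∈ adjointGroup g, W.map φ.toLinearMap = F.borel := by
  obtain ⟨I, hI, φ, hφ, hWI⟩ := F.exists_conj_std hW
  -- If `std I` is closed under brackets it equals `par I`. It would then contain `e (-i)` for `i ∈
  -- I`, against its transversality to `n₋`; so `I` is empty.
  have h1 : F.std I = F.par I := by
    rw [← F.pV_std]
    refine le_antisymm (le_pV _) (pV_le le_rfl ?_)
    rw [← hWI]
    rintro _ ⟨x, hx, rfl⟩ _ ⟨y, hy, rfl⟩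
    exact ⟨⁅x, y⁆, hlie x hx y hy, map_lie_of_mem_adjointGroup hφ x y⟩
  have h0 : I = ∅ := by
    rw [Finset.eq_empty_iff_forall_notMem]
    intro i hi
    have h2 := F.e_neg_mem_par (hI hi) hi
    rw [← h1] at h2
    refine F.e_ne_zero _ (Submodule.disjoint_def.mp (F.isCompl_graph _).disjoint _ h2
      (F.e_mem_sub ?_))
    rw [F.ht_neg, F.ht_simple (hI hi)]
    omega
  exact ⟨φ, hφ, by rw [hWI, h0, F.std_empty]⟩

/-- Borel subalgebras are conjugate. -/
lemma exists_conj_borel {b : LieSubalgebra ℂ g} (hb : IsBorel g b) :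
    ∃ φ ∈ adjointGroup g, b.toSubmodule.map φ.toLinearMap = F.borel := by
  have hsol := hb.1
  obtain ⟨D, K, h0, hanti, hlie, hK⟩ := exists_chain_of_isSolvable b
  -- Maximal nullspaces that are also subalgebras: this class is closed under the limits used, and
  -- its members are conjugate to the standard Borel. Degenerating `F.borel` along the given Borel
  -- subalgebra gives a member which that subalgebra normalizes, hence one that contains it.
  let P : Submodule ℂ g → Prop := fun U => U ∈ Y g ∧ ∀ x ∈ U, ∀ y ∈ U, ⁅x, y⁆ ∈ U
  have hP : ∀ (A : ℕ → g ≃ₗ[ℂ] g) (U : Submodule ℂ g), (∀ n a b, A n ⁅a, b⁆ = ⁅A n a, A n b⁆) →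
      P U → Module.finrank ℂ U ≤ Module.finrank ℂ (limitSpace fun n => U.map (A n).toLinearMap) →
      P (limitSpace fun n => U.map (A n).toLinearMap) := by
    rintro A U hA ⟨hU, hUl⟩ hd
    refine ⟨⟨IsNullspace.limitSpace fun n => hU.1.map (hA n), fun U' hU' => (hU.2 U' hU').trans hd⟩,
      fun x hx y hy => ?_⟩
    refine bilin_mem_limitSpace (LieModule.toEnd ℂ g g : g →ₗ[ℂ] g →ₗ[ℂ] g) (fun n => ?_) hx hy
    rintro _ ⟨x, hx, rfl⟩ _ ⟨y, hy, rfl⟩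
    exact ⟨⁅x, y⁆, hUl x hx y hy, hA n x y⟩
  have hP0 : P F.borel := ⟨F.mem_Y_iff.mpr ⟨F.isNullspace_borel, rfl⟩,
    fun _ hx _ hy => F.lie_mem_borel hx hy⟩
  obtain ⟨W, ⟨hW, hWl⟩, hWb⟩ := exists_stable_of_chain D hanti hlie K hK
    (fun x _ U hU S hS hSU => exists_stable_of_limit_closed hP x hU hS hSU) hP0
  obtain ⟨φ, hφ, hWφ⟩ := F.exists_conj_borel_of_lie_mem hW hWl
  have h1 : mapSubalgebra hφ b ≤ F.parSubalgebra ∅ := by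
    rintro _ ⟨x, hx, rfl⟩
    change φ x ∈ F.par ∅
    rw [F.par_empty]
    refine F.mem_borel_of_normalizes ?_
    rw [← hWφ]
    rintro _ ⟨y, hy, rfl⟩
    refine ⟨⁅x, y⁆, hWb x ?_ y hy, map_lie_of_mem_adjointGroup hφ x y⟩
    rw [h0]
    exact hx
  refine ⟨φ, hφ, le_antisymm ?_ ?_⟩
  · rw [← F.par_empty]
    exact h1
  · rw [← F.par_empty]
    exact (hb.map hφ).2 F.isSolvable_parSubalgebra_empty h1

lemma par_mem_parabolics (I : Finset R) : F.par I ∈ parabolics g :=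
  ⟨F.parSubalgebra I, ⟨F.parSubalgebra ∅, F.isBorel_parSubalgebra_empty, fun x hx => by
    have hx' : x ∈ F.par ∅ := hx
    rw [F.par_empty] at hx'
    exact F.borel_le_par I hx'⟩, rfl⟩

/-- Every parabolic subalgebra is conjugate to a standard one. -/
lemma exists_conj_par {P : Submodule ℂ g} (hP : P ∈ parabolics g) :
    ∃ I ⊆ F.Δ, ∃ φ ∈ adjointGroup g, P.map φ.toLinearMap = F.par I := by
  obtain ⟨p, ⟨b, hb, hbp⟩, rfl⟩ := hP
  obtain ⟨φ, hφ, hbφ⟩ := F.exists_conj_borel hb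
  obtain ⟨I, hI, hpI⟩ := F.exists_eq_par (P := p.toSubmodule.map φ.toLinearMap) (by
    rintro _ ⟨x, hx, rfl⟩ _ ⟨y, hy, rfl⟩
    exact ⟨⁅x, y⁆, p.lie_mem hx hy, map_lie_of_mem_adjointGroup hφ x y⟩) (by
    rw [← hbφ]
    exact Submodule.map_mono hbp)
  exact ⟨I, hI, φ, hφ, hpI⟩

end RootFrame

end MaxNull

namespace MaxNull

/-! ### Rigidity: the action of the normalizer of the Borel modulo `n₊`. -/

section

variable {g : Type*} [LieRing g] [LieAlgebra ℂ g] [FiniteDimensional ℂ g]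

/-- Cramer's rule for an entire family of endomorphisms. -/
lemma IsEntire.exists_cramer {T : ℂ → Module.End ℂ g} (hT : IsEntire T) (h : g) :
    ∃ (δ : ℂ → ℂ) (q : ℂ → g), Differentiable ℂ δ ∧
      (∀ f : Module.Dual ℂ g, Differentiable ℂ fun t => f (q t)) ∧
      (∀ t, T t (q t) = δ t • h) ∧ ∀ t, (∀ v, T t v = 0 → v = 0) ↔ δ t ≠ 0 := by
  classical
  let b := Module.finBasis ℂ g
  let M : ℂ → Matrix _ _ ℂ := fun t => LinearMap.toMatrix b b (T t)
  have hM : ∀ i j, Differentiable ℂ fun t => M t i j := by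
    intro i j
    have h1 : (fun t => M t i j) = fun t => b.coord i (T t (b j)) := by
      funext t
      simp [M, LinearMap.toMatrix_apply]
    rw [h1]
    exact hT _ _
  have hdet : ∀ N : ℂ → Matrix (Fin (Module.finrank ℂ g)) (Fin (Module.finrank ℂ g)) ℂ,
      (∀ i j, Differentiable ℂ fun t => N t i j) → Differentiable ℂ fun t => (N t).det := by
    intro N hN
    simp only [Matrix.det_apply]
    refine Differentiable.fun_sum fun σ _ => ?_
    have h1 : Differentiable ℂ fun t => ∏ i, N t (σ i) i := by
      have := fun i => hN (σ i) i
      fun_prop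
    exact h1.const_smul (Equiv.Perm.sign σ)
  let q : ℂ → g := fun t => b.equivFun.symm (Matrix.cramer (M t) (b.repr h))
  have hq : ∀ t i, b.repr (q t) i = Matrix.cramer (M t) (b.repr h) i := by
    intro t i
    change b.equivFun (b.equivFun.symm _) i = _
    rw [LinearEquiv.apply_symm_apply]
  refine ⟨fun t => (M t).det, q, hdet M hM, fun f => ?_, fun t => ?_, fun t => ?_⟩
  · have h1 : (fun t => f (q t)) =
        fun t => ∑ i, ((M t).updateCol i (b.repr h)).det * f (b i) := by
      funext t
      conv_lhs => rw [← b.sum_repr (q t)]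
      rw [map_sum]
      refine Finset.sum_congr rfl fun i _ => ?_
      rw [map_smul, smul_eq_mul, hq, Matrix.cramer_apply]
    rw [h1]
    refine Differentiable.fun_sum fun i _ => (hdet _ fun k l => ?_).mul_const _
    by_cases hl : l = i
    · subst hl
      simp only [Matrix.updateCol_self]
      exact differentiable_const _
    · simp only [Matrix.updateCol_ne hl]
      exact hM k l
  · apply b.repr.injective
    ext i
    have h1 := congrFun (LinearMap.toMatrix_mulVec_repr b b (T t) (q t)) i
    have h2 : (b.repr (q t) : _ → ℂ) = Matrix.cramer (M t) (b.repr h) := funext (hq t)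
    rw [h2, Matrix.mulVec_cramer] at h1
    rw [← h1]
    simp [M]
  · change _ ↔ (LinearMap.toMatrix b b (T t)).det ≠ 0
    rw [LinearMap.det_toMatrix, ← isUnit_iff_ne_zero, ← LinearMap.isUnit_iff_isUnit_det,
      LinearMap.isUnit_iff_ker_eq_bot, LinearMap.ker_eq_bot']

/-- Entire functions have no zero divisors, and the value at `0` rules out the factor `δ`. -/
lemma exists_eq_zero_of_prod_mul_eq_zero {ι : Type*} (C : Finset ι) {f : ι → ℂ → ℂ}
    (hf : ∀ i ∈ C, Differentiable ℂ (f i)) {δ : ℂ → ℂ} (hδ : Differentiable ℂ δ) (h0 : δ 0 ≠ 0)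
    (h : ∀ t, (∏ i ∈ C, f i t) * δ t = 0) : ∃ i ∈ C, ∀ t, f i t = 0 := by
  classical
  have key : ∀ u v : ℂ → ℂ, Differentiable ℂ u → Differentiable ℂ v → (∀ t, u t * v t = 0) →
      (∀ t, u t = 0) ∨ ∀ t, v t = 0 := by
    intro u v hu hv huv
    have := AnalyticOnNhd.eq_zero_or_eq_zero_of_mul_eq_zero (U := Set.univ)
      (Complex.analyticOnNhd_univ_iff_differentiable.mpr hu)
      (Complex.analyticOnNhd_univ_iff_differentiable.mpr hv) (fun t _ => huv t)
      isPreconnected_univ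
    simpa using this
  induction C using Finset.induction_on with
  | empty => exact absurd (by simpa using h 0) h0
  | insert i C hi ih =>
    have hprod : Differentiable ℂ fun t => (∏ j ∈ C, f j t) * δ t := by
      have h1 := fun j (hj : j ∈ C) => hf j (Finset.mem_insert_of_mem hj)
      exact (Differentiable.fun_finsetProd h1).mul hδ
    rcases key (f i) _ (hf i (Finset.mem_insert_self _ _)) hprod (fun t => by
      have := h t
      rwa [Finset.prod_insert hi, mul_assoc] at this) with h1 | h1
    · exact ⟨i, Finset.mem_insert_self _ _, h1⟩
    · obtain ⟨j, hj, hj'⟩ := ih (fun j hj => hf j (Finset.mem_insert_of_mem hj)) h1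
      exact ⟨j, Finset.mem_insert_of_mem hj, hj'⟩

end

namespace RootFrame

variable {g : Type*} [LieRing g] [LieAlgebra ℂ g] [FiniteDimensional ℂ g]
variable [LieAlgebra.IsKilling ℂ g]
variable {R : Type*} [Fintype R] [DecidableEq R] (F : RootFrame g R)

lemma wt_π (r : R) (x : g) : F.wt r (F.π x) = F.wt r x := by
  conv_rhs => rw [← F.expand x]
  rw [map_add, map_sum, Finset.sum_eq_zero, add_zero]
  intro s _
  rw [map_smul, F.wt_e, smul_zero]

lemma sub_π_mem_npos {y : g} (hy : y ∈ F.borel) : y - F.π y ∈ F.npos := by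
  refine ⟨fun _ => by rw [map_sub, F.π_π, sub_self], fun r hr => ?_⟩
  rw [map_sub, F.coef_of_mem r _ (F.π_mem y), sub_zero]
  exact hy.2 r hr

/-- The eigenvalues of an element of the Borel subalgebra. -/
lemma exists_eigenvector {y : g} (hy : y ∈ F.borel) (r : R) :
    ∃ v ≠ (0 : g), ⁅y, v⁆ = F.wt r y • v := by
  by_contra hcon
  let L : Module.End ℂ g := LieAlgebra.ad ℂ g y - F.wt r y • 1
  have hL : ∀ v, L v = ⁅y, v⁆ - F.wt r y • v := fun v => rfl
  have hinj : Function.Injective L := by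
    rw [← LinearMap.ker_eq_bot, LinearMap.ker_eq_bot']
    intro v hv
    by_contra hv0
    exact hcon ⟨v, hv0, sub_eq_zero.mp hv⟩
  have hy' : y ∈ F.fil 0 := by rwa [← F.borel_eq_fil]
  have hn : y - F.π y ∈ F.fil 1 := by
    rw [← F.npos_eq_fil]
    exact F.sub_π_mem_npos hy
  set M := F.fil (F.ht r + 1) with hM
  -- An injective `L` would map `M`, the part of height above that of `r`, onto itself. Since `L (e
  -- r)` lies in `M`, so would `e r`.
  have hmap : M.map L = M := by
    refine Submodule.eq_of_le_of_finrank_eq ?_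
      (LinearEquiv.finrank_eq (Submodule.equivMapOfInjective L hinj M)).symm
    rintro _ ⟨v, hv, rfl⟩
    rw [hL]
    exact sub_mem (F.lie_mem_fil (by omega) hy' hv) (Submodule.smul_mem _ _ hv)
  have h1 : L (F.e r) ∈ M := by
    have h2 : L (F.e r) = ⁅y - F.π y, F.e r⁆ := by
      rw [hL, sub_lie, F.lie_e _ (F.π_mem y), F.wt_π]
    rw [h2]
    exact F.lie_mem_fil (by omega) hn (F.e_mem_sub (P := fun s => F.ht r ≤ F.ht s) le_rfl)
  rw [← hmap] at h1
  obtain ⟨v, hv, hve⟩ := h1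
  rw [hinj hve] at hv
  have h3 := hv.2 r (by omega)
  rw [F.coef_e, if_pos rfl] at h3
  exact one_ne_zero h3

lemma eq_zero_or_exists_wt_eq {h : g} (hh : h ∈ F.H) {c : ℂ} {v : g} (hv0 : v ≠ 0)
    (hv : ⁅h, v⁆ = c • v) : c = 0 ∨ ∃ s, c = F.wt s h := by
  by_contra! hcon
  refine hv0 (F.ext ?_ fun s => ?_)
  · have h1 := congrArg F.π hv
    rw [F.π_lie_H hh, map_smul, eq_comm, smul_eq_zero] at h1
    rw [map_zero]
    exact h1.resolve_left hcon.1
  · have h1 := congrArg (F.coef s) hv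
    rw [F.coef_lie_H hh, map_smul, smul_eq_mul] at h1
    rw [map_zero]
    have h2 : (c - F.wt s h) * F.coef s v = 0 := by linear_combination -h1
    exact (mul_eq_zero.mp h2).resolve_left (sub_ne_zero.mpr (hcon.2 s))

/-- `wt r (φ h)` is an eigenvalue of `ad (φ h)`, hence of the conjugate operator `ad h`. It thus
takes finitely many values for fixed `h`, which is what makes it rigid in families. -/
lemma wt_map_mem {φ : g ≃ₗ[ℂ] g} (hφ : ∀ a b, φ ⁅a, b⁆ = ⁅φ a, φ b⁆) {h : g} (hh : h ∈ F.H)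
    (hb : φ h ∈ F.borel) (r : R) : F.wt r (φ h) = 0 ∨ ∃ s, F.wt r (φ h) = F.wt s h := by
  obtain ⟨v, hv0, hv⟩ := F.exists_eigenvector hb r
  refine F.eq_zero_or_exists_wt_eq hh (v := φ.symm v) (by simpa using hv0) (φ.injective ?_)
  rw [hφ, map_smul, φ.apply_symm_apply, hv]

lemma eq_of_wt_eq {x h : g} (hh : h ∈ F.H) (hx : ∀ r, F.wt r x = F.wt r h) : F.π x = h := by
  rw [← sub_eq_zero]
  refine F.ext_simple _ (F.H.sub_mem (F.π_mem x) hh) fun i _ => ?_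
  rw [map_sub, F.wt_π, hx, sub_self]

/-- A subalgebra in general position which contains the Cartan subalgebra. -/
lemma eq_borel {V : Submodule ℂ g} (hV : ∀ x ∈ V, ∀ y ∈ V, ⁅x, y⁆ ∈ V) (hc : IsCompl V F.nneg)
    (hH : F.H ≤ V) : V = F.borel := by
  refine F.eq_of_isCompl_nneg (fun x hx => ?_) hc F.isCompl_borel_nneg
  refine ⟨fun h => absurd trivial h, fun r hr => ?_⟩
  by_contra hne
  have h1 := F.e_mem_of_coef_ne_zero (fun h hh v hv => hV _ (hH hh) _ hv) hx hne
  refine F.e_ne_zero r (Submodule.disjoint_def.mp hc.disjoint _ h1 (F.e_mem_sub ?_))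
  have := F.ht_ne_zero r
  omega

/-- A Borel subalgebra in general position is moved to the standard one by a lower unipotent
element. -/
lemma exists_isLower_map_eq_borel {P : R → Prop} (hP : F.Closed P) {φ : g ≃ₗ[ℂ] g}
    (hφ : φ ∈ adjointGroup g) (hT : F.Transversal (F.borel.map φ.toLinearMap))
    (hφP : F.borel.map φ.toLinearMap ≤ F.sub True P) :
    ∃ ν, F.IsLower P ν ∧ F.borel.map (ν * φ).toLinearMap = F.borel := by
  have hnull := F.isNullspace_borel.map (map_lie_of_mem_adjointGroup hφ)
  have hc := F.isCompl_nneg hT (LinearEquiv.finrank_map_eq φ F.borel)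
  obtain ⟨ν, hν, hH, hc'⟩ := F.exists_isLower_H_le hP hnull hc hφP
  refine ⟨ν, hν, ?_⟩
  have h1 : F.borel.map (ν * φ).toLinearMap =
      (F.borel.map φ.toLinearMap).map ν.toLinearMap := by
    rw [← Submodule.map_comp]
    rfl
  rw [← h1] at hH hc'
  refine F.eq_borel ?_ hc' hH
  rintro _ ⟨x, hx, rfl⟩ _ ⟨y, hy, rfl⟩
  exact ⟨⁅x, y⁆, F.lie_mem_borel hx hy,
    map_lie_of_mem_adjointGroup (mul_mem hν.mem hφ) x y⟩

/-- Elements of the adjoint group which normalise the Borel subalgebra act trivially on its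
largest commutative quotient. -/
lemma π_symm_of_map_borel {φ : g ≃ₗ[ℂ] g} (hφ : φ ∈ adjointGroup g)
    (hb : F.borel.map φ.toLinearMap = F.borel) {h : g} (hh : h ∈ F.H) :
    F.π (φ.symm h) = h := by
  classical
  obtain ⟨A, hA0, hA1, hAG, hAe⟩ := exists_path hφ
  let p : Module.End ℂ g := F.borel.projection F.nneg F.isCompl_borel_nneg
  have hpb : ∀ x ∈ F.borel, p x = x := fun x hx => Submodule.projection_apply_of_mem_left _ hx
  have hp0 : ∀ x ∈ F.nneg, p x = 0 := fun x hx =>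
    (Submodule.projection_apply_eq_zero_iff _).mpr hx
  have hpm : ∀ x, p x ∈ F.borel := Submodule.projection_apply_mem _
  have hps : ∀ x, x - p x ∈ F.nneg := Submodule.sub_projection_mem _
  -- `T t` is block diagonal: the compression of `A t` to `b` and the identity on `n₋`. It is
  -- invertible exactly when `A t` maps `b` to a subspace transversal to `n₋`. In that case `q t / δ
  -- t` is the unique `v ∈ b` with `A t v` in `h + n₋`, an element depending meromorphically on `t`.
  let T : ℂ → Module.End ℂ g := fun t => p * (A t : Module.End ℂ g) * p + (1 - p)
  have hT : ∀ t v, T t v = p (A t (p v)) + (v - p v) := fun t v => rfl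
  have hTe : IsEntire T := by
    intro f v
    simp only [hT, map_add]
    exact (hAe (f ∘ₗ p) (p v)).add_const _
  obtain ⟨δ, q, hδ, hq, hTq, hδ0⟩ := hTe.exists_cramer h
  have hhb : h ∈ F.borel := F.H_le_sub trivial _ hh
  have hq_unique : ∀ t, δ t ≠ 0 → ∀ v ∈ F.borel, A t v - h ∈ F.nneg → q t = δ t • v := by
    intro t ht v hv hAv
    have h1 : T t v = h := by
      have h2 := hp0 _ hAv
      rw [map_sub, hpb h hhb, sub_eq_zero] at h2
      rw [hT, hpb v hv, h2, sub_self, add_zero]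
    rw [← sub_eq_zero]
    refine (hδ0 t).mpr ht _ ?_
    rw [map_sub, map_smul, h1, hTq, sub_self]
  have hδ_zero : δ 0 ≠ 0 := by
    refine (hδ0 0).mp fun v hv => ?_
    rw [hT, hA0, LinearEquiv.coe_one, id, hpb _ (hpm v)] at hv
    simpa using hv
  have hδ_one : δ 1 ≠ 0 := by
    refine (hδ0 1).mp fun v hv => ?_
    have h1 : φ (p v) ∈ F.borel := by
      rw [← hb]
      exact ⟨_, hpm v, rfl⟩
    rw [hT, hA1, hpb _ h1] at hv
    have h2 : v - p v = - φ (p v) := by rw [eq_neg_iff_add_eq_zero, add_comm, hv]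
    have h3 : v - p v = 0 := Submodule.disjoint_def.mp F.isCompl_borel_nneg.disjoint _
      (h2 ▸ neg_mem h1) (hps v)
    rw [h3, eq_comm, neg_eq_zero, LinearEquiv.map_eq_zero_iff] at h2
    rwa [h2, sub_zero] at h3
  have hφh : φ.symm h ∈ F.borel := by
    rw [← hb] at hhb
    obtain ⟨v, hv, rfl⟩ := hhb
    change φ.symm (φ v) ∈ F.borel
    rwa [φ.symm_apply_apply]
  have hq0 : q 0 = δ 0 • h := hq_unique 0 hδ_zero h hhb (by
    rw [hA0, LinearEquiv.coe_one, id, sub_self]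
    exact zero_mem _)
  have hq1 : q 1 = δ 1 • φ.symm h := hq_unique 1 hδ_one _ hφh (by
    rw [hA1, φ.apply_symm_apply, sub_self]
    exact zero_mem _)
  -- A lower unipotent `ν` makes `ν * A t` preserve `b`, and the preimage of `h` under this product
  -- is the vector `v` above, since `ν` moves `h` only by elements of `n₋`. Its weights are
  -- therefore zero or weights of `h`.
  have hwt : ∀ t, δ t ≠ 0 → ∃ v, q t = δ t • v ∧ ∀ r, F.wt r v = 0 ∨ ∃ s, F.wt r v = F.wt s h := by
    intro t ht
    have htr : F.Transversal (F.borel.map (A t).toLinearMap) := by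
      rintro _ ⟨b, hbb, rfl⟩ hb'
      have h1 : b = 0 := (hδ0 t).mpr ht b (by
        rw [hT, hpb b hbb, sub_self, add_zero]
        exact hp0 _ hb')
      rw [h1, map_zero]
    obtain ⟨ν, hν, hνb⟩ := F.exists_isLower_map_eq_borel (P := fun _ => True)
      (fun _ _ _ _ _ _ => trivial) (hAG t) htr (by rw [F.sub_eq_top]; exact le_top)
    obtain ⟨v, hv, hvh⟩ : h ∈ F.borel.map (ν * A t).toLinearMap := by rwa [hνb]
    have hvh' : ν (A t v) = h := hvh
    have hs : (ν * A t)⁻¹ h = v := by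
      rw [← hvh]
      exact (ν * A t).symm_apply_apply v
    refine ⟨v, hq_unique t ht v hv ?_, fun r => ?_⟩
    · have hnmap : F.nneg.map ν.toLinearMap = F.nneg :=
        Submodule.eq_of_le_of_finrank_eq (by rintro _ ⟨y, hy, rfl⟩; exact hν.map_nneg y hy)
          (LinearEquiv.finrank_map_eq ν F.nneg)
      have h1 := hν.map_H h hh
      rw [← hnmap] at h1
      obtain ⟨u, hu, hu'⟩ := h1
      have h2 : A t v - h = -u := by
        apply ν.injective
        rw [map_sub, hvh', map_neg]
        change _ = -(ν.toLinearMap u)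
        rw [hu', neg_sub]
      rw [h2]
      exact neg_mem hu
    · rw [← hs]
      refine F.wt_map_mem (map_lie_of_mem_adjointGroup (inv_mem (mul_mem hν.mem (hAG t)))) hh ?_ r
      rwa [hs]
  let C : Finset ℂ := insert 0 (Finset.univ.image fun s => F.wt s h)
  refine F.eq_of_wt_eq hh fun r => ?_
  -- With finitely many possible values, `wt r (q t) = c * δ t` for one constant `c`. Comparing `t =
  -- 0`, where the vector is `h`, with `t = 1`, where it is `φ.symm h`, gives the claim.
  obtain ⟨c, -, hc⟩ := exists_eq_zero_of_prod_mul_eq_zero C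
    (f := fun c t => F.wt r (q t) - c * δ t) (fun c _ => (hq (F.wt r)).sub (hδ.const_mul c)) hδ
    hδ_zero (fun t => by
      by_cases ht : δ t = 0
      · rw [ht, mul_zero]
      · obtain ⟨v, hv, hvr⟩ := hwt t ht
        rw [Finset.prod_eq_zero (i := F.wt r v), zero_mul]
        · rcases hvr r with h1 | ⟨s, h1⟩
          · simp [C, h1]
          · simp [C, h1]
        · rw [hv, map_smul, smul_eq_mul, mul_comm, sub_self])
  have c0 := hc 0
  have c1 := hc 1
  rw [hq0, map_smul, smul_eq_mul, mul_comm, ← sub_mul, mul_eq_zero] at c0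
  rw [hq1, map_smul, smul_eq_mul, mul_comm, ← sub_mul, mul_eq_zero] at c1
  have c0' := c0.resolve_right hδ_zero
  have c1' := c1.resolve_right hδ_one
  rw [sub_eq_zero] at c0' c1'
  rw [c0', c1']

end RootFrame

end MaxNull

namespace MaxNull

/-! ### Standard parabolics are pairwise non-conjugate. -/

namespace RootFrame

variable {g : Type*} [LieRing g] [LieAlgebra ℂ g] [FiniteDimensional ℂ g]
variable [LieAlgebra.IsKilling ℂ g]
variable {R : Type*} [Fintype R] [DecidableEq R] (F : RootFrame g R)

/-- The Borel subalgebras in a standard parabolic subalgebra are conjugate under its stabiliser. -/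
lemma exists_map_borel_eq {J : Finset R} {φ : g ≃ₗ[ℂ] g} (hφ : φ ∈ adjointGroup g)
    (hJ : F.borel.map φ.toLinearMap ≤ F.par J) :
    ∃ χ ∈ adjointGroup g, (F.par J).map χ.toLinearMap = F.par J ∧
      F.borel.map (χ * φ).toLinearMap = F.borel := by
  have hfix : ∀ χ : g ≃ₗ[ℂ] g, (∀ v ∈ F.par J, χ v ∈ F.par J) →
      (F.par J).map χ.toLinearMap = F.par J := fun χ h =>
    Submodule.eq_of_le_of_finrank_eq (by rintro _ ⟨y, hy, rfl⟩; exact h y hy)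
      (LinearEquiv.finrank_map_eq χ _)
  have hUY : F.borel.map φ.toLinearMap ∈ Y g := F.mem_Y_iff.mpr
    ⟨F.isNullspace_borel.map (map_lie_of_mem_adjointGroup hφ), LinearEquiv.finrank_map_eq φ _⟩
  obtain ⟨ψ, ⟨hψ, hψJ⟩, hT⟩ := F.exists_transversal hUY
    -- Exponentials of `n₊` preserve `par J`, so general position can be reached inside its
    -- stabiliser.
    (Γ := adjointGroup g ⊓ MulAction.stabilizer (g ≃ₗ[ℂ] g) (F.par J)) fun x hx =>
      ⟨expAd_mem_adjointGroup x, hfix (expAd x) fun v hv => expAd_mem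
        (fun w hw => F.lie_mem_par (F.borel_le_par J (F.sub_mono (fun h => h.elim)
          (fun _ h => h) hx)) hw) hv⟩
  replace hψJ : (F.par J).map ψ.toLinearMap = F.par J := hψJ
  have hmap : F.borel.map (ψ * φ).toLinearMap =
      (F.borel.map φ.toLinearMap).map ψ.toLinearMap := by
    rw [← Submodule.map_comp]
    rfl
  obtain ⟨ν, hν, hνb⟩ := F.exists_isLower_map_eq_borel (F.closed_level J) (mul_mem hψ hφ)
    (by rwa [hmap]) (by
      rw [hmap]
      refine (Submodule.map_mono hJ).trans ?_
      rw [hψJ]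
      exact le_rfl)
  refine ⟨ν * ψ, mul_mem hν.mem hψ, hfix _ fun v hv => hν.map_sub _ ?_, hνb⟩
  change ψ v ∈ F.par J
  rw [← hψJ]
  exact ⟨v, hv, rfl⟩

/-- The character of a standard parabolic subalgebra. -/
noncomputable def character (J : Finset R) : g := ∑ i ∈ F.Δ \ J, F.ϖ i

lemma character_mem (J : Finset R) : F.character J ∈ F.H :=
  F.H.sum_mem fun i _ => F.ϖ_mem i

lemma wt_character (J : Finset R) (r : R) : F.wt r (F.character J) = F.level J r := by
  rw [character, map_sum, level, Int.cast_sum]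
  exact Finset.sum_congr rfl fun i hi => F.wt_ϖ r i (Finset.mem_sdiff.mp hi).1

/-- The element `character J` centralizes the Levi part, so its bracket with `y` lies in the
nilradical, which is orthogonal to `par J`. -/
lemma killingForm_lie_character {J : Finset R} {x y : g} (hx : x ∈ F.par J) (hy : y ∈ F.par J) :
    killingForm ℂ g ⁅x, y⁆ (F.character J) = 0 := by
  rw [killingForm_lie, ← lie_skew, map_neg, neg_eq_zero]
  have h1 : ⁅F.character J, y⁆ ∈ F.sub False fun r => 0 < F.level J r := by
    refine ⟨fun _ => F.π_lie_H (F.character_mem J) y, fun r hr => ?_⟩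
    rw [F.coef_lie_H (F.character_mem J), F.wt_character]
    by_cases h0 : F.level J r = 0
    · rw [h0, Int.cast_zero, zero_mul]
    · rw [hy.2 r (by omega), mul_zero]
  refine F.kill_eq_zero (by simp) (fun r h2 h3 => ?_) hx h1
  rw [F.level_neg] at h3
  omega

/-- After correction by the stabiliser of `par J`, the conjugating `ψ` preserves the Borel and so
moves elements of `H` only by `n₊`. For `i ∈ I` the element `k = ⁅e i, e (-i)⁆` is a bracket in `par
I`, so `ψ k`, and with it `k`, is orthogonal to `character J`. But that pairing is `level J i` times
a nonzero number, and the level is `1` if `i ∉ J`. -/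
lemma subset_of_map_par_eq {I J : Finset R} (hI : I ⊆ F.Δ) {φ : g ≃ₗ[ℂ] g}
    (hφ : φ ∈ adjointGroup g) (h : (F.par I).map φ.toLinearMap = F.par J) : I ⊆ J := by
  obtain ⟨χ, hχ, hχJ, hχb⟩ := F.exists_map_borel_eq hφ
    ((Submodule.map_mono (F.borel_le_par I)).trans h.le)
  set ψ := χ * φ with hψdef
  have hψ : ψ ∈ adjointGroup g := mul_mem hχ hφ
  have hψJ : ∀ v ∈ F.par I, ψ v ∈ F.par J := by
    intro v hv
    rw [← hχJ, ← h]
    exact ⟨φ v, ⟨v, hv, rfl⟩, rfl⟩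
  intro i hi
  by_contra hiJ
  have hiΔ := hI hi
  have h1 : F.e i ∈ F.par I :=
    F.borel_le_par I (F.e_mem_sub (by rw [F.ht_simple hiΔ]; omega))
  have h2 := F.e_neg_mem_par hiΔ hi
  set k := ⁅F.e i, F.e (F.neg i)⁆ with hk
  have hkH : k ∈ F.H := F.lie_e_neg_mem i
  have h3 : killingForm ℂ g (ψ k) (F.character J) = 0 := by
    rw [hk, map_lie_of_mem_adjointGroup hψ]
    exact F.killingForm_lie_character (hψJ _ h1) (hψJ _ h2)
  have hinv : F.borel.map ψ⁻¹.toLinearMap = F.borel := by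
    conv_lhs => rw [← hχb]
    rw [← Submodule.map_comp]
    have : ψ⁻¹.toLinearMap ∘ₗ ψ.toLinearMap = LinearMap.id :=
      LinearMap.ext fun v => ψ.symm_apply_apply v
    rw [this, Submodule.map_id]
  have h4 : F.π (ψ k) = k := F.π_symm_of_map_borel (inv_mem hψ) hinv hkH
  have h5 : ψ k ∈ F.borel := by
    rw [← hχb]
    exact ⟨k, F.H_le_sub trivial _ hkH, rfl⟩
  have h6 := F.kill_eq_zero (b := True) (Q := fun _ => False) (by simp) (by simp)
    (F.sub_π_mem_npos h5) (F.H_le_sub trivial _ (F.character_mem J))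
  rw [h4, map_sub, LinearMap.sub_apply, h3, zero_sub, neg_eq_zero, hk, killingForm_lie,
    ← lie_skew, F.lie_e _ (F.character_mem J), F.wt_neg, F.wt_character, F.level_simple J hiΔ,
    if_neg hiJ] at h6
  simp [F.kill_e_neg i] at h6

/-- Distinct standard parabolic subalgebras are not conjugate. -/
lemma eq_of_map_par_eq {I J : Finset R} (hI : I ⊆ F.Δ) (hJ : J ⊆ F.Δ) {φ : g ≃ₗ[ℂ] g}
    (hφ : φ ∈ adjointGroup g) (h : (F.par I).map φ.toLinearMap = F.par J) : I = J := by
  refine (F.subset_of_map_par_eq hI hφ h).antisymm (F.subset_of_map_par_eq hJ (inv_mem hφ) ?_)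
  rw [← h, ← Submodule.map_comp]
  have : φ⁻¹.toLinearMap ∘ₗ φ.toLinearMap = LinearMap.id :=
    LinearMap.ext fun v => φ.symm_apply_apply v
  rw [this, Submodule.map_id]

end RootFrame

/-! ### Counting orbits by representatives. -/

section Classification

variable {g : Type*} [LieRing g] [LieAlgebra ℂ g] [FiniteDimensional ℂ g]

lemma smul_mem_Y {φ : g ≃ₗ[ℂ] g} (hφ : φ ∈ adjointGroup g) {V : Submodule ℂ g} (hV : V ∈ Y g) :
    φ • V ∈ Y g := by
  refine ⟨hV.1.map (map_lie_of_mem_adjointGroup hφ), fun U hU => (hV.2 U hU).trans_eq ?_⟩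
  exact (LinearEquiv.finrank_map_eq φ V).symm

lemma pV_smul {φ : g ≃ₗ[ℂ] g} (hφ : φ ∈ adjointGroup g) (V : Submodule ℂ g) :
    pV g (φ • V) = φ • pV g V := pV_map (map_lie_of_mem_adjointGroup hφ) V

lemma mem_orbit_iff {V W : Submodule ℂ g} :
    W ∈ MulAction.orbit (adjointGroup g) V ↔ ∃ φ ∈ adjointGroup g, φ • V = W := by
  constructor
  · rintro ⟨⟨φ, hφ⟩, h⟩
    exact ⟨φ, hφ, h⟩
  · rintro ⟨φ, hφ, h⟩
    exact ⟨⟨φ, hφ⟩, h⟩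

lemma orbit_eq_iff {V W : Submodule ℂ g} :
    MulAction.orbit (adjointGroup g) V = MulAction.orbit (adjointGroup g) W ↔
      ∃ φ ∈ adjointGroup g, φ • V = W := by
  rw [← mem_orbit_iff, eq_comm, MulAction.orbit_eq_iff]

/-- The number of orbits meeting a system of representatives. -/
lemma ncard_orbitsOf {S : Set (Submodule ℂ g)} {R : Type*} {Δ : Finset R}
    {f : Finset R → Submodule ℂ g} (hf : ∀ I ⊆ Δ, f I ∈ S)
    (hS : ∀ V ∈ S, ∃ I ⊆ Δ, ∃ φ ∈ adjointGroup g, φ • V = f I)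
    (hinj : ∀ I ⊆ Δ, ∀ J ⊆ Δ, (∃ φ ∈ adjointGroup g, φ • f I = f J) → I = J) :
    (orbitsOf g S).ncard = 2 ^ Δ.card := by
  have h : orbitsOf g S =
      (fun I => MulAction.orbit (adjointGroup g) (f I)) '' (Δ.powerset : Set (Finset R)) := by
    ext O
    constructor
    · rintro ⟨V, hV, rfl⟩
      obtain ⟨I, hI, hφ⟩ := hS V hV
      exact ⟨I, by simpa using hI, (orbit_eq_iff.mpr hφ).symm⟩
    · rintro ⟨I, hI, rfl⟩
      exact ⟨f I, hf I (by simpa using hI), rfl⟩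
  rw [h, Set.InjOn.ncard_image, Set.ncard_coe_finset, Finset.card_powerset]
  intro I hI J hJ hIJ
  exact hinj I (by simpa using hI) J (by simpa using hJ) (orbit_eq_iff.mp hIJ)

end Classification

end MaxNull

theorem proposition6 (g : Type*) [LieRing g] [LieAlgebra ℂ g] [FiniteDimensional ℂ g]
    [LieAlgebra.IsSemisimple ℂ g] :
    -- `V + [V, V]` is the least parabolic subalgebra containing `V`
    (∀ V ∈ MaxNull.Y g, IsLeast {P | P ∈ MaxNull.parabolics g ∧ V ≤ P} (MaxNull.pV g V)) ∧
    -- two elements of `Y` with the same parabolic subalgebra are conjugate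
    (∀ V₁ ∈ MaxNull.Y g, ∀ V₂ ∈ MaxNull.Y g, MaxNull.pV g V₁ = MaxNull.pV g V₂ →
      ∃ φ ∈ MaxNull.adjointGroup g, φ • V₁ = V₂) ∧
    -- `Y` and the set of parabolic subalgebras are unions of orbits
    (∀ φ ∈ MaxNull.adjointGroup g, ∀ V ∈ MaxNull.Y g, φ • V ∈ MaxNull.Y g) ∧
    (∀ φ ∈ MaxNull.adjointGroup g, ∀ P ∈ MaxNull.parabolics g,
      φ • P ∈ MaxNull.parabolics g) ∧
    -- elements of `Y` are conjugate exactly when their parabolic subalgebras are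
    (∀ V₁ ∈ MaxNull.Y g, ∀ V₂ ∈ MaxNull.Y g,
      ((∃ φ ∈ MaxNull.adjointGroup g, φ • V₁ = V₂) ↔
        ∃ φ ∈ MaxNull.adjointGroup g, φ • MaxNull.pV g V₁ = MaxNull.pV g V₂)) ∧
    -- every parabolic subalgebra arises from an element of `Y`
    (∀ P ∈ MaxNull.parabolics g, ∃ V ∈ MaxNull.Y g, MaxNull.pV g V = P) ∧
    -- `V ↦ V + [V, V]` induces a bijection from orbits of `Y` to classes of parabolics
    Set.BijOn (fun O => MaxNull.pV g '' O)
      (MaxNull.orbitsOf g (MaxNull.Y g)) (MaxNull.orbitsOf g (MaxNull.parabolics g)) ∧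
    -- and there are `2 ^ l` of each
    (MaxNull.orbitsOf g (MaxNull.Y g)).ncard = 2 ^ LieAlgebra.rank ℂ g ∧
    (MaxNull.orbitsOf g (MaxNull.parabolics g)).ncard = 2 ^ LieAlgebra.rank ℂ g := by
  open MaxNull in
  obtain ⟨R, _, _, ⟨F⟩⟩ := exists_rootFrame g
  have hstd : ∀ V ∈ Y g, ∃ I ⊆ F.Δ, ∃ φ ∈ adjointGroup g, φ • V = F.std I :=
    fun V hV => F.exists_conj_std hV
  have hpar : ∀ P ∈ parabolics g, ∃ I ⊆ F.Δ, ∃ φ ∈ adjointGroup g, φ • P = F.par I :=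
    fun P hP => F.exists_conj_par hP
  have hinj : ∀ I ⊆ F.Δ, ∀ J ⊆ F.Δ, (∃ φ ∈ adjointGroup g, φ • F.par I = F.par J) → I = J :=
    fun I hI J hJ ⟨φ, hφ, h⟩ => F.eq_of_map_par_eq hI hJ hφ h
  have hP : ∀ φ ∈ adjointGroup g, ∀ P ∈ parabolics g, φ • P ∈ parabolics g :=
    fun φ hφ P hP => map_mem_parabolics hφ hP
  have hpV : ∀ V ∈ Y g, pV g V ∈ parabolics g := by
    intro V hV
    obtain ⟨I, -, φ, hφ, h⟩ := hstd V hV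
    have h1 := hP φ⁻¹ (inv_mem hφ) _ (F.par_mem_parabolics I)
    rwa [← F.pV_std, ← h, pV_smul hφ, inv_smul_smul] at h1
  have hconj : ∀ V₁ ∈ Y g, ∀ V₂ ∈ Y g, (∃ φ ∈ adjointGroup g, φ • V₁ = V₂) ↔
      ∃ φ ∈ adjointGroup g, φ • pV g V₁ = pV g V₂ := by
    intro V₁ hV₁ V₂ hV₂
    constructor
    · rintro ⟨φ, hφ, rfl⟩
      exact ⟨φ, hφ, (pV_smul hφ V₁).symm⟩
    · rintro ⟨φ, hφ, h⟩
      obtain ⟨I, hI, ψ₁, hψ₁, h₁⟩ := hstd V₁ hV₁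
      obtain ⟨J, hJ, ψ₂, hψ₂, h₂⟩ := hstd V₂ hV₂
      -- Conjugate parabolics give conjugate `par I` and `par J`, hence equal index sets, and both
      -- nullspaces are conjugate to the same `std I`.
      have hIJ : I = J := hinj I hI J hJ ⟨ψ₂ * φ * ψ₁⁻¹,
        mul_mem (mul_mem hψ₂ hφ) (inv_mem hψ₁), by
          rw [← F.pV_std, ← F.pV_std, ← h₁, ← h₂, pV_smul hψ₁, pV_smul hψ₂, ← h, mul_smul, mul_smul,
            inv_smul_smul]⟩
      subst hIJ
      exact ⟨ψ₂⁻¹ * ψ₁, mul_mem (inv_mem hψ₂) hψ₁, by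
        rw [mul_smul, h₁, ← h₂, inv_smul_smul]⟩
  have hsurj : ∀ P ∈ parabolics g, ∃ V ∈ Y g, pV g V = P := by
    intro P hP
    obtain ⟨I, -, φ, hφ, h⟩ := hpar P hP
    refine ⟨φ⁻¹ • F.std I, smul_mem_Y (inv_mem hφ) (F.std_mem_Y I), ?_⟩
    rw [pV_smul (inv_mem hφ), F.pV_std, ← h, inv_smul_smul]
  have himage : ∀ V : Submodule ℂ g, pV g '' MulAction.orbit (adjointGroup g) V =
      MulAction.orbit (adjointGroup g) (pV g V) := by
    intro V
    ext P
    constructor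
    · rintro ⟨_, ⟨⟨φ, hφ⟩, rfl⟩, rfl⟩
      exact ⟨⟨φ, hφ⟩, (pV_smul hφ V).symm⟩
    · rintro ⟨⟨φ, hφ⟩, rfl⟩
      exact ⟨φ • V, ⟨⟨φ, hφ⟩, rfl⟩, pV_smul hφ V⟩
  refine ⟨fun V hV => ⟨⟨hpV V hV, le_pV V⟩, ?_⟩, fun V₁ hV₁ V₂ hV₂ h => ?_,
    fun φ hφ V hV => smul_mem_Y hφ hV, hP, hconj, hsurj, ⟨?_, ?_, ?_⟩, ?_, ?_⟩
  · rintro _ ⟨⟨p, -, rfl⟩, hVp⟩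
    exact pV_le hVp fun x hx y hy => p.lie_mem hx hy
  · exact (hconj V₁ hV₁ V₂ hV₂).mpr ⟨1, one_mem _, by rw [one_smul, h]⟩
  · rintro _ ⟨V, hV, rfl⟩
    exact ⟨pV g V, hpV V hV, (himage V).symm⟩
  · rintro _ ⟨V, hV, rfl⟩ _ ⟨W, hW, rfl⟩ h
    simp only [himage] at h
    exact orbit_eq_iff.mpr ((hconj V hV W hW).mpr (orbit_eq_iff.mp h))
  · rintro _ ⟨P, hP, rfl⟩
    obtain ⟨V, hV, rfl⟩ := hsurj P hP
    exact ⟨_, ⟨V, hV, rfl⟩, himage V⟩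
  · rw [← F.card_simple]
    refine ncard_orbitsOf (fun I _ => F.std_mem_Y I) hstd fun I hI J hJ h => hinj I hI J hJ ?_
    rw [← F.pV_std, ← F.pV_std]
    exact (hconj _ (F.std_mem_Y I) _ (F.std_mem_Y J)).mp h
  · rw [← F.card_simple]
    exact ncard_orbitsOf (fun I _ => F.par_mem_parabolics I) hpar hinj
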